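/- A 2-colored graph is a simple graph whose vertices are colored red and blue; isomorphisms preserve colors, $R$ and $B$ are the sets of red and of blue vertices, and $G$ is ultrahomogeneous if every isomorphism between two finite induced subgraphs extends to an automorphism. For a color $c$, let $K_n^c$ and $\overline K{}_n^{c}$ be the complete and the edgeless graph on $n$ vertices of color $c$; let $T_c$ be the triangle with exactly two vertices of color $c$; let $D$ be the complete graph on two red and two blue vertices minus one cross edge (an edge joining a red and a blue vertex); let $\widetilde H$ be obtained from $H$ by complementing the cross edges only. $G$ is a blow-up if, for some color $c$, it arises from a 2-colored graph $H$ whose color class of $c$ is a nonempty independent set by replacing every vertex of color $c$ by an $i$-clique, for one fixed $i\in\{2,3,\dots\}\cup\{\aleph_0\}$, whose vertices are joined to the neighbors of the original vertex. $G$ is piecewise ultrahomogeneous if $G[M_R\cup M_B]$ is ultrahomogeneous for all maximal cliques $M_R$ of $G[R]$ and $M_B$ of $G[B]$. Let $\mathcal C$ be the class of finite 2-colored graphs whose color classes are disjoint unions of cliques. The Fraïssé limit of a class $\mathcal K$ of finite graphs is the countable ultrahomogeneous 2-colored graph whose finite induced subgraphs are, up to isomorphism, exactly the members of $\mathcal K$.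 Denote the Fraïssé limits of the following classes as indicated. - $G_{r,b}$ ($r,b\in\{1,2,\dots\}\cup\{\aleph_0\}$): the graphs in $\mathcal C$ whose red vertices form at most $r$ cliques and whose blue vertices form at most $b$ cliques. - $F^k_{\aleph_0,1}$: the graphs in $\mathcal C$ omitting $\overline K{}_{k+1}^{\mathrm{red}}$ and $K_2^{\mathrm{blue}}$. - $F^k_{\aleph_0,2}$: the graphs in $\mathcal C$ omitting $\overline K{}_{k+1}^{\mathrm{red}}$, $K_3^{\mathrm{blue}}$, $T_{\mathrm{blue}}$ and $\widetilde T_{\mathrm{blue}}$. - $F_{2,1}$: the graphs in $\mathcal C$ omitting $K_3^{\mathrm{red}}$, $K_2^{\mathrm{blue}}$, $T_{\mathrm{red}}$ and $\widetilde T_{\mathrm{red}}$. - $F_{\aleph_0,1}$: the graphs in $\mathcal C$ omitting $K_2^{\mathrm{blue}}$. - $F_{2,2}$: the graphs in $\mathcal C$ omitting $K_3^{c}$, $T_c$ and $\widetilde T_c$ for both colors $c$. - $F_{\aleph_0,2}$: the graphs in $\mathcal C$ omitting $K_3^{\mathrm{blue}}$, $T_{\mathrm{blue}}$ and $\widetilde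 T_{\mathrm{blue}}$. - $F_{\aleph_0,\aleph_0}$: the graphs in $\mathcal C$ omitting $D$ and $\widetilde D$. **Theorem.** Let $G$ be a countably infinite 2-colored ultrahomogeneous graph whose color classes are disjoint unions of cliques and which is not a blow-up. Then, up to interchanging the colors, exactly one of the following holds. (i) Each color class of $G$ is an independent set or a single clique, or $G\cong G_{r,b}$ for some $r,b\in\{1,2,\dots\}\cup\{\aleph_0\}$, or $G\cong F_{2,2}$. In this case $G$ is piecewise ultrahomogeneous, with exactly one exception: $G$ is not piecewise ultrahomogeneous when one color class is a single clique with at least two vertices and the other one is an independent set with at least two vertices. (ii) $G\cong F^k_{\aleph_0,1}$ for some $k\ge 2$, or $G\cong F^k_{\aleph_0,2}$ for some $k\ge 1$, or $G$ is isomorphic to one of $F_{2,1}$, $F_{\aleph_0,1}$, $F_{\aleph_0,2}$, $F_{\aleph_0,\aleph_0}$. In this case $G$ is not piecewise ultrahomogeneous. (If both color classes contain two non-adjacent vertices, then neither the exception in (i) nor $F^1_{\aleph_0,2}$ in (ii) can occur.) -/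

import Mathlib

/-- The two vertex colors. -/
inductive Color : Type
  | red : Color
  | blue : Color

/-- The color different from a given one. -/
def Color.other : Color → Color
  | .red => .blue
  | .blue => .red

/-- A 2-colored graph on the vertex type `V`: a simple graph together with a (not necessarily
proper, not necessarily surjective) coloring of its vertices in red and blue. -/
structure ColoredGraph (V : Type*) where
  graph : SimpleGraph V
  color : V → Color

namespace ColoredGraph

/-- An isomorphism of 2-colored graphs: a bijection preserving colors, adjacency and
non-adjacency. -/
structure Iso {V W : Type*} (G : ColoredGraph V) (H : ColoredGraph W) extends V ≃ W where
  map_adj : ∀ u v : V, H.graph.Adj (toEquiv u) (toEquiv v) ↔ G.graph.Adj u v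
  map_color : ∀ u : V, H.color (toEquiv u) = G.color u

/-- The induced subgraph on a set of vertices, with inherited colors. -/
def induce {V : Type*} (G : ColoredGraph V) (S : Set V) : ColoredGraph S where
  graph := G.graph.induce S
  color := fun v => G.color v

/-- Ultrahomogeneity: every isomorphism between two finite induced subgraphs extends to an
automorphism. -/
def IsUltrahomogeneous {V : Type*} (G : ColoredGraph V) : Prop :=
  ∀ S T : Set V, S.Finite → T.Finite → ∀ φ : Iso (G.induce S) (G.induce T),
    ∃ ψ : Iso G G, ∀ v : S, ψ.toEquiv (v : V) = (φ.toEquiv v : V)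

/-- `H` is realized in `G`: it is isomorphic to an induced subgraph of `G`. -/
def IsRealizedIn {W V : Type*} (H : ColoredGraph W) (G : ColoredGraph V) : Prop :=
  ∃ S : Set V, Nonempty (Iso H (G.induce S))

/-- `G` omits `H`: no induced subgraph of `G` is isomorphic to `H`. -/
def Omits {V W : Type*} (G : ColoredGraph V) (H : ColoredGraph W) : Prop :=
  ¬ H.IsRealizedIn G

/-- The set of vertices of color `c`. -/
def colorClass {V : Type*} (G : ColoredGraph V) (c : Color) : Set V :=
  {v | G.color v = c}

/-- The graph obtained by interchanging the two colors. -/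
def swap {V : Type*} (G : ColoredGraph V) : ColoredGraph V where
  graph := G.graph
  color := fun v => (G.color v).other

/-- The graph obtained by complementing the cross edges while keeping the edges inside the
color classes. -/
def crossCompl {V : Type*} (G : ColoredGraph V) : ColoredGraph V where
  graph :=
    { Adj := fun u v =>
        (G.color u = G.color v ∧ G.graph.Adj u v) ∨ (G.color u ≠ G.color v ∧ ¬ G.graph.Adj u v)
      symm := ⟨fun u v h => by
        rcases h with ⟨h, h'⟩ | ⟨h, h'⟩
        · exact Or.inl ⟨h.symm, h'.symm⟩
        · exact Or.inr ⟨h.symm, fun h'' => h' h''.symm⟩⟩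
      loopless := ⟨fun v h => by
        rcases h with ⟨_, h⟩ | ⟨h, _⟩
        · exact G.graph.loopless.irrefl v h
        · exact h rfl⟩ }
  color := G.color

/-- The color class of `c` is an independent set. -/
def IsIndep {V : Type*} (G : ColoredGraph V) (c : Color) : Prop :=
  ∀ u v : V, G.color u = c → G.color v = c → ¬ G.graph.Adj u v

/-- The color class of `c` is a single clique. -/
def IsSingleClique {V : Type*} (G : ColoredGraph V) (c : Color) : Prop :=
  ∀ u v : V, G.color u = c → G.color v = c → u ≠ v → G.graph.Adj u v

/-- The color class of `c` induces a disjoint union of cliques (adjacency is transitive on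
distinct vertices). -/
def IsCliqueUnion {V : Type*} (G : ColoredGraph V) (c : Color) : Prop :=
  ∀ u v w : V, G.color u = c → G.color v = c → G.color w = c →
    G.graph.Adj u v → G.graph.Adj v w → u ≠ w → G.graph.Adj u w

/-- The (nonempty) inclusion-wise maximal cliques of the subgraph induced by color `c`. -/
def maxCliques {V : Type*} (G : ColoredGraph V) (c : Color) : Set (Set V) :=
  {M | Maximal (fun C : Set V => C.Nonempty ∧ C ⊆ G.colorClass c ∧ G.graph.IsClique C) M}

/-- Every subgraph induced by a maximal red and a maximal blue clique is ultrahomogeneous. -/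
def IsPiecewiseUltrahomogeneous {V : Type*} (G : ColoredGraph V) : Prop :=
  ∀ M ∈ G.maxCliques Color.red, ∀ N ∈ G.maxCliques Color.blue,
    (G.induce (M ∪ N)).IsUltrahomogeneous

/-- The graph obtained from `H` by replacing every vertex `u` of color `c` by the vertices
`(u, i)`, `i : I`, where the class of color `c` becomes the lexicographic product of the old
class with the complete graph on `I`, and `(u, i)` is joined to the neighbors of `u` of the
other color. -/
def blowUp {W : Type*} (H : ColoredGraph W) (c : Color) (I : Type*) :
    ColoredGraph (({w : W // H.color w = c} × I) ⊕ {w : W // H.color w ≠ c}) where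
  graph :=
    { Adj := fun x y => match x, y with
        | .inl p, .inl q => H.graph.Adj p.1 q.1 ∨ (p.1 = q.1 ∧ p.2 ≠ q.2)
        | .inl p, .inr w => H.graph.Adj p.1 w
        | .inr w, .inl q => H.graph.Adj w q.1
        | .inr w, .inr w' => H.graph.Adj w w'
      symm := ⟨fun x y h => by
        rcases x with p | w <;> rcases y with q | w'
        · rcases h with h | ⟨h, h'⟩
          · exact Or.inl h.symm
          · exact Or.inr ⟨h.symm, h'.symm⟩
        · exact SimpleGraph.Adj.symm h
        · exact SimpleGraph.Adj.symm h
        · exact SimpleGraph.Adj.symm h⟩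
      loopless := ⟨fun x h => by
        rcases x with p | w
        · rcases h with h | ⟨_, h⟩
          · exact H.graph.loopless.irrefl _ h
          · exact h rfl
        · exact H.graph.loopless.irrefl _ h⟩ }
  color := fun x => match x with
    | .inl p => H.color p.1
    | .inr w => H.color w

/-- `G` is a blow-up: for some color `c` and some 2-colored graph `H` whose color class of `c`
is a nonempty independent set, `G` arises from `H` by replacing all vertices of color `c` by
cliques of one size in `{2, 3, …} ∪ {ℵ₀}`. -/
def IsBlowUp.{u} {V : Type u} (G : ColoredGraph V) : Prop :=
  ∃ (c : Color) (W : Type u) (H : ColoredGraph W) (I : Type),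
    Countable I ∧ Nontrivial I ∧ H.IsIndep c ∧ (H.colorClass c).Nonempty ∧
      Nonempty (Iso G (H.blowUp c I))

/-- The class of finite graphs described by `K` has `G` as its Fraïssé limit: `G` is countable
and ultrahomogeneous, and its age consists of the finite graphs satisfying `K`. -/
def IsFraisseLimit {V : Type*} (K : ∀ W : Type, ColoredGraph W → Prop)
    (G : ColoredGraph V) : Prop :=
  Countable V ∧ G.IsUltrahomogeneous ∧
    ∀ (W : Type) [Finite W] (H : ColoredGraph W), H.IsRealizedIn G ↔ K W H

/-! ### Small graphs -/

/-- The complete graph on `n` vertices of color `c`. -/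
def monoK (c : Color) (n : ℕ) : ColoredGraph (Fin n) where
  graph := ⊤
  color := fun _ => c

/-- The edgeless graph on `n` vertices of color `c`. -/
def monoCoK (c : Color) (n : ℕ) : ColoredGraph (Fin n) where
  graph := ⊥
  color := fun _ => c

/-- The triangle `T_c` with two vertices of color `c` and one vertex of the other color. -/
def triangle (c : Color) : ColoredGraph (Fin 3) where
  graph := ⊤
  color := ![c, c, c.other]

/-- The graph `D`: two red vertices `0, 1` and two blue vertices `2, 3`, with all edges
except the cross edge between `0` and `2`. -/
def diamond : ColoredGraph (Fin 4) where
  graph := (⊤ : SimpleGraph (Fin 4)).deleteEdges {s(0, 2)}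
  color := ![Color.red, Color.red, Color.blue, Color.blue]

/-! ### The amalgamation classes -/

/-- Both color classes form disjoint unions of cliques. -/
def CliqueClasses {W : Type*} (H : ColoredGraph W) : Prop :=
  ∀ c : Color, H.IsCliqueUnion c

/-- The red vertices form a disjoint union of at most `r` cliques, and the blue vertices form a
disjoint union of at most `b` cliques (limit: `G_{r,b}`). -/
def ClassG (r b : ℕ∞) (W : Type) (H : ColoredGraph W) : Prop :=
  H.CliqueClasses ∧ (H.maxCliques Color.red).encard ≤ r ∧ (H.maxCliques Color.blue).encard ≤ b

/-- Limit: `F_{ℵ₀,1}^k`. -/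
def ClassFinf1fin (k : ℕ) (W : Type) (H : ColoredGraph W) : Prop :=
  H.CliqueClasses ∧ H.Omits (monoCoK Color.red (k + 1)) ∧ H.Omits (monoK Color.blue 2)

/-- Limit: `F_{ℵ₀,2}^k`. -/
def ClassFinf2fin (k : ℕ) (W : Type) (H : ColoredGraph W) : Prop :=
  H.CliqueClasses ∧ H.Omits (monoCoK Color.red (k + 1)) ∧ H.Omits (monoK Color.blue 3) ∧
    H.Omits (triangle Color.blue) ∧ H.Omits (triangle Color.blue).crossCompl

/-- Limit: `F_{2,1}`. -/
def ClassF21 (W : Type) (H : ColoredGraph W) : Prop :=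
  H.CliqueClasses ∧ H.Omits (monoK Color.red 3) ∧ H.Omits (monoK Color.blue 2) ∧
    H.Omits (triangle Color.red) ∧ H.Omits (triangle Color.red).crossCompl

/-- Limit: `F_{ℵ₀,1}`. -/
def ClassFinf1 (W : Type) (H : ColoredGraph W) : Prop :=
  H.CliqueClasses ∧ H.Omits (monoK Color.blue 2)

/-- Limit: `F_{2,2}`. -/
def ClassF22 (W : Type) (H : ColoredGraph W) : Prop :=
  H.CliqueClasses ∧ ∀ c : Color, H.Omits (monoK c 3) ∧
    H.Omits (triangle c) ∧ H.Omits (triangle c).crossCompl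

/-- Limit: `F_{ℵ₀,2}`. -/
def ClassFinf2 (W : Type) (H : ColoredGraph W) : Prop :=
  H.CliqueClasses ∧ H.Omits (monoK Color.blue 3) ∧
    H.Omits (triangle Color.blue) ∧ H.Omits (triangle Color.blue).crossCompl

/-- Limit: `F_{ℵ₀,ℵ₀}`. -/
def ClassFinfinf (W : Type) (H : ColoredGraph W) : Prop :=
  H.CliqueClasses ∧ H.Omits diamond ∧ H.Omits diamond.crossCompl

/-! ### The two lists of the classification -/

/-- First list: each color class is an independent set or a single clique, or the graph is
`G_{r,b}` for some `r, b ∈ {1, 2, …} ∪ {ℵ₀}`, or it is `F_{2,2}`. -/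
def InListOne {V : Type*} (G : ColoredGraph V) : Prop :=
  (∀ c : Color, G.IsIndep c ∨ G.IsSingleClique c) ∨
  (∃ r b : ℕ∞, 1 ≤ r ∧ 1 ≤ b ∧ IsFraisseLimit (ClassG r b) G) ∨
  IsFraisseLimit ClassF22 G

/-- Second list. The index of the second family starts at `1`: the limit `F_{ℵ₀,2}^1` is the
graph obtained from `F_{2,1}` by complementing the edges inside its independent color class and
interchanging the colors. -/
def InListTwo {V : Type*} (G : ColoredGraph V) : Prop :=
  (∃ k : ℕ, 2 ≤ k ∧ IsFraisseLimit (ClassFinf1fin k) G) ∨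
  (∃ k : ℕ, 1 ≤ k ∧ IsFraisseLimit (ClassFinf2fin k) G) ∨
  IsFraisseLimit ClassF21 G ∨
  IsFraisseLimit ClassFinf1 G ∨
  IsFraisseLimit ClassFinf2 G ∨
  IsFraisseLimit ClassFinfinf G

/-- One color class is a single clique with at least two vertices, and the other one is an
independent set with at least two vertices. -/
def IsMixed {V : Type*} (G : ColoredGraph V) : Prop :=
  ∃ c : Color, G.IsSingleClique c ∧ (G.colorClass c).Nontrivial ∧
    G.IsIndep c.other ∧ (G.colorClass c.other).Nontrivial

/-- `P` holds for `G`, possibly after interchanging the colors of `G`. -/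
def UpToSwap {V : Type*} (P : ColoredGraph V → Prop) (G : ColoredGraph V) : Prop :=
  P G ∨ P G.swap

end ColoredGraph

/-!
Let `G` be an ultrahomogeneous 2-colored graph whose color classes are disjoint unions of cliques.
The main tool is `IsUltrahomogeneous.exists_sameClique`: two vertices with the same color and the
same neighbors in a finite set `C` of vertices of the other color are conjugate over `C`, so their
cliques realize the same patterns of adjacency to `C`.

*Cliques are split.* If `G` is not a blow-up, every vertex splits each nontrivial clique of the
other color into neighbors and non-neighbors (`splits_of_not_isBlowUp`). If there are several
cliques of that color and they have more than two vertices, both parts are infinite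
(`Splits.splitsInf`). Moving a finite set of vertices inside their cliques then shows that every
pattern of adjacency to finitely many vertices of one color is realized by a vertex of the other
color (`Splits.exists_pattern`, `Splits.exists_pattern_notMem`).

*Patterns inside one clique.* Consider two vertices `x`, `y` of one color. Either every clique of
the other color realizes all four patterns over `{x, y}`, or on each clique the adjacencies to `x`
and to `y` agree or are opposite (`Splits.fullOver_or_evenPair`). If the cliques are split into
infinite parts, the second alternative is possible only for `x` and `y` in a common clique
(`SplitsInf.fullOver_pair`). A minimal family over which some clique misses a pattern satisfies a
parity condition, in which an element can be exchanged for a new one. Comparing the two conditions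
makes the exchanged pair even, a contradiction (`fullOver_of_exchange`). Hence cliques realize all
patterns over sets of vertices from different cliques, and over arbitrary finite sets unless `G`
is `Even`, which means that all cliques of different colors are joined by agreeing or opposite
adjacencies.

*The classification.* These facts allow to embed a finite graph satisfying the evident necessary
conditions vertex by vertex, all vertices of one color first (`isRealizedIn_of_hasStep` and the
lemmas `isRealizedIn_of_indep_or_clique`, `isRealizedIn_of_triFree`,
`isRealizedIn_of_clique_patterns`, `isRealizedIn_of_even`). This determines the finite induced
subgraphs of `G`, according to the numbers and the sizes of the cliques of both colors, and so
identifies `G` as one of the listed Fraïssé limits (`IsAdmissible.upToSwap`).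

*Piecewise ultrahomogeneity.* Over a finite part of a maximal clique, each maximal clique of the
other color in `G_{r,b}` realizes every pattern, and in `F_{2,2}` one vertex of a clique
determines the adjacencies to the other vertex, which gives the positive results. A graph of the
second list contains a red and a blue maximal clique inducing a graph that is not
ultrahomogeneous: either one of them is a vertex that splits the other, or two of three red
vertices have the same neighbors in the blue clique and the third one has not. It also has a color
class that is neither independent nor a clique (`InListTwo.properties`). Together with
`InListOne.properties` this shows that the two lists are disjoint.
-/

namespace ColoredGraph

/-! ### Cliques of a color class and automorphisms -/

/-- Two vertices lie in the same clique of their common color class. For graphs whose color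
classes are disjoint unions of cliques this is an equivalence relation. -/
def SameClique {V : Type*} (G : ColoredGraph V) (u v : V) : Prop :=
  G.color u = G.color v ∧ (u = v ∨ G.graph.Adj u v)

/-- The clique of `u` in its color class. -/
def cliqueOf {V : Type*} (G : ColoredGraph V) (u : V) : Set V :=
  {v | G.SameClique u v}

theorem SameClique.refl {V : Type*} (G : ColoredGraph V) (u : V) : G.SameClique u u :=
  ⟨rfl, Or.inl rfl⟩

theorem SameClique.symm {V : Type*} {G : ColoredGraph V} {u v : V} (h : G.SameClique u v) :
    G.SameClique v u :=
  ⟨h.1.symm, h.2.imp Eq.symm SimpleGraph.Adj.symm⟩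

theorem SameClique.trans {V : Type*} {G : ColoredGraph V} (hC : G.CliqueClasses) {u v w : V}
    (h : G.SameClique u v) (h' : G.SameClique v w) : G.SameClique u w := by
  refine ⟨h.1.trans h'.1, ?_⟩
  by_cases huw : u = w
  · exact Or.inl huw
  · rcases h.2 with rfl | h2
    · exact h'.2
    · rcases h'.2 with rfl | h2'
      · exact Or.inr h2
      · exact Or.inr (hC (G.color u) u v w rfl h.1.symm (h.1.trans h'.1).symm h2 h2' huw)

theorem SameClique.color_eq {V : Type*} {G : ColoredGraph V} {u v : V} (h : G.SameClique u v) :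
    G.color v = G.color u := h.1.symm

theorem SameClique.adj {V : Type*} {G : ColoredGraph V} {u v : V} (h : G.SameClique u v)
    (hne : u ≠ v) : G.graph.Adj u v := h.2.resolve_left hne

theorem adj_iff_sameClique {V : Type*} {G : ColoredGraph V} {u v : V}
    (h : G.color u = G.color v) : G.graph.Adj u v ↔ u ≠ v ∧ G.SameClique u v :=
  ⟨fun h' => ⟨h'.ne, h, Or.inr h'⟩, fun h' => h'.2.adj h'.1⟩

theorem color_eq_of_ne_of_ne {a b c : Color} (h : a ≠ c) (h' : b ≠ c) : a = b := by
  cases a <;> cases b <;> cases c <;> simp_all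

theorem color_ne_iff_eq_other {a c : Color} : a ≠ c ↔ a = c.other := by
  cases a <;> cases c <;> simp [Color.other]

/-- A permutation of the vertices is an automorphism. -/
def IsAut {V : Type*} (G : ColoredGraph V) (ψ : V ≃ V) : Prop :=
  (∀ u v, G.graph.Adj (ψ u) (ψ v) ↔ G.graph.Adj u v) ∧ ∀ u, G.color (ψ u) = G.color u

theorem IsAut.symm {V : Type*} {G : ColoredGraph V} {ψ : V ≃ V} (h : G.IsAut ψ) :
    G.IsAut ψ.symm := by
  refine ⟨fun u v => ?_, fun u => ?_⟩
  · rw [← h.1, ψ.apply_symm_apply, ψ.apply_symm_apply]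
  · rw [← h.2, ψ.apply_symm_apply]

theorem IsAut.sameClique {V : Type*} {G : ColoredGraph V} {ψ : V ≃ V} (h : G.IsAut ψ) {u v : V} :
    G.SameClique (ψ u) (ψ v) ↔ G.SameClique u v := by
  simp only [SameClique, h.1, h.2, EmbeddingLike.apply_eq_iff_eq]

/-- The map `f` restricts to an isomorphism from `H[S]` onto an induced subgraph of `G`. -/
structure IsEmbOn {W V : Type*} (H : ColoredGraph W) (G : ColoredGraph V) (S : Set W)
    (f : W → V) : Prop where
  inj : Set.InjOn f S
  color : ∀ w ∈ S, G.color (f w) = H.color w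
  adj : ∀ w ∈ S, ∀ w' ∈ S, G.graph.Adj (f w) (f w') ↔ H.graph.Adj w w'

theorem IsEmbOn.sameClique {W V : Type*} {H : ColoredGraph W} {G : ColoredGraph V} {S : Set W}
    {f : W → V} (h : IsEmbOn H G S f) {w w' : W} (hw : w ∈ S) (hw' : w' ∈ S) :
    G.SameClique (f w) (f w') ↔ H.SameClique w w' := by
  simp only [SameClique, h.adj w hw w' hw', h.color w hw, h.color w' hw', h.inj.eq_iff hw hw']

theorem isRealizedIn_iff {W V : Type*} {H : ColoredGraph W} {G : ColoredGraph V} :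
    H.IsRealizedIn G ↔ ∃ f : W → V, IsEmbOn H G Set.univ f := by
  constructor
  · rintro ⟨S, ⟨φ⟩⟩
    exact ⟨fun w => φ.toEquiv w, fun a _ b _ h => φ.toEquiv.injective (Subtype.ext h),
      fun w _ => φ.map_color w, fun w _ w' _ => φ.map_adj w w'⟩
  · rintro ⟨f, hf⟩
    have hinj : Function.Injective f := fun a b h => hf.inj trivial trivial h
    exact ⟨Set.range f, ⟨{
      toEquiv := Equiv.ofInjective f hinj
      map_adj := fun u v => hf.adj u trivial v trivial
      map_color := fun u => hf.color u trivial }⟩⟩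

theorem IsRealizedIn.trans {U W V : Type*} {F : ColoredGraph U} {H : ColoredGraph W}
    {G : ColoredGraph V} (h : F.IsRealizedIn H) (h' : H.IsRealizedIn G) : F.IsRealizedIn G := by
  rw [isRealizedIn_iff] at *
  obtain ⟨f, hf⟩ := h
  obtain ⟨g, hg⟩ := h'
  exact ⟨g ∘ f, fun a _ b _ h => hf.inj trivial trivial (hg.inj trivial trivial h),
    fun w _ => (hg.color _ trivial).trans (hf.color _ trivial),
    fun w _ w' _ => (hg.adj _ trivial _ trivial).trans (hf.adj _ trivial _ trivial)⟩

theorem Omits.of_isRealizedIn {U W V : Type*} {F : ColoredGraph U} {H : ColoredGraph W}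
    {G : ColoredGraph V} (h : G.Omits F) (h' : H.IsRealizedIn G) : H.Omits F :=
  fun h'' => h (h''.trans h')

theorem isUltrahomogeneous_iff {V : Type*} {G : ColoredGraph V} :
    G.IsUltrahomogeneous ↔ ∀ S : Set V, S.Finite → ∀ f : V → V, IsEmbOn G G S f →
      ∃ ψ : V ≃ V, G.IsAut ψ ∧ ∀ v ∈ S, ψ v = f v := by
  constructor
  · intro hG S hS f hf
    obtain ⟨ψ, hψ⟩ := hG S (f '' S) hS (hS.image f)
      { toEquiv := Equiv.Set.imageOfInjOn f S hf.inj
        map_adj := fun u v => hf.adj u u.2 v v.2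
        map_color := fun u => hf.color u u.2 }
    exact ⟨ψ.toEquiv, ⟨ψ.map_adj, ψ.map_color⟩, fun v hv => hψ ⟨v, hv⟩⟩
  · intro h S T hS _ φ
    classical
    obtain ⟨ψ, hψ, hψS⟩ := h S hS (fun v => if hv : v ∈ S then (φ.toEquiv ⟨v, hv⟩ : V) else v) (by
      refine ⟨fun a ha b hb hab => ?_, fun w hw => ?_, fun w hw w' hw' => ?_⟩
      · simp only [ha, hb, dif_pos] at hab
        simpa using φ.toEquiv.injective (Subtype.ext hab)
      · simp only [hw, dif_pos]
        exact φ.map_color ⟨w, hw⟩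
      · simp only [hw, hw', dif_pos]
        exact φ.map_adj ⟨w, hw⟩ ⟨w', hw'⟩)
    exact ⟨{ toEquiv := ψ, map_adj := hψ.1, map_color := hψ.2 }, fun v => by
      simpa using hψS v v.2⟩

theorem IsUltrahomogeneous.exists_aut {V : Type*} {G : ColoredGraph V}
    (hG : G.IsUltrahomogeneous) {S : Set V} (hS : S.Finite) {f : V → V} (hf : IsEmbOn G G S f) :
    ∃ ψ : V ≃ V, G.IsAut ψ ∧ ∀ v ∈ S, ψ v = f v :=
  isUltrahomogeneous_iff.1 hG S hS f hf

/-- Two vertices with the same color and the same neighbors in a finite set `C` are conjugate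
over `C`. -/
theorem IsUltrahomogeneous.exists_aut_fix {V : Type*} {G : ColoredGraph V}
    (hG : G.IsUltrahomogeneous) {C : Set V} (hC : C.Finite) {x y : V} (hx : x ∉ C) (hy : y ∉ C)
    (hxy : G.color x = G.color y) (hadj : ∀ z ∈ C, G.graph.Adj z x ↔ G.graph.Adj z y) :
    ∃ ψ : V ≃ V, G.IsAut ψ ∧ ψ x = y ∧ ∀ z ∈ C, ψ z = z := by
  classical
  have hne : ∀ z ∈ C, z ≠ x := fun z hz h => hx (h ▸ hz)
  have hne' : ∀ z ∈ C, z ≠ y := fun z hz h => hy (h ▸ hz)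
  obtain ⟨ψ, hψ, hψS⟩ := hG.exists_aut (hC.insert x) (f := Function.update id x y) (by
    refine ⟨?_, ?_, ?_⟩
    · rintro a (rfl | ha) b (rfl | hb) hab
      · rfl
      · simp [hne b hb] at hab
        exact absurd hab.symm (hne' b hb)
      · simp [hne a ha] at hab
        exact absurd hab (hne' a ha)
      · simpa [hne a ha, hne b hb] using hab
    · rintro a (rfl | ha)
      · simp [hxy]
      · simp [hne a ha]
    · rintro a (rfl | ha) b (rfl | hb)
      · simp
      · simp only [Function.update_self, Function.update_of_ne (hne b hb), id]
        rw [G.graph.adj_comm, ← hadj b hb, G.graph.adj_comm]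
      · simp only [Function.update_self, Function.update_of_ne (hne a ha), id]
        rw [← hadj a ha]
      · simp [hne a ha, hne b hb])
  exact ⟨ψ, hψ, by simpa using hψS x (Or.inl rfl),
    fun z hz => by simpa [hne z hz] using hψS z (Or.inr hz)⟩

theorem IsUltrahomogeneous.exists_aut_apply {V : Type*} {G : ColoredGraph V}
    (hG : G.IsUltrahomogeneous) {x y : V} (hxy : G.color x = G.color y) :
    ∃ ψ : V ≃ V, G.IsAut ψ ∧ ψ x = y := by
  obtain ⟨ψ, h, h', -⟩ := hG.exists_aut_fix Set.finite_empty (Set.notMem_empty x)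
    (Set.notMem_empty y) hxy (by simp)
  exact ⟨ψ, h, h'⟩

theorem IsUltrahomogeneous.exists_aut_pair {V : Type*} {G : ColoredGraph V}
    (hG : G.IsUltrahomogeneous) {x y x' y' : V} (hx : G.color x = G.color x')
    (hy : G.color y = G.color y') (hxy : x ≠ y) (hxy' : x' ≠ y')
    (hadj : G.graph.Adj x y ↔ G.graph.Adj x' y') :
    ∃ ψ : V ≃ V, G.IsAut ψ ∧ ψ x = x' ∧ ψ y = y' := by
  obtain ⟨ψ, hψ, hψx⟩ := hG.exists_aut_apply hx
  obtain ⟨θ, hθ, hθy, hθx⟩ := hG.exists_aut_fix (C := {x'}) (Set.finite_singleton x')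
    (x := ψ y) (y := y') (by simpa [← hψx] using hxy.symm) (by simpa using hxy'.symm)
    (by rw [hψ.2, hy]) (by simp only [Set.mem_singleton_iff, forall_eq]
                           have := hψ.1 x y
                           rw [hψx] at this
                           rw [← hadj, this])
  refine ⟨ψ.trans θ, ⟨fun u v => ?_, fun u => ?_⟩, ?_, hθy⟩
  · exact (hθ.1 _ _).trans (hψ.1 _ _)
  · exact (hθ.2 _).trans (hψ.2 _)
  · simpa [hψx] using hθx x' rfl

/-- If `w` and `v` have the same color and the same neighbors in `C`, then every pattern over `C`
occurring in the clique of `w` occurs in the clique of `v`. -/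
theorem IsUltrahomogeneous.exists_sameClique {V : Type*} {G : ColoredGraph V}
    (hG : G.IsUltrahomogeneous) {C : Set V} (hC : C.Finite) {w v w' : V}
    (hcol : ∀ z ∈ C, G.color z ≠ G.color w) (hwv : G.color w = G.color v)
    (hadj : ∀ z ∈ C, G.graph.Adj z w ↔ G.graph.Adj z v) (hw' : G.SameClique w w') :
    ∃ v', G.SameClique v v' ∧ ∀ z ∈ C, G.graph.Adj z v' ↔ G.graph.Adj z w' := by
  obtain ⟨ψ, hψ, hψw, hψC⟩ := hG.exists_aut_fix hC (x := w) (y := v)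
    (fun h => hcol w h rfl) (fun h => hcol v h hwv.symm) hwv hadj
  refine ⟨ψ w', by rwa [← hψw, hψ.sameClique], fun z hz => ?_⟩
  conv_lhs => rw [← hψC z hz]
  exact hψ.1 z w'

theorem mem_maxCliques_iff {V : Type*} {G : ColoredGraph V} (hC : G.CliqueClasses) {c : Color}
    {M : Set V} : M ∈ G.maxCliques c ↔ ∃ u, G.color u = c ∧ M = G.cliqueOf u := by
  have hgood : ∀ u, G.color u = c → (G.cliqueOf u).Nonempty ∧ G.cliqueOf u ⊆ G.colorClass c ∧
      G.graph.IsClique (G.cliqueOf u) := fun u hu =>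
    ⟨⟨u, SameClique.refl G u⟩, fun v hv => hv.1.symm.trans hu, fun v hv w hw hne =>
      (SameClique.trans hC (SameClique.symm hv) hw).adj hne⟩
  have hle : ∀ (N : Set V) u, u ∈ N → N ⊆ G.colorClass c → G.graph.IsClique N →
      N ⊆ G.cliqueOf u := fun N u hu hN hN' v hv =>
    ⟨(hN hu).trans (hN hv).symm, or_iff_not_imp_left.2 fun hne => hN' hu hv hne⟩
  constructor
  · rintro ⟨⟨⟨u, hu⟩, h2, h3⟩, hmax⟩
    exact ⟨u, h2 hu, (hle M u hu h2 h3).antisymm (hmax (hgood u (h2 hu)) (hle M u hu h2 h3))⟩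
  · rintro ⟨u, hu, rfl⟩
    exact ⟨hgood u hu, fun N hN hN' => hle N u (hN' (SameClique.refl G u)) hN.2.1 hN.2.2⟩

theorem cliqueOf_eq_iff {V : Type*} {G : ColoredGraph V} (hC : G.CliqueClasses) {u v : V} :
    G.cliqueOf u = G.cliqueOf v ↔ G.SameClique u v := by
  constructor
  · intro h
    exact (show v ∈ G.cliqueOf u from h ▸ SameClique.refl G v)
  · intro h
    ext w
    exact ⟨fun h' => SameClique.trans hC h.symm h', fun h' => SameClique.trans hC h h'⟩

/-! ### Splitting of cliques and blow-ups -/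

/-- Every vertex of color different from `c` has a neighbor and a non-neighbor in every clique of
color `c`. -/
def Splits {V : Type*} (G : ColoredGraph V) (c : Color) : Prop :=
  ∀ b u, G.color b ≠ c → G.color u = c →
    (∃ v, G.SameClique u v ∧ G.graph.Adj b v) ∧ ∃ v, G.SameClique u v ∧ ¬ G.graph.Adj b v

/-- If one vertex splits one clique, then by ultrahomogeneity it splits all of them: its
stabilizer is transitive on its neighbors and on its non-neighbors. -/
theorem Splits.of_exists {V : Type*} {G : ColoredGraph V} (hG : G.IsUltrahomogeneous)
    {b u v : V} (hb : G.color b ≠ G.color u) (huv : G.SameClique u v)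
    (hbu : G.graph.Adj b u) (hbv : ¬ G.graph.Adj b v) : G.Splits (G.color u) := by
  intro b' w hb' hw
  obtain ⟨ψ, hψ, rfl⟩ := hG.exists_aut_apply (color_eq_of_ne_of_ne hb hb')
  have key : ∀ x y, G.SameClique u x → G.SameClique x y →
      (G.graph.Adj (ψ b) w ↔ G.graph.Adj b x) →
      ∃ z, G.SameClique w z ∧ (G.graph.Adj (ψ b) z ↔ G.graph.Adj b y) := by
    intro x y hux hxy hw'
    obtain ⟨z, hz, hz'⟩ := hG.exists_sameClique (Set.finite_singleton (ψ b)) (w := ψ x) (v := w)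
      (w' := ψ y) (by simpa [hψ.2, hux.color_eq] using hb) (by rw [hψ.2, hux.color_eq, hw])
      (by simp [hψ.1, hw']) (hψ.sameClique.2 hxy)
    exact ⟨z, hz, by simpa [hψ.1] using hz'⟩
  by_cases h : G.graph.Adj (ψ b) w
  · obtain ⟨z, hz, hz'⟩ := key u v (SameClique.refl G u) huv (by simp [h, hbu])
    exact ⟨⟨w, SameClique.refl G w, h⟩, z, hz, fun h' => hbv (hz'.1 h')⟩
  · obtain ⟨z, hz, hz'⟩ := key v u huv huv.symm (by simp [h, hbv])
    exact ⟨⟨z, hz, hz'.2 hbu⟩, w, SameClique.refl G w, h⟩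

/-- If no vertex splits a clique of color `c`, then `G` is the blow-up of the graph induced by
the other vertices and one representative of each clique of color `c`. -/
theorem isBlowUp_of_forall_adj_iff.{u} {V : Type u} [Countable V] {G : ColoredGraph V}
    (hG : G.IsUltrahomogeneous) (hC : G.CliqueClasses) {u₀ v₀ : V}
    (h₀ : G.color u₀ = G.color v₀) (hadj : G.graph.Adj u₀ v₀)
    (hsplit : ∀ b u v, G.color b ≠ G.color u₀ → G.color u = G.color u₀ → G.SameClique u v →
      (G.graph.Adj b u ↔ G.graph.Adj b v)) : G.IsBlowUp := by
  classical
  obtain ⟨ι, hι⟩ := exists_injective_nat V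
  set c := G.color u₀ with hc
  have hsetoid : Equivalence G.SameClique :=
    ⟨SameClique.refl G, SameClique.symm, SameClique.trans hC⟩
  let s : Setoid V := ⟨G.SameClique, hsetoid⟩
  -- `rep v` is the chosen representative of the clique of `v`
  let rep : V → V := fun v => (Quotient.mk s v).out
  have hrep : ∀ v, G.SameClique v (rep v) := fun v => (Quotient.mk_out (s := s) v).symm
  have hrep' : ∀ u v, G.SameClique u v → rep u = rep v := fun u v h =>
    congrArg Quotient.out (Quotient.sound (s := s) h)
  have hψ : ∀ w, G.color w = c → ∃ ψ : V ≃ V, G.IsAut ψ ∧ ψ w = u₀ := fun w hw =>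
    hG.exists_aut_apply hw
  choose! ψ hψ hψw using hψ
  let I : Type := ι '' G.cliqueOf u₀
  -- the index of `v` is read off after moving the clique of `v` to the clique of `u₀`
  have hidx : ∀ v, G.color v = c → ι (ψ (rep v) v) ∈ ι '' G.cliqueOf u₀ := fun v hv => by
    have hr : G.color (rep v) = c := by rw [(hrep v).color_eq, hv]
    refine ⟨_, ?_, rfl⟩
    have := (hψ (rep v) hr).sameClique.2 (hrep v).symm
    rwa [hψw _ hr] at this
  let W : Set V := {v | G.color v = c → rep v = v}
  let F : V → (({w : W // (G.induce W).color w = c} × I) ⊕ {w : W // (G.induce W).color w ≠ c}) :=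
    fun v => if hv : G.color v = c then
      .inl (⟨⟨rep v, fun _ => hrep' _ _ (hrep v).symm⟩, (hrep v).color_eq.trans hv⟩,
        ⟨ι (ψ (rep v) v), hidx v hv⟩)
      else .inr ⟨⟨v, fun h => absurd h hv⟩, hv⟩
  have hF : Function.Bijective F := by
    constructor
    · intro x y hxy
      by_cases hx : G.color x = c <;> by_cases hy : G.color y = c <;>
        simp only [F, hx, hy, dif_pos, dif_neg, not_false_eq_true, Sum.inl.injEq, Sum.inr.injEq,
          Prod.mk.injEq, reduceCtorEq] at hxy
      · have h1 : rep x = rep y := congrArg (fun z => z.1.1) hxy.1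
        have h2 : ι (ψ (rep x) x) = ι (ψ (rep y) y) := congrArg Subtype.val hxy.2
        rw [h1] at h2
        exact (ψ (rep y)).injective (hι h2)
      · exact congrArg (fun z => z.1.1) hxy
    · rintro (⟨⟨⟨w, hw⟩, hwc⟩, ⟨_, ⟨x, hx, rfl⟩⟩⟩ | ⟨⟨w, hw⟩, hwc⟩)
      · have hwc' : G.color w = c := hwc
        have hwr := hw hwc'
        have hwx : G.SameClique w ((ψ w).symm x) := by
          rw [← (hψ w hwc').sameClique, hψw w hwc', Equiv.apply_symm_apply]
          exact hx
        have h1 : G.color ((ψ w).symm x) = c := hwx.color_eq.trans hwc'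
        have h2 : rep ((ψ w).symm x) = w := (hrep' _ _ hwx.symm).trans hwr
        refine ⟨(ψ w).symm x, ?_⟩
        simp only [F, h1, dif_pos, Sum.inl.injEq, Prod.mk.injEq]
        refine ⟨Subtype.ext (Subtype.ext h2), Subtype.ext ?_⟩
        change ι (ψ (rep ((ψ w).symm x)) ((ψ w).symm x)) = ι x
        rw [h2, Equiv.apply_symm_apply]
      · have hwc' : ¬ G.color w = c := hwc
        exact ⟨w, by simp only [F, hwc', dif_neg, not_false_eq_true]⟩
  refine ⟨c, W, G.induce W, I, inferInstance, ?_, ?_, ?_, ⟨?_⟩⟩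
  · refine ⟨⟨ι u₀, u₀, SameClique.refl G u₀, rfl⟩, ⟨ι v₀, v₀, ⟨h₀, Or.inr hadj⟩, rfl⟩, ?_⟩
    intro h
    exact hadj.ne (hι (congrArg Subtype.val h))
  · rintro ⟨x, hx⟩ ⟨y, hy⟩ hxc hyc hxy
    have hxc' : G.color x = c := hxc
    have hyc' : G.color y = c := hyc
    have hxy' : G.graph.Adj x y := hxy
    have := hrep' x y ⟨hxc'.trans hyc'.symm, Or.inr hxy'⟩
    rw [hx hxc', hy hyc'] at this
    exact hxy'.ne this
  · exact ⟨⟨rep u₀, fun _ => hrep' _ _ (hrep u₀).symm⟩, (hrep u₀).color_eq⟩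
  · refine { toEquiv := Equiv.ofBijective F hF, map_adj := fun x y => ?_, map_color := fun x => ?_ }
    · rw [Equiv.ofBijective_apply, Equiv.ofBijective_apply]
      by_cases hx : G.color x = c <;> by_cases hy : G.color y = c <;>
        simp only [F, hx, hy, dif_pos, dif_neg, not_false_eq_true, blowUp]
      · rw [adj_iff_sameClique (hx.trans hy.symm)]
        constructor
        · rintro (h | ⟨h, h'⟩)
          · have h : G.graph.Adj (rep x) (rep y) := h
            have h1 : G.SameClique (rep x) (rep y) :=
              ⟨by rw [(hrep x).color_eq, (hrep y).color_eq, hx, hy], Or.inr h⟩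
            have := hrep' _ _ h1
            rw [hrep' _ _ (hrep x).symm, hrep' _ _ (hrep y).symm] at this
            exact absurd this h.ne
          · have h1 : rep x = rep y := congrArg (fun z => z.1.1) h
            refine ⟨fun hxy => h' (Subtype.ext ?_), ?_⟩
            · change ι (ψ (rep x) x) = ι (ψ (rep y) y)
              rw [hxy]
            have := (hrep y).symm
            rw [← h1] at this
            exact SameClique.trans hC (hrep x) this
        · rintro ⟨h, h'⟩
          refine Or.inr ⟨Subtype.ext (Subtype.ext (hrep' _ _ h')), fun h3 => h ?_⟩
          have h2 : ι (ψ (rep x) x) = ι (ψ (rep y) y) := congrArg Subtype.val h3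
          rw [hrep' _ _ h'] at h2
          exact (ψ (rep y)).injective (hι h2)
      · change G.graph.Adj (rep x) y ↔ _
        rw [G.graph.adj_comm, hsplit y (rep x) x hy ((hrep x).color_eq.trans hx) (hrep x).symm,
          G.graph.adj_comm]
      · change G.graph.Adj x (rep y) ↔ _
        exact hsplit x (rep y) y hx ((hrep y).color_eq.trans hy) (hrep y).symm
      · rfl
    · rw [Equiv.ofBijective_apply]
      by_cases hx : G.color x = c <;> simp only [F, hx, dif_pos, dif_neg, not_false_eq_true, blowUp]
      · exact (hrep x).color_eq.trans hx
      · rfl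

/-- In an ultrahomogeneous graph that is not a blow-up, every vertex splits all cliques with at
least two vertices of the other color. -/
theorem splits_of_not_isBlowUp.{u} {V : Type u} [Countable V] {G : ColoredGraph V}
    (hG : G.IsUltrahomogeneous) (hC : G.CliqueClasses) (hB : ¬ G.IsBlowUp) {c : Color}
    (hc : ¬ G.IsIndep c) : G.Splits c ∧ ∃ b, G.color b ≠ c := by
  simp only [IsIndep, not_forall, not_not] at hc
  obtain ⟨u₀, v₀, rfl, hv₀, hadj⟩ := hc
  by_contra hcon
  refine hB (isBlowUp_of_forall_adj_iff hG hC hv₀.symm hadj fun b u v hb hu huv => ?_)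
  by_contra hne
  apply hcon
  by_cases hbu : G.graph.Adj b u
  · have hbv : ¬ G.graph.Adj b v := fun h => hne ⟨fun _ => h, fun _ => hbu⟩
    exact ⟨hu ▸ Splits.of_exists hG (hu.symm ▸ hb) huv hbu hbv, b, hb⟩
  · have hbv : G.graph.Adj b v := by tauto
    have hv : G.color v = G.color u₀ := huv.color_eq.trans hu
    exact ⟨hv ▸ Splits.of_exists hG (hv.symm ▸ hb) huv.symm hbv hbu, b, hb⟩

/-! ### Realizing adjacency patterns over one color class -/

/-- Every vertex of color different from `c` has infinitely many neighbors and infinitely many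
non-neighbors in every clique of color `c`. -/
def SplitsInf {V : Type*} (G : ColoredGraph V) (c : Color) : Prop :=
  ∀ b u, G.color b ≠ c → G.color u = c → ∀ ε : Prop,
    {v | G.SameClique u v ∧ (G.graph.Adj b v ↔ ε)}.Infinite

/-- The cliques of color `c` have at most two vertices. -/
def TriFree {V : Type*} (G : ColoredGraph V) (c : Color) : Prop :=
  ∀ x y z, G.color x = c → G.color y = c → G.color z = c →
    G.graph.Adj x y → G.graph.Adj y z → G.graph.Adj x z → False

/-- No finite set of vertices meets all cliques of color `c`. -/
def ManyCliques {V : Type*} (G : ColoredGraph V) (c : Color) : Prop :=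
  ∀ F : Set V, F.Finite → ∃ y, G.color y = c ∧ ∀ a ∈ F, ¬ G.SameClique a y

/-- The pattern `X` on `A` separates adjacent vertices of `A`. -/
def SeparatesAdj {V : Type*} (G : ColoredGraph V) (A : Set V) (X : V → Prop) : Prop :=
  ∀ a ∈ A, ∀ a' ∈ A, G.graph.Adj a a' → (X a ↔ ¬ X a')

theorem Splits.exists_adj_iff {V : Type*} {G : ColoredGraph V} {c : Color} (h : G.Splits c)
    {b u : V} (hb : G.color b ≠ c) (hu : G.color u = c) (ε : Prop) :
    ∃ v, G.SameClique u v ∧ (G.graph.Adj b v ↔ ε) := by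
  obtain ⟨⟨v, hv, hbv⟩, w, hw, hbw⟩ := h b u hb hu
  by_cases hε : ε
  · exact ⟨v, hv, by simp [hε, hbv]⟩
  · exact ⟨w, hw, by simp [hε, hbw]⟩

theorem SplitsInf.infinite_clique {V : Type*} {G : ColoredGraph V} {c : Color}
    (h : G.SplitsInf c) {b u : V} (hb : G.color b ≠ c) (hu : G.color u = c) :
    (G.cliqueOf u).Infinite :=
  (h b u hb hu True).mono fun _ hv => hv.1

theorem exists_not_sameClique {V : Type*} {G : ColoredGraph V} (hG : G.IsUltrahomogeneous)
    {c : Color} (hc : ¬ G.IsSingleClique c) {u : V} (hu : G.color u = c) :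
    ∃ v, G.color v = c ∧ ¬ G.SameClique u v := by
  simp only [IsSingleClique, not_forall] at hc
  obtain ⟨x, y, hx, hy, hxy, hadj⟩ := hc
  obtain ⟨ψ, hψ, rfl⟩ := hG.exists_aut_apply (hx.trans hu.symm)
  exact ⟨ψ y, (hψ.2 y).trans hy, fun h => hadj ((hψ.sameClique.1 h).adj hxy)⟩

/-- Suppose `b` splits the clique of `u` into a finite part, of the vertices whose adjacency to
`b` is `ε`, and its complement, and that some other clique has two vertices `y ≠ z` outside the
part given by `ε`. Then moving one vertex of the latter clique gives a conjugate `b'` of `b` with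
the same neighbors as `b` in the first clique but not in the second one, although both cliques
contain the same type over `{b, b'}`. -/
theorem Splits.infinite_of_pair {V : Type*} {G : ColoredGraph V} (hG : G.IsUltrahomogeneous)
    (hC : G.CliqueClasses) {c : Color} (hs : G.Splits c) {b u y z : V} (hb : G.color b ≠ c)
    (hu : G.color u = c) (hyc : G.color y = c) (huy : ¬ G.SameClique u y)
    (hyz : G.SameClique y z) (hne : y ≠ z) {ε : Prop} (hy : ¬ (G.graph.Adj b y ↔ ε))
    (hz : ¬ (G.graph.Adj b z ↔ ε)) : {v | G.SameClique u v ∧ (G.graph.Adj b v ↔ ε)}.Infinite := by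
  intro hfin
  set A := {v | G.SameClique u v ∧ (G.graph.Adj b v ↔ ε)} with hA
  obtain ⟨x, hyx, hx⟩ := hs.exists_adj_iff hb hyc ε
  have hxz : G.SameClique x z := SameClique.trans hC hyx.symm hyz
  have hAx : ∀ a ∈ A, ∀ w, G.SameClique y w → ¬ G.SameClique a w := fun a ha w hw h =>
    huy (SameClique.trans hC (SameClique.trans hC ha.1 h) hw.symm)
  have hxne : x ≠ z := fun h => hz (h ▸ hx)
  obtain ⟨ψ, hψ, hψx, hψA⟩ := hG.exists_aut_fix (hfin.insert z) (x := x) (y := y)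
    (by rintro (h | h)
        · exact hxne h
        · exact hAx x h x hyx (SameClique.refl G x))
    (by rintro (h | h)
        · exact hne h
        · exact hAx y h y (SameClique.refl G y) (SameClique.refl G y))
    hyx.color_eq
    (by rintro w (rfl | hw)
        · exact ⟨fun _ => hyz.symm.adj hne.symm, fun _ => hxz.symm.adj hxne.symm⟩
        · have hwc : G.color w = G.color y := by rw [hw.1.color_eq, hu, hyc]
          refine ⟨fun h => (hAx w hw x hyx ?_).elim,
            fun h => (hAx w hw y (SameClique.refl G y) ?_).elim⟩
          · exact ⟨hwc.trans hyx.color_eq.symm, Or.inr h⟩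
          · exact ⟨hwc, Or.inr h⟩)
  have hψA' : ∀ a ∈ A, ψ a = a := fun a ha => hψA a (Or.inr ha)
  obtain ⟨a₀, ha₀, ha₀'⟩ := hs.exists_adj_iff hb hu ε
  have hψu : ∀ v, G.SameClique u v → G.SameClique u (ψ.symm v) := by
    intro v hv
    have h1 : G.SameClique (ψ a₀) v := by
      rw [hψA' a₀ ⟨ha₀, ha₀'⟩]
      exact SameClique.trans hC ha₀.symm hv
    rw [← ψ.apply_symm_apply v, hψ.sameClique] at h1
    exact SameClique.trans hC ha₀ h1
  have hb' : ∀ v, G.SameClique u v → (G.graph.Adj (ψ b) v ↔ ε) → v ∈ A := by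
    intro v hv hv'
    rw [← ψ.apply_symm_apply v, hψ.1] at hv'
    have h1 := hψA' (ψ.symm v) ⟨hψu v hv, hv'⟩
    rw [ψ.apply_symm_apply] at h1
    rw [h1]
    exact ⟨hψu v hv, hv'⟩
  obtain ⟨v₀, hv₀, hv₀'⟩ := hs.exists_adj_iff hb hu (¬ ε)
  have hzb' : G.graph.Adj (ψ b) z ↔ G.graph.Adj b z := by
    have := hψ.1 b z
    rwa [hψA z (Or.inl rfl)] at this
  have hyb' : G.graph.Adj (ψ b) y ↔ G.graph.Adj b x := by rw [← hψx, hψ.1]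
  have hv₀b : ¬ (G.graph.Adj (ψ b) v₀ ↔ ε) := fun h => by
    have := (hb' v₀ hv₀ h).2
    clear * - this hv₀'
    tauto
  -- `z` and `v₀` have the same type over `{b, ψ b}`, but only the clique of `z` separates `b`, `ψ b`
  obtain ⟨v, hv, hvb⟩ := hG.exists_sameClique (C := {b, ψ b}) (by simp) (w := z) (v := v₀) (w' := y)
    (by simp [hψ.2, hyz.color_eq, hyc, hb]) (by rw [hyz.color_eq, hyc, hv₀.color_eq, hu])
    (by simp only [Set.mem_insert_iff, Set.mem_singleton_iff, forall_eq_or_imp, forall_eq]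
        clear * - hzb' hz hv₀' hv₀b
        constructor <;> tauto) hyz.symm
  have h1 := hvb b (by simp)
  have h2 := hvb (ψ b) (by simp)
  have h3 := (hb' v (SameClique.trans hC hv₀ hv) (h2.trans (hyb'.trans hx))).2
  exact hy (h1.symm.trans h3)

/-- If there are several cliques of color `c` and they have more than two vertices, then every
vertex of the other color splits them into two infinite parts. -/
theorem Splits.splitsInf {V : Type*} {G : ColoredGraph V} (hG : G.IsUltrahomogeneous)
    (hC : G.CliqueClasses) {c : Color} (hs : G.Splits c) (h1 : ¬ G.IsSingleClique c)
    (h3 : ¬ G.TriFree c) : G.SplitsInf c := by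
  intro b u hb hu ε
  obtain ⟨u', hu', huu'⟩ := exists_not_sameClique hG h1 hu
  have hu'u : ¬ G.SameClique u' u := fun h => huu' h.symm
  -- two vertices of the clique of `u'` have the same adjacency to `b`
  obtain ⟨ε₀, y, z, hy, hz, hne, hby, hbz⟩ : ∃ (ε₀ : Prop) (y z : V), G.SameClique u' y ∧
      G.SameClique u' z ∧ y ≠ z ∧ ¬ (G.graph.Adj b y ↔ ε₀) ∧ ¬ (G.graph.Adj b z ↔ ε₀) := by
    simp only [TriFree, not_forall] at h3
    obtain ⟨x, y, z, hx, hy, hz, hxy, hyz, hxz, -⟩ := h3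
    obtain ⟨ψ, hψ, rfl⟩ := hG.exists_aut_apply (hx.trans hu'.symm)
    have h1 := SameClique.refl G (ψ x)
    have h2 := hψ.sameClique.2 (⟨hx.trans hy.symm, Or.inr hxy⟩ : G.SameClique x y)
    have h3 := hψ.sameClique.2 (⟨hx.trans hz.symm, Or.inr hxz⟩ : G.SameClique x z)
    have key : ∀ p q r : Prop, (¬ (p ↔ ¬ p) ∧ ¬ (q ↔ ¬ p)) ∨ (¬ (p ↔ ¬ p) ∧ ¬ (r ↔ ¬ p)) ∨
        (¬ (q ↔ p) ∧ ¬ (r ↔ p)) := by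
      intro p q r
      tauto
    rcases key (G.graph.Adj b (ψ x)) (G.graph.Adj b (ψ y)) (G.graph.Adj b (ψ z)) with h | h | h
    · exact ⟨_, ψ x, ψ y, h1, h2, ψ.injective.ne hxy.ne, h.1, h.2⟩
    · exact ⟨_, ψ x, ψ z, h1, h3, ψ.injective.ne hxz.ne, h.1, h.2⟩
    · exact ⟨_, ψ y, ψ z, h2, h3, ψ.injective.ne hyz.ne, h.1, h.2⟩
  have hI : {v | G.SameClique u v ∧ (G.graph.Adj b v ↔ ε₀)}.Infinite :=
    hs.infinite_of_pair hG hC hb hu (hy.color_eq.trans hu')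
      (fun h => huu' (SameClique.trans hC h hy.symm)) (SameClique.trans hC hy.symm hz) hne hby hbz
  -- the stabilizer of `b` moves two vertices of the infinite part to the clique of `u'`
  have hI' : {v | G.SameClique u v ∧ (G.graph.Adj b v ↔ ¬ ε₀)}.Infinite := by
    obtain ⟨v, hv⟩ := hI.nonempty
    obtain ⟨w, hw, hvw⟩ := hI.exists_notMem_finite (Set.finite_singleton v)
    obtain ⟨x, hx, hbx⟩ := hs.exists_adj_iff hb hu' ε₀
    obtain ⟨ψ, hψ, hψv, hψb⟩ := hG.exists_aut_fix (Set.finite_singleton b) (x := v) (y := x)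
      (by rintro rfl; exact hb (hv.1.color_eq.trans hu))
      (by rintro rfl; exact hb (hx.color_eq.trans hu'))
      (by rw [hv.1.color_eq, hx.color_eq, hu, hu'])
      (by simp only [Set.mem_singleton_iff, forall_eq]
          exact hv.2.trans hbx.symm)
    have hψb := hψb b rfl
    have hvw' : G.SameClique v w := SameClique.trans hC hv.1.symm hw.1
    have hxw := hψ.sameClique.2 hvw'
    rw [hψv] at hxw
    have hbw := hψ.1 b w
    rw [hψb] at hbw
    have hne' : x ≠ ψ w := fun h => hvw (ψ.injective (by rw [hψv, ← h])).symm
    have key : ∀ p : Prop, (p ↔ ε₀) → ¬ (p ↔ ¬ ε₀) := fun p hp => by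
      rw [hp]
      exact iff_not_self
    exact hs.infinite_of_pair hG hC hb hu (hx.color_eq.trans hu')
      (fun h => huu' (SameClique.trans hC h hx.symm)) hxw hne'
      (key _ hbx) (key _ (hbw.trans hw.2))
  by_cases h : ε ↔ ε₀
  · simpa only [h] using hI
  · have : ε ↔ ¬ ε₀ := by
      clear * - h
      tauto
    simpa only [this] using hI'

/-- Every pattern over a finite set `A` of vertices of color `c` is realized by a vertex of the
other color: move `A` inside its cliques to a set over which a given vertex has the pattern. -/
theorem Splits.exists_pattern {V : Type*} {G : ColoredGraph V} (hG : G.IsUltrahomogeneous)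
    (hC : G.CliqueClasses) {c : Color} (hs : G.Splits c) (hb : ∃ b, G.color b ≠ c) {A : Set V}
    (hA : A.Finite) (hAc : ∀ a ∈ A, G.color a = c) {X : V → Prop}
    (h : G.SplitsInf c ∨ G.SeparatesAdj A X) :
    ∃ b, G.color b ≠ c ∧ ∀ a ∈ A, G.graph.Adj a b ↔ X a := by
  classical
  obtain ⟨b₀, hb₀⟩ := hb
  obtain ⟨g, hinj, hg⟩ : ∃ g : V → V, Set.InjOn g A ∧
      ∀ a ∈ A, G.SameClique a (g a) ∧ (G.graph.Adj b₀ (g a) ↔ X a) := by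
    rcases h with h | h
    · induction A, hA using Set.Finite.induction_on with
      | empty => exact ⟨id, by simp, by simp⟩
      | @insert a A ha hA ih =>
        obtain ⟨g, hinj, hg⟩ := ih fun a ha => hAc a (Or.inr ha)
        obtain ⟨y, hy, hyA⟩ := (h b₀ a hb₀ (hAc a (Or.inl rfl)) (X a)).exists_notMem_finite
          (hA.image g)
        have hne : ∀ x ∈ A, x ≠ a := fun x hx hxa => ha (hxa ▸ hx)
        have heq : Set.EqOn (Function.update g a y) g A := fun x hx =>
          Function.update_of_ne (hne x hx) _ _
        refine ⟨Function.update g a y, ?_, ?_⟩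
        · rw [Set.injOn_insert ha]
          refine ⟨hinj.congr heq.symm, ?_⟩
          rw [Set.image_congr heq]
          simpa using hyA
        · rintro x (rfl | hx)
          · simpa using hy
          · rw [heq hx]
            exact hg x hx
    · choose! g hg using fun a (ha : a ∈ A) => hs.exists_adj_iff hb₀ (hAc a ha) (X a)
      refine ⟨g, fun a ha a' ha' haa' => ?_, hg⟩
      by_contra hne
      have h1 := (hg a ha).1
      rw [haa'] at h1
      have h2 := (hg a ha).2
      have h3 := (hg a' ha').2
      have h4 := h a ha a' ha' ((SameClique.trans hC h1 (hg a' ha').1.symm).adj hne)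
      rw [haa'] at h2
      clear * - h2 h3 h4
      tauto
  obtain ⟨ψ, hψ, hψA⟩ := hG.exists_aut hA (f := g) (by
    refine ⟨hinj, fun a ha => (hg a ha).1.color_eq, fun a ha a' ha' => ?_⟩
    have hc' : G.color a = G.color a' := by rw [hAc a ha, hAc a' ha']
    rw [adj_iff_sameClique hc', adj_iff_sameClique
      (by rw [(hg a ha).1.color_eq, (hg a' ha').1.color_eq, hc']), hinj.ne_iff ha ha']
    refine and_congr_right fun _ => ⟨fun h => ?_, fun h => ?_⟩
    · exact SameClique.trans hC (SameClique.trans hC (hg a ha).1 h) (hg a' ha').1.symm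
    · exact SameClique.trans hC (SameClique.trans hC (hg a ha).1.symm h) (hg a' ha').1)
  refine ⟨ψ.symm b₀, by rwa [hψ.symm.2], fun a ha => ?_⟩
  rw [← hψ.1, ψ.apply_symm_apply, hψA a ha, G.graph.adj_comm]
  exact (hg a ha).2

/-- The pattern can be realized outside any finite set `F`: a vertex `b ∈ F` is avoided by
prescribing the opposite of its adjacency to one additional vertex of color `c`. -/
theorem Splits.exists_pattern_notMem {V : Type*} {G : ColoredGraph V} (hG : G.IsUltrahomogeneous)
    (hC : G.CliqueClasses) {c : Color} (hs : G.Splits c) (hb : ∃ b, G.color b ≠ c)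
    (hc : ∃ u, G.color u = c) {A : Set V}
    (hA : A.Finite) (hAc : ∀ a ∈ A, G.color a = c) {X : V → Prop}
    (h : G.SplitsInf c ∨ G.ManyCliques c ∧ G.SeparatesAdj A X) {F : Set V} (hF : F.Finite) :
    ∃ b ∉ F, G.color b ≠ c ∧ ∀ a ∈ A, G.graph.Adj a b ↔ X a := by
  classical
  induction F, hF using Set.Finite.induction_on generalizing A X with
  | empty =>
    obtain ⟨b, hb⟩ := hs.exists_pattern hG hC hb hA hAc (h.imp_right And.right)
    exact ⟨b, by simp, hb⟩
  | @insert b₁ F _ _ ih =>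
    obtain ⟨a, hac, haA, hsep⟩ : ∃ a, G.color a = c ∧ a ∉ A ∧
        (G.SplitsInf c ∨ ∀ x ∈ A, ¬ G.SameClique x a) := by
      rcases h with h | h
      · obtain ⟨u, hu⟩ := hc
        obtain ⟨b, hb⟩ := hb
        obtain ⟨a, ha, haA⟩ := (h.infinite_clique hb hu).exists_notMem_finite hA
        exact ⟨a, ha.color_eq.trans hu, haA, Or.inl h⟩
      · obtain ⟨a, ha, haA⟩ := h.1 A hA
        exact ⟨a, ha, fun h' => haA a h' (SameClique.refl G a), Or.inr haA⟩
    have hne : ∀ x ∈ A, x ≠ a := fun x hx hxa => haA (hxa ▸ hx)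
    obtain ⟨b, hbF, hbc, hbA⟩ := ih (hA.insert a) (X := Function.update X a (¬ G.graph.Adj a b₁))
      (by rintro x (rfl | hx)
          · exact hac
          · exact hAc x hx)
      (by
        rcases h with h | h
        · exact Or.inl h
        · rcases hsep with hsep | hsep
          · exact Or.inl hsep
          · refine Or.inr ⟨h.1, ?_⟩
            rintro x (rfl | hx) y (rfl | hy) hxy
            · exact absurd rfl hxy.ne
            · exact absurd ⟨(hAc y hy).trans hac.symm, Or.inr hxy.symm⟩ (hsep y hy)
            · exact absurd ⟨(hAc x hx).trans hac.symm, Or.inr hxy⟩ (hsep x hx)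
            · rw [Function.update_of_ne (hne x hx), Function.update_of_ne (hne y hy)]
              exact h.2 x hx y hy hxy)
    refine ⟨b, ?_, hbc, fun x hx => ?_⟩
    · rintro (rfl | hbF')
      · have := hbA a (Or.inl rfl)
        simp at this
      · exact hbF hbF'
    · have := hbA x (Or.inr hx)
      rwa [Function.update_of_ne (hne x hx)] at this

theorem TriFree.finite_clique {V : Type*} {G : ColoredGraph V} (hC : G.CliqueClasses) {c : Color}
    (h : G.TriFree c) {u : V} (hu : G.color u = c) : (G.cliqueOf u).Finite := by
  by_contra hinf
  obtain ⟨v, hv, hvu⟩ := Set.Infinite.exists_notMem_finite hinf (Set.finite_singleton u)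
  obtain ⟨w, hw, hwu⟩ := Set.Infinite.exists_notMem_finite hinf (Set.toFinite {u, v})
  simp only [Set.mem_singleton_iff, Set.mem_insert_iff, not_or] at hvu hwu
  exact h u v w hu (SameClique.color_eq hv ▸ hu) (SameClique.color_eq hw ▸ hu)
    (SameClique.adj hv (Ne.symm hvu))
    ((SameClique.trans hC (SameClique.symm hv) hw).adj (Ne.symm hwu.2))
    (SameClique.adj hw (Ne.symm hwu.1))

theorem TriFree.manyCliques {V : Type*} {G : ColoredGraph V} (hC : G.CliqueClasses) {c : Color}
    (h : G.TriFree c) (hinf : (G.colorClass c).Infinite) : G.ManyCliques c := by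
  intro F hF
  have hfin : (⋃ a ∈ F ∩ G.colorClass c, G.cliqueOf a).Finite :=
    (hF.subset Set.inter_subset_left).biUnion fun a ha => h.finite_clique hC ha.2
  obtain ⟨y, hy, hy'⟩ := hinf.exists_notMem_finite hfin
  refine ⟨y, hy, fun a ha hay => hy' ?_⟩
  exact Set.mem_biUnion ⟨ha, hay.1.trans hy⟩ hay

/-- In a clique with two vertices, a vertex of the other color has exactly one neighbor. -/
theorem Splits.adj_iff_not_adj {V : Type*} {G : ColoredGraph V} {c : Color} (hs : G.Splits c)
    (h : G.TriFree c) (hC : G.CliqueClasses) {x y w : V} (hx : G.color x = c) (hy : G.color y = c)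
    (hw : G.color w ≠ c) (hxy : G.graph.Adj x y) : G.graph.Adj w x ↔ ¬ G.graph.Adj w y := by
  have key : ∀ z, G.SameClique x z → z = x ∨ z = y := by
    intro z hz
    by_contra! hne
    have hzy : G.SameClique z y := SameClique.trans hC hz.symm ⟨hx.trans hy.symm, Or.inr hxy⟩
    exact h x z y hx (hz.color_eq.trans hx) hy (hz.adj hne.1.symm) (hzy.adj hne.2) hxy
  obtain ⟨⟨u, hu, hu'⟩, v, hv, hv'⟩ := hs w x hw hx
  rcases key u hu with rfl | rfl <;> rcases key v hv with rfl | rfl <;> tauto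

/-! ### Patterns realized inside a single clique -/

/-- Every clique of color `c` realizes every pattern over `C`. -/
def FullOver {V : Type*} (G : ColoredGraph V) (c : Color) (C : Set V) : Prop :=
  ∀ u, G.color u = c → ∀ X : V → Prop, ∃ v, G.SameClique u v ∧ ∀ z ∈ C, G.graph.Adj z v ↔ X z

/-- On every clique of color `c`, the adjacencies to `x` and to `y` agree or are opposite. -/
def EvenPair {V : Type*} (G : ColoredGraph V) (c : Color) (x y : V) : Prop :=
  ∀ u v, G.color u = c → G.SameClique u v →
    ((G.graph.Adj x u ↔ G.graph.Adj y u) ↔ (G.graph.Adj x v ↔ G.graph.Adj y v))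

theorem EvenPair.map {V : Type*} {G : ColoredGraph V} {c : Color} {x y : V}
    (h : G.EvenPair c x y) {ψ : V ≃ V} (hψ : G.IsAut ψ) : G.EvenPair c (ψ x) (ψ y) := by
  intro u v hu huv
  have := h (ψ.symm u) (ψ.symm v) (by rwa [hψ.symm.2]) (hψ.symm.sameClique.2 huv)
  rwa [← hψ.1 x, ← hψ.1 y, ← hψ.1 x, ← hψ.1 y, ψ.apply_symm_apply, ψ.apply_symm_apply] at this

theorem FullOver.map {V : Type*} {G : ColoredGraph V} {c : Color} {C : Set V}
    (h : G.FullOver c C) {ψ : V ≃ V} (hψ : G.IsAut ψ) : G.FullOver c (ψ '' C) := by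
  intro u hu X
  obtain ⟨v, hv, hvC⟩ := h (ψ.symm u) (by rwa [hψ.symm.2]) (X ∘ ψ)
  refine ⟨ψ v, ?_, ?_⟩
  · rwa [← hψ.sameClique, ψ.apply_symm_apply] at hv
  · rintro _ ⟨z, hz, rfl⟩
    rw [hψ.1]
    exact hvC z hz

/-- If two cliques realize a common pattern over `{x, y}`, then they realize the same patterns.
Since `x` and `y` split all cliques, a clique realizing three of the four patterns shares one with
any other clique. -/
theorem Splits.fullOver_or_evenPair {V : Type*} {G : ColoredGraph V} (hG : G.IsUltrahomogeneous)
    (hC : G.CliqueClasses) {c : Color} (hs : G.Splits c) {x y : V} (hx : G.color x ≠ c)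
    (hy : G.color y ≠ c)
    (hpat : ∀ X : V → Prop, ∃ u, G.color u = c ∧ ∀ z ∈ ({x, y} : Set V), G.graph.Adj z u ↔ X z) :
    G.FullOver c {x, y} ∨ G.EvenPair c x y := by
  refine or_iff_not_imp_right.2 fun hne => ?_
  simp only [EvenPair, not_forall] at hne
  obtain ⟨u, v, hu, huv, hne⟩ := hne
  -- the clique of `u` realizes patterns of both parities, and so shares one with any other clique
  have hshare : ∀ w, G.color w = c → ∃ w' v', G.SameClique w w' ∧ G.SameClique u v' ∧
      ∀ z ∈ ({x, y} : Set V), G.graph.Adj z w' ↔ G.graph.Adj z v' := by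
    intro w hw
    by_cases hxu : G.graph.Adj x u ↔ G.graph.Adj x v
    · obtain ⟨w', hw', hxw⟩ := hs.exists_adj_iff hx hw (G.graph.Adj x u)
      by_cases hyw : G.graph.Adj y w' ↔ G.graph.Adj y u
      · exact ⟨w', u, hw', SameClique.refl G u, by simp [hxw, hyw]⟩
      · refine ⟨w', v, hw', huv, ?_⟩
        simp only [Set.mem_insert_iff, Set.mem_singleton_iff, forall_eq_or_imp, forall_eq]
        clear * - hne hxu hxw hyw
        constructor <;> tauto
    · obtain ⟨w', hw', hyw⟩ := hs.exists_adj_iff hy hw (G.graph.Adj y u)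
      by_cases hxw : G.graph.Adj x w' ↔ G.graph.Adj x u
      · exact ⟨w', u, hw', SameClique.refl G u, by simp [hxw, hyw]⟩
      · refine ⟨w', v, hw', huv, ?_⟩
        simp only [Set.mem_insert_iff, Set.mem_singleton_iff, forall_eq_or_imp, forall_eq]
        clear * - hne hxu hxw hyw
        constructor <;> tauto
  intro w hw X
  obtain ⟨t, ht, htX⟩ := hpat X
  obtain ⟨t', v', htt', huv', ht'⟩ := hshare t ht
  obtain ⟨w', v'', hww', huv'', hw'⟩ := hshare w hw
  obtain ⟨e, he, heX⟩ := hG.exists_sameClique (Set.toFinite {x, y}) (w := t') (v := v') (w' := t)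
    (by simp [htt'.color_eq, ht, hx, hy]) (by rw [htt'.color_eq, ht, huv'.color_eq, hu]) ht'
    htt'.symm
  obtain ⟨e', he', he'X⟩ := hG.exists_sameClique (Set.toFinite {x, y}) (w := v'') (v := w')
    (w' := e) (by simp [huv''.color_eq, hu, hx, hy]) (by rw [huv''.color_eq, hu, hww'.color_eq, hw])
    (fun z hz => (hw' z hz).symm)
    (SameClique.trans hC huv''.symm (SameClique.trans hC huv' he))
  exact ⟨e', SameClique.trans hC hww' he',
    fun z hz => (he'X z hz).trans ((heX z hz).trans (htX z hz))⟩

/-- Two vertices in different cliques of the other color cannot be even on the infinite cliques of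
color `c`: otherwise all pairs were even, and two neighbors of a vertex in one clique would have
the same neighbors of the other color, as would then any two vertices of that clique. -/
theorem SplitsInf.fullOver_pair {V : Type*} {G : ColoredGraph V} (hG : G.IsUltrahomogeneous)
    (hC : G.CliqueClasses) {c : Color} (hs : G.Splits c) (hinf : G.SplitsInf c)
    (hc : ∃ u, G.color u = c) (hd : ¬ G.IsSingleClique c.other)
    (hpat : ∀ x y, G.color x ≠ c → G.color y ≠ c → ¬ G.SameClique x y → ∀ X : V → Prop,
      ∃ u, G.color u = c ∧ ∀ z ∈ ({x, y} : Set V), G.graph.Adj z u ↔ X z)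
    {x y : V} (hx : G.color x ≠ c) (hy : G.color y ≠ c) (hxy : ¬ G.SameClique x y) :
    G.FullOver c {x, y} := by
  refine (hs.fullOver_or_evenPair hG hC hx hy (hpat x y hx hy hxy)).resolve_right fun heven => ?_
  have hnadj : ∀ {a b}, G.color a ≠ c → G.color b ≠ c → ¬ G.SameClique a b →
      ¬ G.graph.Adj a b := fun ha hb h h' => h ⟨color_eq_of_ne_of_ne ha hb, Or.inr h'⟩
  have heven1 : ∀ a b, G.color a ≠ c → G.color b ≠ c → ¬ G.SameClique a b → G.EvenPair c a b := by
    intro a b ha hb hab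
    obtain ⟨ψ, hψ, rfl, rfl⟩ := hG.exists_aut_pair (x := x) (y := y) (x' := a) (y' := b)
      (color_eq_of_ne_of_ne hx ha) (color_eq_of_ne_of_ne hy hb)
      (fun h => hxy (h ▸ SameClique.refl G x)) (fun h => hab (h ▸ SameClique.refl G a))
      (iff_of_false (hnadj hx hy hxy) (hnadj ha hb hab))
    exact heven.map hψ
  have heven2 : ∀ a b, G.color a ≠ c → G.color b ≠ c → G.EvenPair c a b := by
    intro a b ha hb
    by_cases hab : G.SameClique a b
    · obtain ⟨z, hz, haz⟩ := exists_not_sameClique hG hd (color_ne_iff_eq_other.1 ha)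
      have hzc := color_ne_iff_eq_other.2 hz
      intro u v hu huv
      have h1 := heven1 a z ha hzc haz u v hu huv
      have h2 := heven1 b z hb hzc (fun h => haz (SameClique.trans hC hab h)) u v hu huv
      clear * - h1 h2
      tauto
    · exact heven1 a b ha hb hab
  obtain ⟨u, hu⟩ := hc
  obtain ⟨v, hv⟩ := (hinf x u hx hu True).nonempty
  obtain ⟨v', hv', hne⟩ := (hinf x u hx hu True).exists_notMem_finite (Set.finite_singleton v)
  obtain ⟨w, hw⟩ := (hinf x u hx hu False).nonempty
  have hvw : v ≠ w := by
    rintro rfl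
    exact (hw.2.1 (hv.2.2 trivial))
  have hvv' : v ≠ v' := fun h => hne h.symm
  -- `x` has the neighbors `v`, `v'` and the non-neighbor `w` in a clique; with `v' ↦ w` over `v`,
  -- the vertices `x` and `ψ⁻¹ x` violate evenness at `v` and `v'`
  obtain ⟨ψ, hψ, hψv', hψv⟩ := hG.exists_aut_fix (Set.finite_singleton v) (x := v') (y := w)
    (by simpa using hvv'.symm) (by simpa using hvw.symm)
    (by rw [hv'.1.color_eq, hw.1.color_eq])
    (by simp only [Set.mem_singleton_iff, forall_eq]
        exact iff_of_true ((SameClique.trans hC hv.1.symm hv'.1).adj hvv')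
          ((SameClique.trans hC hv.1.symm hw.1).adj hvw))
  have h1 := heven2 x (ψ.symm x) hx (by rwa [hψ.symm.2]) v v' (hv.1.color_eq.trans hu)
    (SameClique.trans hC hv.1.symm hv'.1)
  rw [← hψ.1 (ψ.symm x), ← hψ.1 (ψ.symm x), ψ.apply_symm_apply, hψv', hψv v rfl] at h1
  have h2 := hv.2
  have h3 := hv'.2
  have h4 := hw.2
  clear * - h1 h2 h3 h4
  tauto

/-- Suppose some pattern over `C` is missing in some clique, but all patterns over `C \ {d}` occur
in all cliques. As each pattern over `C` occurs in some clique and two cliques sharing a pattern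
realize the same ones, no clique contains two vertices which differ exactly at `d`. -/
theorem adj_iff_of_not_fullOver {V : Type*} {G : ColoredGraph V} (hG : G.IsUltrahomogeneous)
    (hC : G.CliqueClasses) {c : Color} {C : Set V} (hfin : C.Finite)
    (hcol : ∀ z ∈ C, G.color z ≠ c)
    (hpat : ∀ X : V → Prop, ∃ u, G.color u = c ∧ ∀ z ∈ C, G.graph.Adj z u ↔ X z) {d : V}
    (hfull : G.FullOver c (C \ {d})) (hnot : ¬ G.FullOver c C) {v v' : V}
    (hv : G.color v = c) (hvv' : G.SameClique v v')
    (h : ∀ z ∈ C \ {d}, G.graph.Adj z v ↔ G.graph.Adj z v') :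
    G.graph.Adj d v ↔ G.graph.Adj d v' := by
  by_contra hne
  refine hnot fun u hu X => ?_
  -- any clique shares a pattern with the clique of `v`
  have hshare : ∀ w, G.color w = c → ∃ w' t, G.SameClique w w' ∧ G.SameClique v t ∧
      ∀ z ∈ C, G.graph.Adj z w' ↔ G.graph.Adj z t := by
    intro w hw
    obtain ⟨w', hw', hw'C⟩ := hfull w hw fun z => G.graph.Adj z v
    by_cases hdw : G.graph.Adj d w' ↔ G.graph.Adj d v
    · refine ⟨w', v, hw', SameClique.refl G v, fun z hz => ?_⟩
      by_cases hzd : z = d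
      · rwa [hzd]
      · exact hw'C z ⟨hz, hzd⟩
    · refine ⟨w', v', hw', hvv', fun z hz => ?_⟩
      by_cases hzd : z = d
      · rw [hzd]
        clear * - hdw hne
        tauto
      · exact (hw'C z ⟨hz, hzd⟩).trans (h z ⟨hz, hzd⟩)
  obtain ⟨s, hs, hsX⟩ := hpat X
  obtain ⟨s', t, hss', hvt, hst⟩ := hshare s hs
  obtain ⟨u', t', huu', hvt', hut⟩ := hshare u hu
  obtain ⟨e, he, heX⟩ := hG.exists_sameClique hfin (w := s') (v := t) (w' := s)
    (fun z hz => by rw [hss'.color_eq, hs]; exact hcol z hz)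
    (by rw [hss'.color_eq, hs, hvt.color_eq, hv]) hst hss'.symm
  obtain ⟨e', he', he'X⟩ := hG.exists_sameClique hfin (w := t') (v := u') (w' := e)
    (fun z hz => by rw [hvt'.color_eq, hv]; exact hcol z hz)
    (by rw [hvt'.color_eq, hv, huu'.color_eq, hu]) (fun z hz => (hut z hz).symm)
    (SameClique.trans hC hvt'.symm (SameClique.trans hC hvt he))
  exact ⟨e', SameClique.trans hC huu' he',
    fun z hz => (he'X z hz).trans ((heX z hz).trans (hsX z hz))⟩

/-- Let `T` be a family of finite sets of vertices of the color different from `c`, closed under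
subsets, such that all patterns over members of `T` are realized. If every element `x` of a member
of `T` can be exchanged for a new element `y` with `{x, y}` realized fully in each clique of color
`c`, then every clique of color `c` realizes all patterns over members of `T`.

In a minimal counterexample `C = insert x C₀`, toggling the adjacency to one element of `C₀`
inside a clique toggles the adjacency to `x`. The same holds for `insert y C₀`, so `{x, y}` is
even on every clique. -/
theorem fullOver_of_exchange {V : Type*} {G : ColoredGraph V} (hG : G.IsUltrahomogeneous)
    (hC : G.CliqueClasses) {c : Color} (hc : ∃ u, G.color u = c) {T : Set V → Prop}
    (hmono : ∀ C D, T C → D ⊆ C → T D) (hcol : ∀ C, T C → ∀ z ∈ C, G.color z ≠ c)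
    (hpat : ∀ C : Set V, C.Finite → T C → ∀ X : V → Prop,
      ∃ u, G.color u = c ∧ ∀ z ∈ C, G.graph.Adj z u ↔ X z)
    (hex : ∀ (C : Set V) (x : V), C.Finite → x ∉ C → T (insert x C) →
      ∃ y, y ≠ x ∧ y ∉ C ∧ G.color y = G.color x ∧ T (insert y C) ∧ G.FullOver c {x, y} ∧
        ∀ z ∈ C, G.graph.Adj z x ↔ G.graph.Adj z y)
    {C : Set V} (hfin : C.Finite) (hT : T C) : G.FullOver c C := by
  classical
  induction hn : C.ncard using Nat.strong_induction_on generalizing C with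
  | _ n ih =>
  subst hn
  by_contra hnot
  obtain ⟨x, hx⟩ : C.Nonempty := by
    rw [Set.nonempty_iff_ne_empty]
    rintro rfl
    exact hnot fun u _ X => ⟨u, SameClique.refl G u, by simp⟩
  set C₀ := C \ {x} with hC₀
  have hCx : C = insert x C₀ := by simp [hC₀, Set.insert_eq_of_mem hx]
  have hxC₀ : x ∉ C₀ := by simp [hC₀]
  have hfin₀ : C₀.Finite := hfin.subset Set.sdiff_subset
  obtain ⟨y, hyx, hyC₀, hyc, hTy, hfullxy, hadj⟩ := hex C₀ x hfin₀ hxC₀ (hCx ▸ hT)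
  have hcardx : C.ncard = C₀.ncard + 1 := by
    rw [hCx, Set.ncard_insert_of_notMem hxC₀ hfin₀]
  have hcardy : (insert y C₀).ncard = C₀.ncard + 1 := Set.ncard_insert_of_notMem hyC₀ hfin₀
  have hnoty : ¬ G.FullOver c (insert y C₀) := by
    intro h
    obtain ⟨ψ, hψ, hψy, hψC⟩ := hG.exists_aut_fix hfin₀ hyC₀ hxC₀ hyc fun z hz => (hadj z hz).symm
    have := h.map hψ
    rw [Set.image_insert_eq, hψy, Set.image_congr hψC, Set.image_id', ← hCx] at this
    exact hnot this
  have hfull₀ : G.FullOver c C₀ := ih _ (by omega) hfin₀ (hmono _ _ hT Set.sdiff_subset) rfl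
  have hbase : ∀ p, p ∉ C₀ → T (insert p C₀) → ¬ G.FullOver c (insert p C₀) → ∀ v v',
      G.color v = c → G.SameClique v v' → (∀ z ∈ C₀, G.graph.Adj z v ↔ G.graph.Adj z v') →
      (G.graph.Adj p v ↔ G.graph.Adj p v') := by
    intro p hp hTp hnp v v' hv hvv' h
    have hd : insert p C₀ \ {p} = C₀ := by simp [hp]
    exact adj_iff_of_not_fullOver hG hC (hfin₀.insert p) (hcol _ hTp)
      (hpat _ (hfin₀.insert p) hTp) (by rwa [hd]) hnp hv hvv' (by rwa [hd])
  have htoggle : ∀ p, p ∉ C₀ → T (insert p C₀) → ¬ G.FullOver c (insert p C₀) → ∀ v v' d,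
      d ∈ C₀ → G.color v = c → G.SameClique v v' →
      (∀ z ∈ C₀, z ≠ d → (G.graph.Adj z v ↔ G.graph.Adj z v')) →
      ¬ (G.graph.Adj d v ↔ G.graph.Adj d v') → ¬ (G.graph.Adj p v ↔ G.graph.Adj p v') := by
    intro p hp hTp hnp v v' d hd hv hvv' h hne hpv
    have hfind : (insert p C₀ \ {d}).Finite := (hfin₀.insert p).subset Set.sdiff_subset
    have hcard : (insert p C₀ \ {d}).ncard + 1 = C₀.ncard + 1 := by
      rw [Set.ncard_sdiff_singleton_add_one (Set.mem_insert_of_mem p hd) (hfin₀.insert p),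
        Set.ncard_insert_of_notMem hp hfin₀]
    refine hne (adj_iff_of_not_fullOver hG hC (hfin₀.insert p) (hcol _ hTp)
      (hpat _ (hfin₀.insert p) hTp)
      (ih _ (by omega) hfind (hmono _ _ hTp Set.sdiff_subset) rfl) hnp hv hvv' ?_)
    rintro z ⟨rfl | hz, hzd⟩
    · exact hpv
    · exact h z hz hzd
  have hTx : T (insert x C₀) := hCx ▸ hT
  have hnotx : ¬ G.FullOver c (insert x C₀) := hCx ▸ hnot
  -- each change at an element of `C₀` toggles the adjacencies to `x` and to `y` alike
  have heven : ∀ n v v', G.color v = c → G.SameClique v v' →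
      {z ∈ C₀ | ¬ (G.graph.Adj z v ↔ G.graph.Adj z v')}.ncard = n →
      ((G.graph.Adj x v ↔ G.graph.Adj x v') ↔ (G.graph.Adj y v ↔ G.graph.Adj y v')) := by
    intro n
    induction n with
    | zero =>
      intro v v' hv hvv' hn
      rw [Set.ncard_eq_zero (hfin₀.subset (Set.sep_subset _ _))] at hn
      have h : ∀ z ∈ C₀, G.graph.Adj z v ↔ G.graph.Adj z v' := fun z hz => by
        by_contra h
        exact Set.notMem_empty z (hn ▸ ⟨hz, h⟩)
      exact iff_of_true (hbase x hxC₀ hTx hnotx v v' hv hvv' h)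
        (hbase y hyC₀ hTy hnoty v v' hv hvv' h)
    | succ n ihn =>
      intro v v' hv hvv' hn
      obtain ⟨d, hd, hdv⟩ : {z ∈ C₀ | ¬ (G.graph.Adj z v ↔ G.graph.Adj z v')}.Nonempty := by
        rw [Set.nonempty_iff_ne_empty]
        intro h
        simp [h] at hn
      -- `w` differs from `v'` exactly at `d`
      obtain ⟨w, hw, hwC⟩ := hfull₀ v hv
        fun z => if z = d then G.graph.Adj z v else G.graph.Adj z v'
      have hwd := hwC d hd
      rw [if_pos rfl] at hwd
      have hw' : ∀ z ∈ C₀, z ≠ d → (G.graph.Adj z w ↔ G.graph.Adj z v') := fun z hz hzd => by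
        have := hwC z hz
        rwa [if_neg hzd] at this
      have hset : {z ∈ C₀ | ¬ (G.graph.Adj z v ↔ G.graph.Adj z w)} =
          {z ∈ C₀ | ¬ (G.graph.Adj z v ↔ G.graph.Adj z v')} \ {d} := by
        ext z
        by_cases hzd : z = d
        · subst hzd
          simp [hwd]
        · simp only [Set.mem_ofPred_eq, Set.mem_sdiff, Set.mem_singleton_iff, hzd, not_false_eq_true,
            and_true]
          exact and_congr_right fun hz => by rw [hw' z hz hzd]
      have h1 := ihn v w hv hw (by
        rw [hset, Set.ncard_sdiff_singleton_of_mem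
          (show d ∈ {z ∈ C₀ | ¬ (G.graph.Adj z v ↔ G.graph.Adj z v')} from ⟨hd, hdv⟩), hn,
          Nat.add_sub_cancel])
      have hwc := hw.color_eq.trans hv
      have hwv' := SameClique.trans hC hw.symm hvv'
      have hne : ¬ (G.graph.Adj d w ↔ G.graph.Adj d v') := by rwa [hwd]
      have h2 := htoggle x hxC₀ hTx hnotx w v' d hd hwc hwv' hw' hne
      have h3 := htoggle y hyC₀ hTy hnoty w v' d hd hwc hwv' hw' hne
      clear * - h1 h2 h3
      tauto
  obtain ⟨u, hu⟩ := hc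
  -- patterns over `{x, y}` of different parity in one clique
  obtain ⟨v, hv, hvxy⟩ := hfullxy u hu fun _ => True
  obtain ⟨v', hv', hv'xy⟩ := hfullxy u hu fun z => z = x
  have h := heven _ v v' (hv.color_eq.trans hu) (SameClique.trans hC hv.symm hv') rfl
  have h1 := hvxy x (by simp)
  have h2 := hvxy y (by simp)
  have h3 := hv'xy x (by simp)
  have h4 := hv'xy y (by simp)
  clear * - h h1 h2 h3 h4 hyx
  tauto

/-! ### Infinite cliques: the even and the generic case -/

theorem color_ne_other_iff {a c : Color} : a ≠ c.other ↔ a = c := by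
  cases a <;> cases c <;> simp [Color.other]

/-- Any clique of color `c` and any clique of the other color are joined evenly: two vertices of
one of them have the same or opposite neighbors in the other one. -/
def Even {V : Type*} (G : ColoredGraph V) (c : Color) : Prop :=
  ∀ x y, G.color x ≠ c → G.SameClique x y → G.EvenPair c x y

theorem Even.other {V : Type*} {G : ColoredGraph V} {c : Color} (h : G.Even c) :
    G.Even c.other := by
  intro u v hu huv x y hx hxy
  have hu' := color_ne_other_iff.1 hu
  have := h x y (color_ne_iff_eq_other.2 hx) hxy u v hu' huv
  rw [G.graph.adj_comm u x, G.graph.adj_comm v x, G.graph.adj_comm u y, G.graph.adj_comm v y]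
  clear * - this
  tauto

/-- The exchange lemma for sets of vertices from different cliques; the new vertex is taken from a
new clique. -/
theorem fullOver_of_pairwise_not_sameClique {V : Type*} {G : ColoredGraph V}
    (hG : G.IsUltrahomogeneous) (hC : G.CliqueClasses) {c : Color} (hs : G.Splits c)
    (hinf : G.SplitsInf c) (hc : ∃ u, G.color u = c) (hs' : G.Splits c.other)
    (hd : ¬ G.IsSingleClique c.other) (hm : G.ManyCliques c.other) {C : Set V} (hfin : C.Finite)
    (hcol : ∀ z ∈ C, G.color z ≠ c)
    (hpw : ∀ x ∈ C, ∀ y ∈ C, x ≠ y → ¬ G.SameClique x y) : G.FullOver c C := by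
  have hpat : ∀ C : Set V, C.Finite → ((∀ z ∈ C, G.color z ≠ c) ∧
      ∀ x ∈ C, ∀ y ∈ C, x ≠ y → ¬ G.SameClique x y) → ∀ X : V → Prop,
      ∃ u, G.color u = c ∧ ∀ z ∈ C, G.graph.Adj z u ↔ X z := by
    intro C hfin hT X
    obtain ⟨u, hu, huX⟩ := hs'.exists_pattern hG hC (by simpa only [color_ne_other_iff] using hc)
      hfin (fun z hz => color_ne_iff_eq_other.1 (hT.1 z hz)) (X := X) (Or.inr fun a ha b hb hab =>
        (hT.2 a ha b hb hab.ne
          ⟨color_eq_of_ne_of_ne (hT.1 a ha) (hT.1 b hb), Or.inr hab⟩).elim)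
    exact ⟨u, color_ne_other_iff.1 hu, huX⟩
  refine fullOver_of_exchange hG hC hc (T := fun C => (∀ z ∈ C, G.color z ≠ c) ∧
      ∀ x ∈ C, ∀ y ∈ C, x ≠ y → ¬ G.SameClique x y) ?_ ?_ hpat ?_ hfin ⟨hcol, hpw⟩
  · exact fun C D hT hD => ⟨fun z hz => hT.1 z (hD hz),
      fun x hx y hy => hT.2 x (hD hx) y (hD hy)⟩
  · exact fun C hT => hT.1
  · intro C x hfin hx hT
    obtain ⟨y, hy, hyC⟩ := hm (insert x C) (hfin.insert x)
    have hyc := color_ne_iff_eq_other.2 hy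
    have hxc := hT.1 x (Or.inl rfl)
    have hnadj : ∀ {a b}, G.color a ≠ c → G.color b ≠ c → ¬ G.SameClique a b →
        ¬ G.graph.Adj a b := fun ha hb h h' => h ⟨color_eq_of_ne_of_ne ha hb, Or.inr h'⟩
    have hyC' : y ∉ C := fun h => hyC y (Or.inr h) (SameClique.refl G y)
    refine ⟨y, fun h => hyC x (Or.inl rfl) (h ▸ SameClique.refl G y), hyC',
      color_eq_of_ne_of_ne hyc hxc, ⟨?_, ?_⟩, ?_, fun z hz => iff_of_false ?_ ?_⟩
    · rintro z (rfl | hz)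
      · exact hyc
      · exact hT.1 z (Or.inr hz)
    · rintro a (rfl | ha) b (rfl | hb) hab
      · exact absurd rfl hab
      · exact fun h => hyC b (Or.inr hb) h.symm
      · exact hyC a (Or.inr ha)
      · exact hT.2 a (Or.inr ha) b (Or.inr hb) hab
    · refine SplitsInf.fullOver_pair hG hC hs hinf hc hd ?_ hxc hyc (hyC x (Or.inl rfl))
      intro a b ha hb hab
      refine hpat {a, b} (Set.toFinite _) ⟨by simp [ha, hb], ?_⟩
      rintro p (rfl | rfl) q (rfl | rfl) hpq
      · exact absurd rfl hpq
      · exact hab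
      · exact fun h => hab h.symm
      · exact absurd rfl hpq
    · exact hnadj (hT.1 z (Or.inr hz)) hxc (hT.2 z (Or.inr hz) x (Or.inl rfl)
        fun h => hx (h ▸ hz))
    · exact hnadj (hT.1 z (Or.inr hz)) hyc (hyC z (Or.inr hz))

/-- The exchange lemma for arbitrary finite sets; the new vertex is taken from the clique of the old
one. -/
theorem fullOver_of_not_even {V : Type*} {G : ColoredGraph V}
    (hG : G.IsUltrahomogeneous) (hC : G.CliqueClasses) {c : Color} (hs : G.Splits c)
    (hc : ∃ u, G.color u = c) (hs' : G.Splits c.other) (hinf' : G.SplitsInf c.other)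
    (heven : ¬ G.Even c) {C : Set V} (hfin : C.Finite)
    (hcol : ∀ z ∈ C, G.color z ≠ c) : G.FullOver c C := by
  have hpat : ∀ C : Set V, C.Finite → (∀ z ∈ C, G.color z ≠ c) → ∀ X : V → Prop,
      ∃ u, G.color u = c ∧ ∀ z ∈ C, G.graph.Adj z u ↔ X z := by
    intro C hfin hT X
    obtain ⟨u, hu, huX⟩ := hs'.exists_pattern hG hC (by simpa only [color_ne_other_iff] using hc)
      hfin (fun z hz => color_ne_iff_eq_other.1 (hT z hz)) (X := X) (Or.inl hinf')
    exact ⟨u, color_ne_other_iff.1 hu, huX⟩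
  simp only [Even, not_forall] at heven
  obtain ⟨x₀, y₀, hx₀, hxy₀, hne⟩ := heven
  have hy₀ : G.color y₀ ≠ c := hxy₀.color_eq ▸ hx₀
  have hxy₀' : x₀ ≠ y₀ := by
    rintro rfl
    exact hne fun u v _ _ => by simp
  have hfull₀ := (hs.fullOver_or_evenPair hG hC hx₀ hy₀
    (hpat {x₀, y₀} (Set.toFinite _) (by simp [hx₀, hy₀]))).resolve_right hne
  refine fullOver_of_exchange hG hC hc (T := fun C => ∀ z ∈ C, G.color z ≠ c)
    (fun C D hT hD z hz => hT z (hD hz)) (fun C hT => hT) hpat ?_ hfin hcol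
  intro C x hfin hx hT
  obtain ⟨u, hu⟩ := hc
  have hxc := hT x (Or.inl rfl)
  obtain ⟨y, hxy, hyC⟩ := (hinf'.infinite_clique (b := u) (color_ne_other_iff.2 hu)
    (color_ne_iff_eq_other.1 hxc)).exists_notMem_finite (hfin.insert x)
  simp only [Set.mem_insert_iff, not_or] at hyC
  have hyc : G.color y ≠ c := SameClique.color_eq hxy ▸ hxc
  refine ⟨y, hyC.1, hyC.2, SameClique.color_eq hxy, ?_, ?_, fun z hz => ?_⟩
  · rintro z (rfl | hz)
    · exact hyc
    · exact hT z (Or.inr hz)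
  · obtain ⟨ψ, hψ, rfl, rfl⟩ := hG.exists_aut_pair (color_eq_of_ne_of_ne hx₀ hxc)
      (color_eq_of_ne_of_ne hy₀ hyc) hxy₀' (Ne.symm hyC.1)
      (iff_of_true (hxy₀.adj hxy₀') (SameClique.adj hxy (Ne.symm hyC.1)))
    have := hfull₀.map hψ
    rwa [Set.image_pair] at this
  · have hzc := hT z (Or.inr hz)
    have hzx : z ≠ x := fun h => hx (h ▸ hz)
    have hzy : z ≠ y := fun h => hyC.2 (h ▸ hz)
    rw [adj_iff_sameClique (color_eq_of_ne_of_ne hzc hxc),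
      adj_iff_sameClique (color_eq_of_ne_of_ne hzc hyc)]
    exact ⟨fun h => ⟨hzy, SameClique.trans hC h.2 hxy⟩,
      fun h => ⟨hzx, SameClique.trans hC h.2 (SameClique.symm hxy)⟩⟩

/-- In the even case, a clique which realizes a pattern over `C` determines, up to opposites, the
adjacency to the vertices of the cliques of `C`. A finite set of cliques is avoided by prescribing
other values at additional vertices in the clique of some `z₀ ∈ C`. -/
theorem Even.exists_pattern_not_sameClique {V : Type*} {G : ColoredGraph V}
    (hG : G.IsUltrahomogeneous) (hC : G.CliqueClasses) {c : Color} (heven : G.Even c)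
    (hc : ∃ u, G.color u = c) (hs' : G.Splits c.other) (hinf' : G.SplitsInf c.other)
    {C : Set V} (hfin : C.Finite) (hcol : ∀ z ∈ C, G.color z ≠ c) {z₀ : V} (hz₀ : z₀ ∈ C)
    (X : V → Prop) {F : Set V} (hF : F.Finite) :
    ∃ u, G.color u = c ∧ (∀ z ∈ C, G.graph.Adj z u ↔ X z) ∧ ∀ m ∈ F, ¬ G.SameClique m u := by
  classical
  induction F, hF using Set.Finite.induction_on generalizing C X with
  | empty =>
    obtain ⟨u, hu, huX⟩ := hs'.exists_pattern hG hC (by simpa only [color_ne_other_iff] using hc)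
      hfin (fun z hz => color_ne_iff_eq_other.1 (hcol z hz)) (X := X) (Or.inl hinf')
    exact ⟨u, color_ne_other_iff.1 hu, huX, by simp⟩
  | @insert m F _ _ ih =>
    obtain ⟨u₀, hu₀⟩ := hc
    obtain ⟨z, hz, hzC⟩ := (hinf'.infinite_clique (b := u₀) (color_ne_other_iff.2 hu₀)
      (color_ne_iff_eq_other.1 (hcol z₀ hz₀))).exists_notMem_finite hfin
    have hz : G.SameClique z₀ z := hz
    have hzc : G.color z ≠ c := hz.color_eq ▸ hcol z₀ hz₀
    have hne : ∀ x ∈ C, x ≠ z := fun x hx h => hzC (h ▸ hx)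
    obtain ⟨u, hu, huX, huF⟩ := ih (hfin.insert z)
      (by rintro x (rfl | hx)
          · exact hzc
          · exact hcol x hx) (Or.inr hz₀)
      (Function.update X z (¬ ((G.graph.Adj z₀ m ↔ G.graph.Adj z m) ↔ X z₀)))
    have huC : ∀ x ∈ C, G.graph.Adj x u ↔ X x := fun x hx => by
      have := huX x (Or.inr hx)
      rwa [Function.update_of_ne (hne x hx)] at this
    refine ⟨u, hu, huC, ?_⟩
    rintro m' (rfl | hm')
    · intro hmu
      have h1 := heven z₀ z (hcol z₀ hz₀) hz m' u (hmu.1.trans hu) hmu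
      have h2 := huX z (Or.inl rfl)
      rw [Function.update_self] at h2
      have h3 := huC z₀ hz₀
      clear * - h1 h2 h3
      tauto
    · exact huF m' hm'

theorem Even.manyCliques {V : Type*} {G : ColoredGraph V}
    (hG : G.IsUltrahomogeneous) (hC : G.CliqueClasses) {c : Color} (heven : G.Even c)
    (hc : ∃ u, G.color u = c) (hb : ∃ b, G.color b ≠ c) (hs' : G.Splits c.other)
    (hinf' : G.SplitsInf c.other) : G.ManyCliques c := by
  intro F hF
  obtain ⟨b, hb⟩ := hb
  obtain ⟨u, hu, -, huF⟩ := heven.exists_pattern_not_sameClique hG hC hc hs' hinf'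
    (Set.finite_singleton b) (by simpa using hb) (Set.mem_singleton b) (fun _ => True) hF
  exact ⟨u, hu, huF⟩

/-! ### Numbers of cliques -/

theorem CliqueClasses.of_isRealizedIn {W V : Type*} {H : ColoredGraph W} {G : ColoredGraph V}
    (hC : G.CliqueClasses) (h : H.IsRealizedIn G) : H.CliqueClasses := by
  obtain ⟨f, hf⟩ := isRealizedIn_iff.1 h
  intro c u v w hu hv hw huv hvw huw
  rw [← hf.adj u trivial w trivial]
  refine hC c (f u) (f v) (f w) ?_ ?_ ?_ ((hf.adj _ trivial _ trivial).2 huv)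
    ((hf.adj _ trivial _ trivial).2 hvw) (fun h => huw (hf.inj trivial trivial h))
  · rwa [hf.color u trivial]
  · rwa [hf.color v trivial]
  · rwa [hf.color w trivial]

theorem encard_maxCliques_le {W V : Type*} {H : ColoredGraph W} {G : ColoredGraph V}
    (hC : G.CliqueClasses) (h : H.IsRealizedIn G) (c : Color) :
    (H.maxCliques c).encard ≤ (G.maxCliques c).encard := by
  have hCH := hC.of_isRealizedIn h
  obtain ⟨f, hf⟩ := isRealizedIn_iff.1 h
  have hrep : ∀ M ∈ H.maxCliques c, ∃ w, H.color w = c ∧ M = H.cliqueOf w :=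
    fun M hM => (mem_maxCliques_iff hCH).1 hM
  rcases (H.maxCliques c).eq_empty_or_nonempty with h0 | ⟨M₀, hM₀⟩
  · simp [h0]
  have : Nonempty W := ⟨(hrep M₀ hM₀).choose⟩
  choose! r hrc hr using hrep
  refine Set.encard_le_encard_of_injOn (f := fun M => G.cliqueOf (f (r M))) ?_ ?_
  · exact fun M hM => (mem_maxCliques_iff hC).2
      ⟨f (r M), (hf.color _ trivial).trans (hrc M hM), rfl⟩
  · intro M hM N hN hMN
    rw [hr M hM, hr N hN, cliqueOf_eq_iff hCH, ← hf.sameClique trivial trivial,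
      ← cliqueOf_eq_iff hC]
    exact hMN

theorem ManyCliques.encard_maxCliques {V : Type*} {G : ColoredGraph V} (hC : G.CliqueClasses)
    {c : Color} (h : G.ManyCliques c) : (G.maxCliques c).encard = ⊤ := by
  rw [Set.encard_eq_top_iff]
  intro hfin
  have hrep : ∀ M ∈ G.maxCliques c, ∃ w, G.color w = c ∧ M = G.cliqueOf w :=
    fun M hM => (mem_maxCliques_iff hC).1 hM
  have : Nonempty V := ⟨(h ∅ Set.finite_empty).choose⟩
  choose! r hrc hr using hrep
  obtain ⟨y, hy, hyF⟩ := h _ (hfin.image r)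
  have hM : G.cliqueOf y ∈ G.maxCliques c := (mem_maxCliques_iff hC).2 ⟨y, hy, rfl⟩
  exact hyF _ ⟨_, hM, rfl⟩ ((cliqueOf_eq_iff hC).1 (hr _ hM).symm)

theorem omits_monoCoK_iff {V : Type*} {G : ColoredGraph V} (hC : G.CliqueClasses) {c : Color}
    {k : ℕ} : G.Omits (monoCoK c (k + 1)) ↔ (G.maxCliques c).encard ≤ k := by
  rw [Omits, isRealizedIn_iff, ← not_iff_not, not_not, not_le]
  constructor
  · rintro ⟨f, hf⟩
    have hne : ∀ i j, i ≠ j → ¬ G.SameClique (f i) (f j) := fun i j hij h =>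
      (hf.adj i trivial j trivial).1 (h.adj fun h' => hij (hf.inj trivial trivial h'))
    have h1 : (Set.range fun i => G.cliqueOf (f i)) ⊆ G.maxCliques c := by
      rintro _ ⟨i, rfl⟩
      exact (mem_maxCliques_iff hC).2 ⟨f i, hf.color i trivial, rfl⟩
    have h2 : Function.Injective fun i => G.cliqueOf (f i) := fun i j hij => by
      by_contra hne'
      exact hne i j hne' ((cliqueOf_eq_iff hC).1 hij)
    have h3 := Set.encard_le_encard h1
    rw [← Set.image_univ, h2.encard_image, Set.encard_univ, ENat.card_eq_coe_fintype_card,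
      Fintype.card_fin] at h3
    exact lt_of_lt_of_le (by exact_mod_cast Nat.lt_succ_self k) h3
  · intro h
    have h' : ((k + 1 : ℕ) : ℕ∞) ≤ (G.maxCliques c).encard := by
      have := Order.add_one_le_of_lt h
      exact_mod_cast this
    obtain ⟨t, ht, htk⟩ := Set.exists_subset_encard_eq h'
    have htfin : t.Finite := Set.finite_of_encard_eq_coe htk
    have hcard : Nat.card t = k + 1 := by
      rw [Nat.card_coe_set_eq, Set.ncard_def, htk]
      rfl
    have := htfin.to_subtype
    let e := (Finite.equivFinOfCardEq hcard).symm
    have hrep : ∀ i, ∃ w, G.color w = c ∧ (e i : Set V) = G.cliqueOf w :=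
      fun i => (mem_maxCliques_iff hC).1 (ht (e i).2)
    choose r hrc hr using hrep
    have hsame : ∀ i j, G.SameClique (r i) (r j) → i = j := fun i j hij => by
      rw [← cliqueOf_eq_iff hC, ← hr, ← hr] at hij
      exact e.injective (Subtype.ext hij)
    refine ⟨r, fun i _ j _ hij => hsame i j (hij ▸ SameClique.refl G _), fun i _ => hrc i,
      fun i _ j _ => iff_of_false (fun h => ?_) id⟩
    have := hsame i j ⟨(hrc i).trans (hrc j).symm, Or.inr h⟩
    exact h.ne (this ▸ rfl)

/-! ### Embedding finite graphs, one color class after the other -/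

/-- The embedding `f` of `H[S]` extends to the vertex `v`. Adjacency is expressed through cliques
for vertices of the same color. -/
def HasStep {W V : Type*} (H : ColoredGraph W) (G : ColoredGraph V) (S : Set W) (f : W → V)
    (v : W) : Prop :=
  ∃ y, G.color y = H.color v ∧ (∀ s ∈ S, f s ≠ y) ∧
    (∀ s ∈ S, H.color s = H.color v → (G.SameClique (f s) y ↔ H.SameClique s v)) ∧
    ∀ s ∈ S, H.color s ≠ H.color v → (G.graph.Adj (f s) y ↔ H.graph.Adj s v)

open Classical in
theorem IsEmbOn.update {W V : Type*} {H : ColoredGraph W} {G : ColoredGraph V}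
    {S : Set W} {f : W → V} {v : W} (hf : IsEmbOn H G S f) (hv : v ∉ S) {y : V}
    (hyc : G.color y = H.color v) (hyS : ∀ s ∈ S, f s ≠ y)
    (hadj : ∀ s ∈ S, (G.graph.Adj (f s) y ↔ H.graph.Adj s v)) :
    IsEmbOn H G (insert v S) (Function.update f v y) := by
  have hne : ∀ s ∈ S, s ≠ v := fun s hs h => hv (h ▸ hs)
  have heq : Set.EqOn (Function.update f v y) f S := fun s hs => Function.update_of_ne (hne s hs) _ _
  refine ⟨?_, ?_, ?_⟩
  · rw [Set.injOn_insert hv]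
    refine ⟨hf.inj.congr heq.symm, ?_⟩
    rw [Set.image_congr heq]
    rintro ⟨s, hs, hsy⟩
    exact hyS s hs (by simpa using hsy)
  · rintro s (rfl | hs)
    · simpa using hyc
    · rw [heq hs]
      exact hf.color s hs
  · rintro s (rfl | hs) t (rfl | ht)
    · simp
    · rw [heq ht, Function.update_self, G.graph.adj_comm, hadj t ht, H.graph.adj_comm]
    · rw [heq hs, Function.update_self, hadj s hs]
    · rw [heq hs, heq ht]
      exact hf.adj s hs t ht

theorem HasStep.exists_isEmbOn {W V : Type*} {H : ColoredGraph W} {G : ColoredGraph V}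
    {S : Set W} {f : W → V} {v : W} (h : HasStep H G S f v) (hf : IsEmbOn H G S f) (hv : v ∉ S) :
    ∃ g, IsEmbOn H G (insert v S) g := by
  obtain ⟨y, hyc, hyS, hsame, hcross⟩ := h
  refine ⟨_, hf.update hv hyc hyS fun s hs => ?_⟩
  by_cases hc : H.color s = H.color v
  · have hne : s ≠ v := fun h => hv (h ▸ hs)
    rw [adj_iff_sameClique hc, adj_iff_sameClique (by rw [hf.color s hs, hc, hyc]), hsame s hs hc]
    exact and_congr_left fun _ => ⟨fun _ => hne, fun _ => hyS s hs⟩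
  · exact hcross s hs hc

theorem isRealizedIn_of_hasStep {W V : Type*} [Finite W] [Nonempty V] {H : ColoredGraph W}
    {G : ColoredGraph V} (c : Color)
    (h1 : ∀ (S : Set W) (f : W → V) (v : W), IsEmbOn H G S f → (∀ s ∈ S, H.color s = c) →
      H.color v = c → v ∉ S → HasStep H G S f v)
    (h2 : ∀ (S : Set W) (f : W → V) (v : W), IsEmbOn H G S f → H.colorClass c ⊆ S →
      H.color v ≠ c → v ∉ S → HasStep H G S f v) : H.IsRealizedIn G := by
  have hstep1 : ∀ S : Set W, S ⊆ H.colorClass c → ∃ f, IsEmbOn H G S f := by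
    intro S hS
    induction S, S.toFinite using Set.Finite.induction_on with
    | empty => exact ⟨fun _ => Classical.arbitrary V, by simp, by simp, by simp⟩
    | @insert v S hv _ ih =>
      obtain ⟨f, hf⟩ := ih fun s hs => hS (Or.inr hs)
      exact (h1 S f v hf (fun s hs => hS (Or.inr hs)) (hS (Or.inl rfl)) hv).exists_isEmbOn hf hv
  have hstep2 : ∀ S : Set W, ∃ f, IsEmbOn H G (S ∪ H.colorClass c) f := by
    intro S
    induction S, S.toFinite using Set.Finite.induction_on with
    | empty => simpa using hstep1 _ subset_rfl
    | @insert v S hv _ ih =>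
      obtain ⟨f, hf⟩ := ih
      rw [Set.insert_union]
      by_cases hv' : v ∈ S ∪ H.colorClass c
      · rw [Set.insert_eq_of_mem hv']
        exact ⟨f, hf⟩
      · exact (h2 _ f v hf Set.subset_union_right (fun h => hv' (Or.inr h)) hv').exists_isEmbOn
          hf hv'
  obtain ⟨f, hf⟩ := hstep2 Set.univ
  exact isRealizedIn_iff.2 ⟨f, by simpa using hf⟩

/-- If `G` has at least as many cliques of color `c` as `H`, then there is a clique of `G` for the
next vertex of `H`. -/
theorem IsEmbOn.exists_clique {W V : Type*} [Finite W] {H : ColoredGraph W}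
    {G : ColoredGraph V} (hCH : H.CliqueClasses) (hC : G.CliqueClasses) {S : Set W} {f : W → V}
    (hf : IsEmbOn H G S f) {v : W} {c : Color}
    (hcard : (H.maxCliques c).encard ≤ (G.maxCliques c).encard) (hvc : H.color v = c) :
    ∃ u, G.color u = c ∧ ∀ s ∈ S, G.SameClique (f s) u ↔ H.SameClique s v := by
  by_cases hex : ∃ s ∈ S, H.SameClique s v
  · obtain ⟨s, hs, hsv⟩ := hex
    refine ⟨f s, by rw [hf.color s hs, ← hvc, hsv.color_eq], fun t ht => ?_⟩
    rw [hf.sameClique ht hs]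
    exact ⟨fun h => SameClique.trans hCH h hsv, fun h => SameClique.trans hCH h hsv.symm⟩
  · by_contra hcon
    have hrep : ∀ M ∈ G.maxCliques c, ∃ s ∈ S, H.color s = c ∧ M = G.cliqueOf (f s) := by
      intro M hM
      obtain ⟨u, hu, rfl⟩ := (mem_maxCliques_iff hC).1 hM
      by_contra! hne
      refine hcon ⟨u, hu, fun s hs => iff_of_false (fun h => ?_) fun h => hex ⟨s, hs, h⟩⟩
      refine hne s hs ?_ ((cliqueOf_eq_iff hC).2 h).symm
      rw [← hf.color s hs, h.1, hu]
    have : Nonempty W := ⟨v⟩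
    choose! r hrS hrc hr using hrep
    have hle : (G.maxCliques c).encard ≤ (H.maxCliques c \ {H.cliqueOf v}).encard := by
      refine Set.encard_le_encard_of_injOn (f := fun M => H.cliqueOf (r M)) ?_ ?_
      · refine fun M hM => ⟨(mem_maxCliques_iff hCH).2 ⟨r M, hrc M hM, rfl⟩, fun h => ?_⟩
        exact hex ⟨r M, hrS M hM, (cliqueOf_eq_iff hCH).1 h⟩
      · intro M hM N hN hMN
        rw [hr M hM, hr N hN, cliqueOf_eq_iff hC, hf.sameClique (hrS M hM) (hrS N hN),
          ← cliqueOf_eq_iff hCH]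
        exact hMN
    have hmem : H.cliqueOf v ∈ H.maxCliques c := (mem_maxCliques_iff hCH).2 ⟨v, hvc, rfl⟩
    have h1 := hcard.trans hle
    rw [← Set.encard_sdiff_singleton_add_one hmem] at h1
    have hfin : (H.maxCliques c \ {H.cliqueOf v}).encard ≠ ⊤ :=
      Set.encard_ne_top_iff.2 (Set.toFinite _)
    exact absurd h1 (not_le.2 (ENat.lt_add_one_iff hfin |>.2 le_rfl))

/-- The cliques of color `c` of `G` have room for those of `H`. -/
def HasRoom {W V : Type*} (H : ColoredGraph W) (G : ColoredGraph V) (c : Color) : Prop :=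
  (H.maxCliques c).encard ≤ (G.maxCliques c).encard ∧
    ((∀ u, G.color u = c → (G.cliqueOf u).Infinite) ∨
      H.TriFree c ∧ ∀ u, G.color u = c → ∃ w, G.SameClique u w ∧ w ≠ u)

theorem HasRoom.exists_vertex {W V : Type*} [Finite W] {H : ColoredGraph W}
    {G : ColoredGraph V} {c : Color} (h : HasRoom H G c) (hCH : H.CliqueClasses)
    (hC : G.CliqueClasses) {S : Set W} {f : W → V} (hf : IsEmbOn H G S f) {v : W} (hv : v ∉ S)
    (hvc : H.color v = c) :
    ∃ y, G.color y = c ∧ (∀ s ∈ S, f s ≠ y) ∧ ∀ s ∈ S, G.SameClique (f s) y ↔ H.SameClique s v := by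
  obtain ⟨u, hu, huS⟩ := hf.exists_clique hCH hC h.1 hvc
  have hgoal : ∀ y, G.SameClique u y → ∀ s ∈ S, G.SameClique (f s) y ↔ H.SameClique s v :=
    fun y hy s hs => by
      rw [← huS s hs]
      exact ⟨fun h => SameClique.trans hC h hy.symm, fun h => SameClique.trans hC h hy⟩
  rcases h.2 with h | ⟨htri, hpart⟩
  · obtain ⟨y, hy, hyS⟩ := (h u hu).exists_notMem_finite (S.toFinite.image f)
    exact ⟨y, (SameClique.color_eq hy).trans hu, fun s hs hsy => hyS ⟨s, hs, hsy⟩, hgoal y hy⟩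
  · by_cases hex : ∃ s ∈ S, H.SameClique s v
    · obtain ⟨s, hs, hsv⟩ := hex
      have hne : ∀ s ∈ S, s ≠ v := fun s hs h => hv (h ▸ hs)
      have hus := ((huS s hs).2 hsv).symm
      obtain ⟨y, hy, hys⟩ := hpart (f s) (hus.color_eq.trans hu)
      have huy : G.SameClique u y := SameClique.trans hC hus hy
      refine ⟨y, huy.color_eq.trans hu, fun t ht hty => ?_, hgoal y huy⟩
      have hts : t ≠ s := fun h => hys (by rw [← hty, h])
      have htv : H.SameClique t v := (hgoal y huy t ht).1 (hty ▸ SameClique.refl G _)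
      have hsc : H.color s = c := by rw [← hvc, hsv.color_eq]
      have htc : H.color t = c := by rw [← hvc, htv.color_eq]
      exact htri t s v htc hsc hvc ((SameClique.trans hCH htv hsv.symm).adj hts)
        (hsv.adj (hne s hs)) (htv.adj (hne t ht))
    · refine ⟨u, hu, fun s hs h => hex ⟨s, hs, ?_⟩, hgoal u (SameClique.refl G u)⟩
      rw [← huS s hs, h]
      exact SameClique.refl G u

theorem HasRoom.hasStep {W V : Type*} [Finite W] {H : ColoredGraph W}
    {G : ColoredGraph V} {c : Color} (h : HasRoom H G c) (hCH : H.CliqueClasses)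
    (hC : G.CliqueClasses) {S : Set W} {f : W → V} (hf : IsEmbOn H G S f)
    (hS : ∀ s ∈ S, H.color s = c) {v : W} (hv : v ∉ S)
    (hvc : H.color v = c) : HasStep H G S f v := by
  obtain ⟨y, hyc, hyS, hy⟩ := h.exists_vertex hCH hC hf hv hvc
  exact ⟨y, hyc.trans hvc.symm, hyS, fun s hs _ => hy s hs,
    fun s hs hne => absurd ((hS s hs).trans hvc.symm) hne⟩

theorem SplitsInf.hasRoom {W V : Type*} {H : ColoredGraph W} {G : ColoredGraph V} {c : Color}
    (h : G.SplitsInf c) (hb : ∃ b, G.color b ≠ c)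
    (hcard : (H.maxCliques c).encard ≤ (G.maxCliques c).encard) : HasRoom H G c :=
  ⟨hcard, Or.inl fun _ hu => h.infinite_clique hb.choose_spec hu⟩

theorem Splits.hasRoom {W V : Type*} {H : ColoredGraph W} {G : ColoredGraph V} {c : Color}
    (h : G.Splits c) (hb : ∃ b, G.color b ≠ c) (htri : H.TriFree c)
    (hcard : (H.maxCliques c).encard ≤ (G.maxCliques c).encard) : HasRoom H G c := by
  refine ⟨hcard, Or.inr ⟨htri, fun u hu => ?_⟩⟩
  obtain ⟨b, hb⟩ := hb
  obtain ⟨w, hw, hbw⟩ := h.exists_adj_iff hb hu (¬ G.graph.Adj b u)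
  exact ⟨w, hw, fun h => by simp [h] at hbw⟩

/-- The pattern that the vertex `v` of `H` prescribes over the image of `S`. -/
def imagePattern {W V : Type*} (H : ColoredGraph W) (S : Set W) (f : W → V) (v : W) (a : V) :
    Prop :=
  ∃ s ∈ S, f s = a ∧ H.graph.Adj s v

theorem IsEmbOn.imagePattern_iff {W V : Type*} {H : ColoredGraph W} {G : ColoredGraph V}
    {S : Set W} {f : W → V} (hf : IsEmbOn H G S f) {v s : W} (hs : s ∈ S) :
    imagePattern H S f v (f s) ↔ H.graph.Adj s v := by
  constructor
  · rintro ⟨t, ht, hts, h⟩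
    rwa [← hf.inj ht hs hts]
  · exact fun h => ⟨s, hs, rfl, h⟩

/-- Every vertex of color different from `c` is adjacent to exactly one of any two adjacent
vertices of color `c`. -/
def ExactlyOne {V : Type*} (G : ColoredGraph V) (c : Color) : Prop :=
  ∀ x y w, G.color x = c → G.color y = c → G.color w ≠ c → G.graph.Adj x y →
    (G.graph.Adj w x ↔ ¬ G.graph.Adj w y)

theorem IsEmbOn.separatesAdj {W V : Type*} {H : ColoredGraph W} {G : ColoredGraph V}
    {S : Set W} {f : W → V} (hf : IsEmbOn H G S f) {c : Color} (hH : H.ExactlyOne c) {v : W}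
    (hv : H.color v ≠ c) :
    G.SeparatesAdj (f '' {s ∈ S | H.color s = c}) (imagePattern H S f v) := by
  rintro _ ⟨s, ⟨hs, hsc⟩, rfl⟩ _ ⟨t, ⟨ht, htc⟩, rfl⟩ hst
  rw [hf.imagePattern_iff hs, hf.imagePattern_iff ht, H.graph.adj_comm s, H.graph.adj_comm t]
  exact hH s t v hsc htc hv ((hf.adj s hs t ht).1 hst)

theorem exists_pairwise_not_sameClique {V : Type*} {G : ColoredGraph V} {C : Set V}
    (hfin : C.Finite) :
    ∃ D ⊆ C, (∀ x ∈ D, ∀ y ∈ D, x ≠ y → ¬ G.SameClique x y) ∧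
      ∀ x ∈ C, ∃ y ∈ D, G.SameClique x y := by
  induction C, hfin using Set.Finite.induction_on with
  | empty => exact ⟨∅, by simp⟩
  | @insert a C _ _ ih =>
    obtain ⟨D, hDC, hD, hCD⟩ := ih
    by_cases h : ∃ y ∈ D, G.SameClique a y
    · refine ⟨D, hDC.trans (Set.subset_insert a C), hD, ?_⟩
      rintro x (rfl | hx)
      · exact h
      · exact hCD x hx
    · refine ⟨insert a D, Set.insert_subset_insert hDC, ?_, ?_⟩
      · rintro x (rfl | hx) y (rfl | hy) hxy
        · exact absurd rfl hxy
        · exact fun h' => h ⟨y, hy, h'⟩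
        · exact fun h' => h ⟨x, hx, h'.symm⟩
        · exact hD x hx y hy hxy
      · rintro x (rfl | hx)
        · exact ⟨x, Or.inl rfl, SameClique.refl G x⟩
        · obtain ⟨y, hy, hxy⟩ := hCD x hx
          exact ⟨y, Or.inr hy, hxy⟩

/-! ### The finite graphs realized in each case -/

/-- If the second color class is independent or a clique: embed the vertices of color `c` first. -/
theorem isRealizedIn_of_indep_or_clique {W V : Type*} [Finite W] {H : ColoredGraph W}
    {G : ColoredGraph V} (hG : G.IsUltrahomogeneous) (hC : G.CliqueClasses)
    (hCH : H.CliqueClasses) {c : Color} (hs : G.Splits c) (hb : ∃ b, G.color b ≠ c)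
    (hc : ∃ u, G.color u = c) (hcard : (H.maxCliques c).encard ≤ (G.maxCliques c).encard)
    (hcase : G.SplitsInf c ∨ G.ManyCliques c ∧ H.TriFree c ∧ H.ExactlyOne c)
    (hd : (G.IsIndep c.other ∧ H.IsIndep c.other) ∨
      (G.IsSingleClique c.other ∧ H.IsSingleClique c.other)) : H.IsRealizedIn G := by
  have : Nonempty V := ⟨hc.choose⟩
  have hroom : HasRoom H G c := by
    rcases hcase with h | h
    · exact h.hasRoom hb hcard
    · exact hs.hasRoom hb h.2.1 hcard
  refine isRealizedIn_of_hasStep c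
    (fun S f v hf hS hvc hv => hroom.hasStep hCH hC hf hS hv hvc) fun S f v hf hS hvc hv => ?_
  obtain ⟨y, hyF, hyc, hy⟩ := hs.exists_pattern_notMem hG hC hb hc
    (A := f '' {s ∈ S | H.color s = c}) (Set.toFinite _)
    (by rintro _ ⟨s, ⟨hs, hsc⟩, rfl⟩
        rw [hf.color s hs, hsc]) (X := imagePattern H S f v)
    (hcase.imp_right fun h => ⟨h.1, hf.separatesAdj h.2.2 hvc⟩) (S.toFinite.image f)
  have hyS : ∀ s ∈ S, f s ≠ y := fun s hs h => hyF ⟨s, hs, h⟩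
  refine ⟨y, color_eq_of_ne_of_ne hyc hvc, hyS, fun s hs hsv => ?_, fun s hs hsv => ?_⟩
  · have hne : s ≠ v := fun h => hv (h ▸ hs)
    have hsd : H.color s = c.other := color_ne_iff_eq_other.1 (hsv ▸ hvc)
    have hvd := color_ne_iff_eq_other.1 hvc
    have hyd := color_ne_iff_eq_other.1 hyc
    have hfd : G.color (f s) = c.other := (hf.color s hs).trans hsd
    rcases hd with h | h
    · exact iff_of_false (fun h' => h.1 _ _ hfd hyd (h'.adj (hyS s hs)))
        fun h' => h.2 _ _ hsd hvd (h'.adj hne)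
    · exact iff_of_true ⟨hfd.trans hyd.symm, Or.inr (h.1 _ _ hfd hyd (hyS s hs))⟩
        ⟨hsv, Or.inr (h.2 _ _ hsd hvd hne)⟩
  · have hsc : H.color s = c := by
      by_contra h
      exact hsv (color_eq_of_ne_of_ne h hvc)
    rw [hy (f s) ⟨s, ⟨hs, hsc⟩, rfl⟩, hf.imagePattern_iff hs]

/-- The case of cliques with two vertices in both colors. The partner of a vertex is determined by
that vertex, so only vertices in new cliques need a pattern. -/
theorem isRealizedIn_of_triFree {W V : Type*} [Finite W] {H : ColoredGraph W}
    {G : ColoredGraph V} (hG : G.IsUltrahomogeneous) (hC : G.CliqueClasses)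
    (hCH : H.CliqueClasses) {c : Color} (hs : G.Splits c) (hs' : G.Splits c.other)
    (hb : ∃ b, G.color b ≠ c) (hc : ∃ u, G.color u = c) (hm : G.ManyCliques c)
    (hm' : G.ManyCliques c.other) (ht : G.TriFree c) (htH : ∀ c, H.TriFree c)
    (hH : ∀ c, H.ExactlyOne c) : H.IsRealizedIn G := by
  have : Nonempty V := ⟨hc.choose⟩
  have hc' : ∃ b, G.color b ≠ c.other := by simpa only [color_ne_other_iff] using hc
  have hroom : HasRoom H G c.other :=
    hs'.hasRoom hc' (htH _) (hm'.encard_maxCliques hC ▸ le_top)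
  refine isRealizedIn_of_hasStep c.other
    (fun S f v hf hS hvc hv => hroom.hasStep hCH hC hf hS hv hvc) fun S f v hf hS hvc hv => ?_
  have hvc' := color_ne_other_iff.1 hvc
  by_cases hex : ∃ s ∈ S, H.SameClique s v
  · -- the partner of `v` has been embedded already
    have hroom' : HasRoom H G c := hs.hasRoom hb (htH c) (hm.encard_maxCliques hC ▸ le_top)
    obtain ⟨y, hyc, hyS, hy⟩ := hroom'.exists_vertex hCH hC hf hv hvc'
    refine ⟨y, hyc.trans hvc'.symm, hyS, fun s hs _ => hy s hs, fun s hs' hsv => ?_⟩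
    obtain ⟨t, ht', htv⟩ := hex
    have htc : H.color t = c := by rw [← hvc', htv.color_eq]
    have hsc : H.color s ≠ c := hvc' ▸ hsv
    have h1 := hs.adj_iff_not_adj ht hC (x := y) (y := f t) (w := f s) hyc
      (by rw [hf.color t ht', htc]) (by rwa [hf.color s hs'])
      (((hy t ht').2 htv).adj (hyS t ht')).symm
    have h2 := hH c v t s hvc' htc hsc (htv.adj fun h => hv (h ▸ ht')).symm
    rw [h1, h2, hf.adj s hs' t ht']
  · obtain ⟨y, hyF, hyc, hy⟩ := hs'.exists_pattern_notMem hG hC hc'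
      (by simpa only [color_ne_iff_eq_other] using hb)
      (A := f '' {s ∈ S | H.color s = c.other}) (Set.toFinite _)
      (by rintro _ ⟨s, ⟨hs, hsc⟩, rfl⟩
          rw [hf.color s hs, hsc]) (X := imagePattern H S f v)
      (Or.inr ⟨hm', hf.separatesAdj (hH _) hvc⟩)
      (F := ⋃ a ∈ f '' {s ∈ S | H.color s = c}, G.cliqueOf a)
      ((Set.toFinite _).biUnion (by
        rintro _ ⟨s, ⟨hs, hsc⟩, rfl⟩
        exact ht.finite_clique hC (by rw [hf.color s hs, hsc])))
    have hyc' := color_ne_other_iff.1 hyc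
    have hyS : ∀ s ∈ S, ¬ G.SameClique (f s) y := fun s hs h =>
      hyF (Set.mem_biUnion ⟨s, ⟨hs, by rw [← hf.color s hs, h.1, hyc']⟩, rfl⟩ h)
    refine ⟨y, hyc'.trans hvc'.symm, fun s hs h => hyS s hs (h ▸ SameClique.refl G _),
      fun s hs _ => iff_of_false (hyS s hs) fun h => hex ⟨s, hs, h⟩, fun s hs hsv => ?_⟩
    have hsc : H.color s = c.other := color_ne_iff_eq_other.1 (hvc' ▸ hsv)
    rw [hy (f s) ⟨s, ⟨hs, hsc⟩, rfl⟩, hf.imagePattern_iff hs]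

/-- The case in which each clique of color `c` realizes the patterns prescribed by `H`: embed the
vertices of the other color first. -/
theorem isRealizedIn_of_clique_patterns {W V : Type*} [Finite W] [Nonempty V]
    {H : ColoredGraph W} {G : ColoredGraph V} (hC : G.CliqueClasses) (hCH : H.CliqueClasses)
    {c : Color} (hcard : (H.maxCliques c).encard ≤ (G.maxCliques c).encard)
    (hroom : HasRoom H G c.other)
    (hpat : ∀ C : Set V, C.Finite → (∀ z ∈ C, G.color z ≠ c) → ∀ X : V → Prop,
      (H.ExactlyOne c.other → G.SeparatesAdj C X) → ∀ u, G.color u = c → ∀ F : Set V, F.Finite →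
        ∃ y ∉ F, G.SameClique u y ∧ ∀ z ∈ C, G.graph.Adj z y ↔ X z) : H.IsRealizedIn G := by
  refine isRealizedIn_of_hasStep c.other
    (fun S f v hf hS hvc hv => hroom.hasStep hCH hC hf hS hv hvc) fun S f v hf hS hvc hv => ?_
  have hvc' := color_ne_other_iff.1 hvc
  obtain ⟨u, hu, huS⟩ := hf.exists_clique hCH hC hcard hvc'
  obtain ⟨y, hyF, huy, hy⟩ := hpat (f '' {s ∈ S | H.color s = c.other}) (Set.toFinite _)
    (by rintro _ ⟨s, ⟨hs, hsc⟩, rfl⟩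
        rw [hf.color s hs, hsc]
        exact color_ne_iff_eq_other.2 rfl) (imagePattern H S f v)
    (fun h => hf.separatesAdj h hvc) u hu (f '' S) (S.toFinite.image f)
  refine ⟨y, huy.color_eq.trans (hu.trans hvc'.symm), fun s hs h => hyF ⟨s, hs, h⟩,
    fun s hs _ => ?_, fun s hs hsv => ?_⟩
  · rw [← huS s hs]
    exact ⟨fun h => SameClique.trans hC h huy.symm, fun h => SameClique.trans hC h huy⟩
  · have hsc : H.color s = c.other := color_ne_iff_eq_other.1 (hvc' ▸ hsv)
    rw [hy (f s) ⟨s, ⟨hs, hsc⟩, rfl⟩, hf.imagePattern_iff hs]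

/-- Finitely many vertices can be avoided when realizing patterns in a clique: prescribe the
opposite of their adjacency at additional vertices. -/
theorem FullOver.exists_notMem {V : Type*} {G : ColoredGraph V} {c : Color} {T : Set V → Prop}
    (hfull : ∀ C, C.Finite → T C → G.FullOver c C)
    (hext : ∀ C, C.Finite → T C → ∃ z ∉ C, T (insert z C)) {C : Set V} (hfin : C.Finite)
    (hT : T C) (X : V → Prop) {u : V} (hu : G.color u = c) {F : Set V} (hF : F.Finite) :
    ∃ y ∉ F, G.SameClique u y ∧ ∀ z ∈ C, G.graph.Adj z y ↔ X z := by
  classical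
  induction F, hF using Set.Finite.induction_on generalizing C X with
  | empty =>
    obtain ⟨y, hy⟩ := hfull C hfin hT u hu X
    exact ⟨y, by simp, hy⟩
  | @insert m F _ _ ih =>
    obtain ⟨z, hz, hTz⟩ := hext C hfin hT
    have hne : ∀ x ∈ C, x ≠ z := fun x hx h => hz (h ▸ hx)
    obtain ⟨y, hyF, huy, hy⟩ := ih (hfin.insert z) hTz
      (Function.update X z (¬ G.graph.Adj z m))
    refine ⟨y, ?_, huy, fun x hx => ?_⟩
    · rintro (rfl | h)
      · have := hy z (Or.inl rfl)
        simp at this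
      · exact hyF h
    · have := hy x (Or.inr hx)
      rwa [Function.update_of_ne (hne x hx)] at this

theorem isRealizedIn_of_fullOver {W V : Type*} [Finite W]
    {H : ColoredGraph W} {G : ColoredGraph V} (hC : G.CliqueClasses) (hCH : H.CliqueClasses)
    {c : Color} (hcard : ∀ c, (H.maxCliques c).encard ≤ (G.maxCliques c).encard)
    (hc : ∃ u, G.color u = c) (hb : ∃ b, G.color b ≠ c) (hinf : G.SplitsInf c.other)
    (hfull : ∀ C : Set V, C.Finite → (∀ z ∈ C, G.color z ≠ c) → G.FullOver c C) :
    H.IsRealizedIn G := by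
  have : Nonempty V := ⟨hc.choose⟩
  have hc' : ∃ b, G.color b ≠ c.other := by simpa only [color_ne_other_iff] using hc
  refine isRealizedIn_of_clique_patterns hC hCH (hcard c) (hinf.hasRoom hc' (hcard _)) ?_
  intro C hfin hcol X _ u hu F hF
  refine FullOver.exists_notMem (T := fun C => ∀ z ∈ C, G.color z ≠ c) hfull ?_ hfin hcol X hu hF
  intro C hfin hcol
  obtain ⟨b, hb⟩ := hb
  obtain ⟨u, hu⟩ := hc'
  obtain ⟨z, hz, hzC⟩ := (hinf.infinite_clique hu
    (color_ne_iff_eq_other.1 hb)).exists_notMem_finite hfin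
  refine ⟨z, hzC, ?_⟩
  rintro x (rfl | hx)
  · exact SameClique.color_eq hz ▸ hb
  · exact hcol x hx

/-- The family of sets of vertices of color different from `c` in different cliques can be
extended if there are infinitely many such cliques. -/
theorem ManyCliques.exists_insert {V : Type*} {G : ColoredGraph V} {c : Color}
    (hm : G.ManyCliques c.other) {C : Set V} (hfin : C.Finite)
    (hC : (∀ z ∈ C, G.color z ≠ c) ∧ ∀ x ∈ C, ∀ y ∈ C, x ≠ y → ¬ G.SameClique x y) :
    ∃ z ∉ C, (∀ x ∈ insert z C, G.color x ≠ c) ∧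
      ∀ x ∈ insert z C, ∀ y ∈ insert z C, x ≠ y → ¬ G.SameClique x y := by
  obtain ⟨z, hz, hzC⟩ := hm C hfin
  refine ⟨z, fun h => hzC z h (SameClique.refl G z), ?_, ?_⟩
  · rintro x (rfl | hx)
    · exact color_ne_iff_eq_other.2 hz
    · exact hC.1 x hx
  · rintro x (rfl | hx) y (rfl | hy) hxy
    · exact absurd rfl hxy
    · exact fun h => hzC y hy h.symm
    · exact hzC x hx
    · exact hC.2 x hx y hy hxy

theorem isRealizedIn_of_infinite_of_triFree {W V : Type*} [Finite W]
    {H : ColoredGraph W} {G : ColoredGraph V} (hC : G.CliqueClasses) (hCH : H.CliqueClasses)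
    {c : Color} (hcard : (H.maxCliques c).encard ≤ (G.maxCliques c).encard)
    (hc : ∃ u, G.color u = c) (hs' : G.Splits c.other)
    (ht' : G.TriFree c.other) (hm' : G.ManyCliques c.other) (htH : H.TriFree c.other)
    (hH : H.ExactlyOne c.other)
    (hfull : ∀ C : Set V, C.Finite → (∀ z ∈ C, G.color z ≠ c) →
      (∀ x ∈ C, ∀ y ∈ C, x ≠ y → ¬ G.SameClique x y) → G.FullOver c C) :
    H.IsRealizedIn G := by
  have : Nonempty V := ⟨hc.choose⟩
  have hc' : ∃ b, G.color b ≠ c.other := by simpa only [color_ne_other_iff] using hc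
  refine isRealizedIn_of_clique_patterns hC hCH hcard
    (hs'.hasRoom hc' htH (hm'.encard_maxCliques hC ▸ le_top)) ?_
  intro C hfin hcol X hsep u hu F hF
  obtain ⟨D, hDC, hD, hCD⟩ := exists_pairwise_not_sameClique (G := G) hfin
  obtain ⟨y, hyF, huy, hy⟩ := FullOver.exists_notMem (T := fun C => (∀ z ∈ C, G.color z ≠ c) ∧
    ∀ x ∈ C, ∀ y ∈ C, x ≠ y → ¬ G.SameClique x y) (fun C h h' => hfull C h h'.1 h'.2)
    (fun C h h' => hm'.exists_insert h h') (hfin.subset hDC)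
    ⟨fun z hz => hcol z (hDC hz), hD⟩ X hu hF
  refine ⟨y, hyF, huy, fun x hx => ?_⟩
  obtain ⟨x', hx', hxx'⟩ := hCD x hx
  by_cases hne : x = x'
  · rw [hne]
    exact hy x' hx'
  · have h1 := hs'.adj_iff_not_adj ht' hC (color_ne_iff_eq_other.1 (hcol x hx))
      (color_ne_iff_eq_other.1 (hcol x' (hDC hx'))) (w := y)
      (color_ne_other_iff.2 (huy.color_eq.trans hu)) (hxx'.adj hne)
    rw [G.graph.adj_comm x, h1, G.graph.adj_comm y, hy x' hx',
      hsep hH x hx x' (hDC hx') (hxx'.adj hne)]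

/-- The even case. A vertex in an old clique needs a pattern over representatives of the cliques
of the other color only; a vertex in a new clique can have any pattern. -/
theorem isRealizedIn_of_even {W V : Type*} [Finite W]
    {H : ColoredGraph W} {G : ColoredGraph V} (hG : G.IsUltrahomogeneous) (hC : G.CliqueClasses)
    (hCH : H.CliqueClasses) {c : Color}
    (hc : ∃ u, G.color u = c) (hb : ∃ b, G.color b ≠ c) (hs' : G.Splits c.other)
    (hinf' : G.SplitsInf c.other) (hm' : G.ManyCliques c.other) (heven : G.Even c)
    (hevenH : H.Even c)
    (hfull : ∀ C : Set V, C.Finite → (∀ z ∈ C, G.color z ≠ c) →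
      (∀ x ∈ C, ∀ y ∈ C, x ≠ y → ¬ G.SameClique x y) → G.FullOver c C) :
    H.IsRealizedIn G := by
  have : Nonempty V := ⟨hc.choose⟩
  have hc' : ∃ b, G.color b ≠ c.other := by simpa only [color_ne_other_iff] using hc
  have hroom : HasRoom H G c.other :=
    hinf'.hasRoom hc' (hm'.encard_maxCliques hC ▸ le_top)
  refine isRealizedIn_of_hasStep c.other
    (fun S f v hf hS hvc hv => hroom.hasStep hCH hC hf hS hv hvc) fun S f v hf hS hvc hv => ?_
  have hvc' := color_ne_other_iff.1 hvc
  set A := f '' {s ∈ S | H.color s = c.other} with hA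
  have hAfin : A.Finite := Set.toFinite _
  have hAc : ∀ a ∈ A, G.color a ≠ c := by
    rintro _ ⟨s, ⟨hs, hsc⟩, rfl⟩
    rw [hf.color s hs, hsc]
    exact color_ne_iff_eq_other.2 rfl
  by_cases hex : ∃ s ∈ S, H.SameClique s v
  · obtain ⟨s, hs, hsv⟩ := hex
    have hsc : H.color s = c := by rw [← hvc', hsv.color_eq]
    have hfs : G.color (f s) = c := (hf.color s hs).trans hsc
    obtain ⟨D, hDA, hD, hAD⟩ := exists_pairwise_not_sameClique (G := G) hAfin
    obtain ⟨y, hyF, huy, hy⟩ := FullOver.exists_notMem (T := fun C => (∀ z ∈ C, G.color z ≠ c) ∧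
      ∀ x ∈ C, ∀ y ∈ C, x ≠ y → ¬ G.SameClique x y) (fun C h h' => hfull C h h'.1 h'.2)
      (fun C h h' => hm'.exists_insert h h') (hAfin.subset hDA)
      ⟨fun z hz => hAc z (hDA hz), hD⟩ (imagePattern H S f v) hfs (S.toFinite.image f)
    refine ⟨y, huy.color_eq.trans (hfs.trans hvc'.symm), fun t ht h => hyF ⟨t, ht, h⟩,
      fun t ht _ => ?_, fun t ht htv => ?_⟩
    · constructor
      · intro h
        exact SameClique.trans hCH ((hf.sameClique ht hs).1 (SameClique.trans hC h huy.symm)) hsv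
      · intro h
        exact SameClique.trans hC
          ((hf.sameClique ht hs).2 (SameClique.trans hCH h hsv.symm)) huy
    · have htc : H.color t ≠ c := hvc' ▸ htv
      obtain ⟨_, hx', hxx'⟩ := hAD (f t) ⟨t, ⟨ht, color_ne_iff_eq_other.1 htc⟩, rfl⟩
      obtain ⟨r, ⟨hr, hrc⟩, rfl⟩ := hDA hx'
      have h1 := heven (f t) (f r) (by rwa [hf.color t ht]) hxx' (f s) y hfs huy
      have h2 := hevenH t r htc ((hf.sameClique ht hr).1 hxx') s v hsc hsv
      -- evenness in `G` and in `H` transfers the adjacency from the representative `f r` to `f t`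
      have h3 := hy (f r) hx'
      rw [hf.imagePattern_iff hr] at h3
      rw [hf.adj t ht s hs, hf.adj r hr s hs] at h1
      clear * - h1 h2 h3
      tauto
  -- adding `b` makes the set nonempty, also if no vertex of the other color is embedded yet
  · obtain ⟨b, hb⟩ := hb
    obtain ⟨y, hyc, hy, hyS⟩ := heven.exists_pattern_not_sameClique hG hC hc hs' hinf'
      (hAfin.insert b) (by
        rintro x (rfl | hx)
        · exact hb
        · exact hAc x hx) (Set.mem_insert b A) (imagePattern H S f v) (S.toFinite.image f)
    have hyS : ∀ s ∈ S, ¬ G.SameClique (f s) y := fun s hs => hyS _ ⟨s, hs, rfl⟩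
    refine ⟨y, hyc.trans hvc'.symm, fun s hs h => hyS s hs (h ▸ SameClique.refl G _),
      fun s hs _ => iff_of_false (hyS s hs) fun h => hex ⟨s, hs, h⟩, fun s hs hsv => ?_⟩
    have hsc : H.color s = c.other := color_ne_iff_eq_other.1 (hvc' ▸ hsv)
    rw [hy (f s) (Or.inr ⟨s, ⟨hs, hsc⟩, rfl⟩), hf.imagePattern_iff hs]

/-! ### Forbidden subgraphs as conditions on vertices -/

theorem omits_monoK_two_iff {V : Type*} {G : ColoredGraph V} {c : Color} :
    G.Omits (monoK c 2) ↔ G.IsIndep c := by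
  rw [Omits, isRealizedIn_iff]
  constructor
  · intro h u v hu hv huv
    refine h ⟨![u, v], ?_, ?_, ?_⟩
    · intro i _ j _ hij
      fin_cases i <;> fin_cases j <;> simp_all
    · intro i _
      fin_cases i <;> simp [monoK, hu, hv]
    · intro i _ j _
      fin_cases i <;> fin_cases j <;> simp [monoK, huv, huv.symm]
  · rintro h ⟨f, hf⟩
    exact h (f 0) (f 1) (hf.color 0 trivial) (hf.color 1 trivial)
      ((hf.adj 0 trivial 1 trivial).2 (by simp [monoK]))

theorem omits_monoK_three_iff {V : Type*} {G : ColoredGraph V} {c : Color} :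
    G.Omits (monoK c 3) ↔ G.TriFree c := by
  rw [Omits, isRealizedIn_iff]
  constructor
  · intro h u v w hu hv hw huv hvw huw
    refine h ⟨![u, v, w], ?_, ?_, ?_⟩
    · intro i _ j _ hij
      have := huv.ne
      have := hvw.ne
      have := huw.ne
      fin_cases i <;> fin_cases j <;> simp_all
    · intro i _
      fin_cases i <;> simp [monoK, hu, hv, hw]
    · intro i _ j _
      fin_cases i <;> fin_cases j <;> simp [monoK, huv, huv.symm, hvw, hvw.symm, huw, huw.symm]
  · rintro h ⟨f, hf⟩
    exact h (f 0) (f 1) (f 2) (hf.color 0 trivial) (hf.color 1 trivial) (hf.color 2 trivial)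
      ((hf.adj 0 trivial 1 trivial).2 (by simp [monoK]))
      ((hf.adj 1 trivial 2 trivial).2 (by simp [monoK]))
      ((hf.adj 0 trivial 2 trivial).2 (by simp [monoK]))

theorem other_ne (c : Color) : c.other ≠ c := by
  cases c <;> simp [Color.other]

theorem omits_triangle_iff {V : Type*} {G : ColoredGraph V} {c : Color} :
    G.Omits (triangle c) ∧ G.Omits (triangle c).crossCompl ↔ G.ExactlyOne c := by
  have hc := other_ne c
  simp only [Omits, isRealizedIn_iff]
  constructor
  · rintro ⟨h, h'⟩ x y w hx hy hw hxy
    have hwx : w ≠ x := fun e => hw (e ▸ hx)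
    have hwy : w ≠ y := fun e => hw (e ▸ hy)
    have hwc := color_ne_iff_eq_other.1 hw
    have hinj : Set.InjOn ![x, y, w] Set.univ := by
      intro i _ j _ hij
      have := hxy.ne
      fin_cases i <;> fin_cases j <;> simp_all
    constructor
    · intro h1 h2
      refine h ⟨![x, y, w], hinj, ?_, ?_⟩
      · intro i _
        fin_cases i <;> simp [triangle, hx, hy, hwc]
      · intro i _ j _
        fin_cases i <;> fin_cases j <;> simp [triangle, hxy, hxy.symm, h1, h2, h1.symm, h2.symm]
    · intro h2
      by_contra h1
      have h1' : ¬ G.graph.Adj x w := fun e => h1 e.symm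
      have h2' : ¬ G.graph.Adj y w := fun e => h2 e.symm
      refine h' ⟨![x, y, w], hinj, ?_, ?_⟩
      · intro i _
        fin_cases i <;> simp [triangle, crossCompl, hx, hy, hwc]
      · intro i _ j _
        fin_cases i <;> fin_cases j <;>
          simp [triangle, crossCompl, hxy, hxy.symm, h1, h2, h1', h2', hc, hc.symm]
  · intro h
    constructor
    · rintro ⟨f, hf⟩
      have := h (f 0) (f 1) (f 2) (hf.color 0 trivial) (hf.color 1 trivial)
        (by rw [hf.color 2 trivial]; simpa [triangle] using hc)
        ((hf.adj 0 trivial 1 trivial).2 (by simp [triangle]))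
      rw [hf.adj 2 trivial 0 trivial, hf.adj 2 trivial 1 trivial] at this
      simp [triangle] at this
    · rintro ⟨f, hf⟩
      have := h (f 0) (f 1) (f 2) (hf.color 0 trivial) (hf.color 1 trivial)
        (by rw [hf.color 2 trivial]; simpa [triangle, crossCompl] using hc)
        ((hf.adj 0 trivial 1 trivial).2 (by simp [triangle, crossCompl]))
      rw [hf.adj 2 trivial 0 trivial, hf.adj 2 trivial 1 trivial] at this
      simp [triangle, crossCompl, hc] at this

theorem isRealizedIn_diamond {V : Type*} {G : ColoredGraph V} {x y u v : V}
    (hx : G.color x = .red) (hy : G.color y = .red) (hu : G.color u = .blue)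
    (hv : G.color v = .blue) (hxy : G.graph.Adj x y) (huv : G.graph.Adj u v)
    (hxu : ¬ G.graph.Adj x u) (hxv : G.graph.Adj x v) (hyu : G.graph.Adj y u)
    (hyv : G.graph.Adj y v) : diamond.IsRealizedIn G := by
  have hux : ¬ G.graph.Adj u x := fun e => hxu e.symm
  refine isRealizedIn_iff.2 ⟨![x, y, u, v], ?_, ?_, ?_⟩
  · intro i _ j _ hij
    have := hxy.ne
    have := huv.ne
    have := hxv.ne
    have := hyu.ne
    have := hyv.ne
    have : x ≠ u := by
      rintro rfl
      simp [hx] at hu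
    fin_cases i <;> fin_cases j <;> simp_all
  · intro i _
    fin_cases i <;> simp [diamond, hx, hy, hu, hv]
  · intro i _ j _
    fin_cases i <;> fin_cases j <;>
      simp [diamond, hxy, hxy.symm, huv, huv.symm, hxu, hux, hxv, hxv.symm, hyu, hyu.symm, hyv,
        hyv.symm]

theorem isRealizedIn_diamond_crossCompl {V : Type*} {G : ColoredGraph V} {x y u v : V}
    (hx : G.color x = .red) (hy : G.color y = .red) (hu : G.color u = .blue)
    (hv : G.color v = .blue) (hxy : G.graph.Adj x y) (huv : G.graph.Adj u v)
    (hxu : G.graph.Adj x u) (hxv : ¬ G.graph.Adj x v) (hyu : ¬ G.graph.Adj y u)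
    (hyv : ¬ G.graph.Adj y v) : diamond.crossCompl.IsRealizedIn G := by
  have hvx : ¬ G.graph.Adj v x := fun e => hxv e.symm
  have huy : ¬ G.graph.Adj u y := fun e => hyu e.symm
  have hvy : ¬ G.graph.Adj v y := fun e => hyv e.symm
  refine isRealizedIn_iff.2 ⟨![x, y, u, v], ?_, ?_, ?_⟩
  · have hne : ∀ {a b}, G.color a = .red → G.color b = .blue → a ≠ b := by
      rintro a b ha hb rfl
      simp [ha] at hb
    intro i _ j _ hij
    have := hxy.ne
    have := huv.ne
    have := hne hx hu
    have := hne hx hv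
    have := hne hy hu
    have := hne hy hv
    fin_cases i <;> fin_cases j <;> simp_all
  · intro i _
    fin_cases i <;> simp [diamond, crossCompl, hx, hy, hu, hv]
  · intro i _ j _
    fin_cases i <;> fin_cases j <;>
      simp [diamond, crossCompl, hxy, hxy.symm, huv, huv.symm, hxu, hxu.symm, hxv, hvx, hyu, huy,
        hyv, hvy]

/-- The cross edges between two adjacent red and two adjacent blue vertices form `D` or its cross
complement exactly if their number is odd. -/
theorem omits_diamond_iff {V : Type*} {G : ColoredGraph V} :
    G.Omits diamond ∧ G.Omits diamond.crossCompl ↔ G.Even .red := by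
  constructor
  · rintro ⟨h, h'⟩ u v hu huv x y hx hxy
    by_cases huv' : u = v
    · simp [huv']
    by_cases hxy' : x = y
    · simp [hxy']
    have hu : G.color u = .blue := color_ne_iff_eq_other.1 hu
    have hv : G.color v = .blue := huv.color_eq.trans hu
    have hy : G.color y = .red := hxy.color_eq.trans hx
    have e := huv.adj huv'
    have e' := hxy.adj hxy'
    rw [G.graph.adj_comm u x, G.graph.adj_comm v x, G.graph.adj_comm u y, G.graph.adj_comm v y]
    have d1 : ¬ (¬ G.graph.Adj x u ∧ G.graph.Adj x v ∧ G.graph.Adj y u ∧ G.graph.Adj y v) :=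
      fun k => h (isRealizedIn_diamond hx hy hu hv e' e k.1 k.2.1 k.2.2.1 k.2.2.2)
    have d2 : ¬ (¬ G.graph.Adj x v ∧ G.graph.Adj x u ∧ G.graph.Adj y v ∧ G.graph.Adj y u) :=
      fun k => h (isRealizedIn_diamond hx hy hv hu e' e.symm k.1 k.2.1 k.2.2.1 k.2.2.2)
    have d3 : ¬ (¬ G.graph.Adj y u ∧ G.graph.Adj y v ∧ G.graph.Adj x u ∧ G.graph.Adj x v) :=
      fun k => h (isRealizedIn_diamond hy hx hu hv e'.symm e k.1 k.2.1 k.2.2.1 k.2.2.2)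
    have d4 : ¬ (¬ G.graph.Adj y v ∧ G.graph.Adj y u ∧ G.graph.Adj x v ∧ G.graph.Adj x u) :=
      fun k => h (isRealizedIn_diamond hy hx hv hu e'.symm e.symm k.1 k.2.1 k.2.2.1 k.2.2.2)
    have d5 : ¬ (G.graph.Adj x u ∧ ¬ G.graph.Adj x v ∧ ¬ G.graph.Adj y u ∧ ¬ G.graph.Adj y v) :=
      fun k => h' (isRealizedIn_diamond_crossCompl hx hy hu hv e' e k.1 k.2.1 k.2.2.1 k.2.2.2)
    have d6 : ¬ (G.graph.Adj x v ∧ ¬ G.graph.Adj x u ∧ ¬ G.graph.Adj y v ∧ ¬ G.graph.Adj y u) :=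
      fun k => h' (isRealizedIn_diamond_crossCompl hx hy hv hu e' e.symm k.1 k.2.1 k.2.2.1 k.2.2.2)
    have d7 : ¬ (G.graph.Adj y u ∧ ¬ G.graph.Adj y v ∧ ¬ G.graph.Adj x u ∧ ¬ G.graph.Adj x v) :=
      fun k => h' (isRealizedIn_diamond_crossCompl hy hx hu hv e'.symm e k.1 k.2.1 k.2.2.1 k.2.2.2)
    have d8 : ¬ (G.graph.Adj y v ∧ ¬ G.graph.Adj y u ∧ ¬ G.graph.Adj x v ∧ ¬ G.graph.Adj x u) :=
      fun k => h' (isRealizedIn_diamond_crossCompl hy hx hv hu e'.symm e.symm k.1 k.2.1 k.2.2.1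
        k.2.2.2)
    clear * - d1 d2 d3 d4 d5 d6 d7 d8
    by_cases x1 : G.graph.Adj x u <;> by_cases x2 : G.graph.Adj x v <;>
      by_cases x3 : G.graph.Adj y u <;> by_cases x4 : G.graph.Adj y v <;> simp_all
  · intro h
    have key : ∀ f : Fin 4 → V, G.color (f 0) = .red → G.color (f 1) = .red →
        G.color (f 2) = .blue → G.color (f 3) = .blue → G.graph.Adj (f 0) (f 1) →
        G.graph.Adj (f 2) (f 3) → ((G.graph.Adj (f 2) (f 0) ↔ G.graph.Adj (f 3) (f 0)) ↔
          (G.graph.Adj (f 2) (f 1) ↔ G.graph.Adj (f 3) (f 1))) := by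
      intro f h0 h1 h2 h3 h01 h23
      exact h (f 2) (f 3) (by simp [h2]) ⟨h2.trans h3.symm, Or.inr h23⟩ (f 0) (f 1) h0
        ⟨h0.trans h1.symm, Or.inr h01⟩
    constructor
    · intro hr
      obtain ⟨f, hf⟩ := isRealizedIn_iff.1 hr
      have := key f (hf.color 0 trivial) (hf.color 1 trivial) (hf.color 2 trivial)
        (hf.color 3 trivial) ((hf.adj 0 trivial 1 trivial).2 (by simp [diamond]))
        ((hf.adj 2 trivial 3 trivial).2 (by simp [diamond]))
      rw [hf.adj 2 trivial 0 trivial, hf.adj 3 trivial 0 trivial, hf.adj 2 trivial 1 trivial,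
        hf.adj 3 trivial 1 trivial] at this
      simp [diamond] at this
    · intro hr
      obtain ⟨f, hf⟩ := isRealizedIn_iff.1 hr
      have := key f (hf.color 0 trivial) (hf.color 1 trivial) (hf.color 2 trivial)
        (hf.color 3 trivial) ((hf.adj 0 trivial 1 trivial).2 (by simp [diamond, crossCompl]))
        ((hf.adj 2 trivial 3 trivial).2 (by simp [diamond, crossCompl]))
      rw [hf.adj 2 trivial 0 trivial, hf.adj 3 trivial 0 trivial, hf.adj 2 trivial 1 trivial,
        hf.adj 3 trivial 1 trivial] at this
      simp [diamond, crossCompl] at this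

theorem encard_maxCliques_le_one_iff {V : Type*} {G : ColoredGraph V} (hC : G.CliqueClasses)
    {c : Color} : (G.maxCliques c).encard ≤ 1 ↔ G.IsSingleClique c := by
  rw [Set.encard_le_one_iff]
  constructor
  · intro h u v hu hv hne
    have := h _ _ ((mem_maxCliques_iff hC).2 ⟨u, hu, rfl⟩) ((mem_maxCliques_iff hC).2 ⟨v, hv, rfl⟩)
    exact ((cliqueOf_eq_iff hC).1 this).adj hne
  · intro h M N hM hN
    obtain ⟨u, hu, rfl⟩ := (mem_maxCliques_iff hC).1 hM
    obtain ⟨v, hv, rfl⟩ := (mem_maxCliques_iff hC).1 hN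
    rw [cliqueOf_eq_iff hC]
    exact ⟨hu.trans hv.symm, or_iff_not_imp_left.2 (h u v hu hv)⟩

theorem one_le_encard_maxCliques {V : Type*} {G : ColoredGraph V} (hC : G.CliqueClasses)
    {c : Color} (h : ∃ u, G.color u = c) : 1 ≤ (G.maxCliques c).encard := by
  obtain ⟨u, hu⟩ := h
  rw [Set.one_le_encard_iff_nonempty]
  exact ⟨_, (mem_maxCliques_iff hC).2 ⟨u, hu, rfl⟩⟩

/-! ### The classification -/

/-- The properties of `G` used in the classification. They are preserved by interchanging the
colors. -/
structure IsAdmissible {V : Type*} (G : ColoredGraph V) : Prop where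
  uh : G.IsUltrahomogeneous
  cliques : G.CliqueClasses
  splits : ∀ c, ¬ G.IsIndep c → G.Splits c ∧ ∃ b, G.color b ≠ c

theorem other_other (c : Color) : c.other.other = c := by
  cases c <;> rfl

theorem swap_color_eq_iff {V : Type*} {G : ColoredGraph V} {u : V} {c : Color} :
    G.swap.color u = c ↔ G.color u = c.other := by
  cases h : G.color u <;> cases c <;> simp [swap, h, Color.other]

theorem swap_color_eq_color_iff {V : Type*} {G : ColoredGraph V} {u v : V} :
    G.swap.color u = G.swap.color v ↔ G.color u = G.color v := by
  rw [swap_color_eq_iff, swap, other_other]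

theorem sameClique_swap_iff {V : Type*} {G : ColoredGraph V} {u v : V} :
    G.swap.SameClique u v ↔ G.SameClique u v := by
  rw [SameClique, SameClique, swap_color_eq_color_iff]
  rfl

theorem isAut_swap_iff {V : Type*} {G : ColoredGraph V} {ψ : V ≃ V} :
    G.swap.IsAut ψ ↔ G.IsAut ψ := by
  simp only [IsAut, swap_color_eq_color_iff]
  rfl

theorem isEmbOn_swap_iff {V : Type*} {G : ColoredGraph V} {S : Set V} {f : V → V} :
    IsEmbOn G.swap G.swap S f ↔ IsEmbOn G G S f :=
  ⟨fun h => ⟨h.inj, fun w hw => swap_color_eq_color_iff.1 (h.color w hw), h.adj⟩,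
    fun h => ⟨h.inj, fun w hw => swap_color_eq_color_iff.2 (h.color w hw), h.adj⟩⟩

theorem isUltrahomogeneous_swap_iff {V : Type*} {G : ColoredGraph V} :
    G.swap.IsUltrahomogeneous ↔ G.IsUltrahomogeneous := by
  simp only [isUltrahomogeneous_iff, isAut_swap_iff, isEmbOn_swap_iff]

theorem isIndep_swap_iff {V : Type*} {G : ColoredGraph V} {c : Color} :
    G.swap.IsIndep c ↔ G.IsIndep c.other := by
  simp only [IsIndep, swap_color_eq_iff]
  rfl

theorem isSingleClique_swap_iff {V : Type*} {G : ColoredGraph V} {c : Color} :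
    G.swap.IsSingleClique c ↔ G.IsSingleClique c.other := by
  simp only [IsSingleClique, swap_color_eq_iff]
  rfl

theorem triFree_swap_iff {V : Type*} {G : ColoredGraph V} {c : Color} :
    G.swap.TriFree c ↔ G.TriFree c.other := by
  simp only [TriFree, swap_color_eq_iff]
  rfl

theorem IsAdmissible.swap {V : Type*} {G : ColoredGraph V} (h : G.IsAdmissible) :
    G.swap.IsAdmissible := by
  refine ⟨isUltrahomogeneous_swap_iff.2 h.uh, fun c => ?_, fun c hc => ?_⟩
  · have := h.cliques c.other
    simp only [IsCliqueUnion, swap_color_eq_iff] at this ⊢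
    exact this
  · have := h.splits c.other (by rwa [← isIndep_swap_iff])
    simp only [Splits, sameClique_swap_iff, swap_color_eq_iff, ne_eq] at this ⊢
    exact this

theorem isIndep_triFree {V : Type*} {G : ColoredGraph V} {c : Color} (h : G.IsIndep c) :
    G.TriFree c :=
  fun x y _ hx hy _ hxy _ _ => h x y hx hy hxy

/-- Infinitely many patterns over color `c` are realized, so there are infinitely many vertices
of the other color. -/
theorem Splits.infinite_other {V : Type*} {G : ColoredGraph V} (hG : G.IsUltrahomogeneous)
    (hC : G.CliqueClasses) {c : Color} (hs : G.Splits c) (hb : ∃ b, G.color b ≠ c)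
    (hc : ∃ u, G.color u = c) (h : G.SplitsInf c ∨ G.ManyCliques c) :
    (G.colorClass c.other).Infinite := by
  intro hfin
  obtain ⟨b, hbF, hb', -⟩ := hs.exists_pattern_notMem hG hC hb hc (A := ∅) Set.finite_empty
    (by simp) (X := fun _ => True) (h.imp_right fun h => ⟨h, by simp [SeparatesAdj]⟩) hfin
  exact hbF (color_ne_iff_eq_other.1 hb')

/-- If the other color class is independent or a clique, a finite color class is impossible: two
vertices of the infinite other class had the same neighbors, hence any two of them. -/
theorem Splits.infinite_of_indep_or_clique {V : Type*} [Infinite V] {G : ColoredGraph V}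
    (hG : G.IsUltrahomogeneous) {c : Color} (hs : G.Splits c)
    (hb : ∃ b, G.color b ≠ c) (hc : ∃ u, G.color u = c)
    (hd : G.IsIndep c.other ∨ G.IsSingleClique c.other) : (G.colorClass c).Infinite := by
  intro hfin
  have hinf : (G.colorClass c.other).Infinite := by
    intro hfin'
    refine Set.infinite_univ (α := V) ((hfin.union hfin').subset fun v _ => ?_)
    by_cases h : G.color v = c
    · exact Or.inl h
    · exact Or.inr (color_ne_iff_eq_other.1 h)
  obtain ⟨b₁, hb₁, b₂, hb₂, hne, heq⟩ := hinf.exists_ne_map_eq_of_mapsTo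
    (f := fun b => {u | G.color u = c ∧ G.graph.Adj u b}) (t := 𝒫 G.colorClass c)
    (fun b _ u hu => hu.1) hfin.powerset
  have hsame : ∀ u, G.color u = c → (G.graph.Adj u b₁ ↔ G.graph.Adj u b₂) := by
    intro u hu
    have := Set.ext_iff.1 heq u
    simpa [hu] using this
  obtain ⟨b, hb⟩ := hb
  obtain ⟨u, hu⟩ := hc
  obtain ⟨⟨v, huv, hv⟩, w, huw, hw⟩ := hs b u hb hu
  -- `b` and a conjugate of `b` differ at `v`
  obtain ⟨ψ, hψ, hψv⟩ := hG.exists_aut_apply (x := w) (y := v) (by rw [huv.color_eq, huw.color_eq])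
  have hψb : ¬ G.graph.Adj v (ψ b) := by
    rwa [← hψv, hψ.1, G.graph.adj_comm]
  have hne' : b ≠ ψ b := by
    intro h
    exact hψb (h ▸ hv.symm)
  have hbd := color_ne_iff_eq_other.1 hb
  have hbd' : G.color (ψ b) = c.other := (hψ.2 b).trans hbd
  obtain ⟨θ, hθ, hθ₁, hθ₂⟩ := hG.exists_aut_pair (hb₁.trans hbd.symm) (hb₂.trans hbd'.symm) hne
    hne' (by
      rcases hd with h | h
      · exact iff_of_false (h _ _ hb₁ hb₂) (h _ _ hbd hbd')
      · exact iff_of_true (h _ _ hb₁ hb₂ hne) (h _ _ hbd hbd' hne'))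
  have := hsame (θ.symm v) (by rw [hθ.symm.2, huv.color_eq, hu])
  rw [← hθ.1 _ b₁, ← hθ.1 _ b₂, θ.apply_symm_apply, hθ₁, hθ₂] at this
  exact hψb (this.1 hv.symm)

theorem IsAdmissible.splitsInf_or {V : Type*} [Infinite V] {G : ColoredGraph V}
    (h : G.IsAdmissible) {c : Color} (h1 : ¬ G.IsIndep c) (h2 : ¬ G.IsSingleClique c)
    (hd : G.IsIndep c.other ∨ G.IsSingleClique c.other) :
    G.SplitsInf c ∧ ¬ G.TriFree c ∨ G.TriFree c ∧ G.ManyCliques c ∧ G.ExactlyOne c := by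
  obtain ⟨hs, hb⟩ := h.splits c h1
  by_cases ht : G.TriFree c
  · have hc : ∃ u, G.color u = c := by
      simp only [IsIndep, not_forall] at h1
      obtain ⟨u, -, hu, -⟩ := h1
      exact ⟨u, hu⟩
    exact Or.inr ⟨ht, ht.manyCliques h.cliques (hs.infinite_of_indep_or_clique h.uh hb hc hd),
      fun x y w hx hy hw hxy => hs.adj_iff_not_adj ht h.cliques hx hy hw hxy⟩
  · exact Or.inl ⟨hs.splitsInf h.uh h.cliques h2 ht, ht⟩

theorem exists_color_eq_of_not_isIndep {V : Type*} {G : ColoredGraph V} {c : Color}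
    (h : ¬ G.IsIndep c) : ∃ u, G.color u = c := by
  simp only [IsIndep, not_forall] at h
  obtain ⟨u, -, hu, -⟩ := h
  exact ⟨u, hu⟩

/-- If blue is independent and red is neither independent nor a clique, the graph is `F_{2,1}`,
`F_{ℵ₀,1}` or `F^k_{ℵ₀,1}`. -/
theorem IsAdmissible.inListTwo_of_isIndep {V : Type*} [Countable V] [Infinite V]
    {G : ColoredGraph V} (h : G.IsAdmissible) (h1 : ¬ G.IsIndep .red)
    (h2 : ¬ G.IsSingleClique .red) (hd : G.IsIndep .blue) : G.InListTwo := by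
  obtain ⟨hs, hb⟩ := h.splits _ h1
  have hc := exists_color_eq_of_not_isIndep h1
  have hreal : ∀ (W : Type) [Finite W] (H : ColoredGraph W), H.CliqueClasses → H.IsIndep .blue →
      (H.maxCliques .red).encard ≤ (G.maxCliques .red).encard →
      (G.SplitsInf .red ∨ G.ManyCliques .red ∧ H.TriFree .red ∧ H.ExactlyOne .red) →
      H.IsRealizedIn G := fun W _ H hCH hH hcard hcase =>
    isRealizedIn_of_indep_or_clique h.uh h.cliques hCH hs hb hc hcard hcase (Or.inl ⟨hd, hH⟩)
  rcases h.splitsInf_or h1 h2 (Or.inl hd) with ⟨hinf, -⟩ | ⟨ht, hm, hone⟩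
  · by_cases htop : (G.maxCliques .red).encard = ⊤
    · refine Or.inr (Or.inr (Or.inr (Or.inl ⟨inferInstance, h.uh, fun W _ H => ⟨fun hH => ?_, ?_⟩⟩)))
      · exact ⟨h.cliques.of_isRealizedIn hH, (omits_monoK_two_iff.2 hd).of_isRealizedIn hH⟩
      · rintro ⟨hCH, hH⟩
        exact hreal W H hCH (omits_monoK_two_iff.1 hH) (htop ▸ le_top) (Or.inl hinf)
    · obtain ⟨k, hk⟩ := ENat.ne_top_iff_exists.1 htop
      refine Or.inl ⟨k, ?_, inferInstance, h.uh, fun W _ H => ⟨fun hH => ?_, ?_⟩⟩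
      · have := (encard_maxCliques_le_one_iff h.cliques).not.2 h2
        rw [← hk, not_le] at this
        have h' : 1 < k := by exact_mod_cast this
        omega
      · exact ⟨h.cliques.of_isRealizedIn hH,
          ((omits_monoCoK_iff h.cliques).2 hk.ge).of_isRealizedIn hH,
          (omits_monoK_two_iff.2 hd).of_isRealizedIn hH⟩
      · rintro ⟨hCH, hH', hH⟩
        exact hreal W H hCH (omits_monoK_two_iff.1 hH)
          (((omits_monoCoK_iff hCH).1 hH').trans hk.le) (Or.inl hinf)
  · refine Or.inr (Or.inr (Or.inl ⟨inferInstance, h.uh, fun W _ H => ⟨fun hH => ?_, ?_⟩⟩))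
    · exact ⟨h.cliques.of_isRealizedIn hH, (omits_monoK_three_iff.2 ht).of_isRealizedIn hH,
        (omits_monoK_two_iff.2 hd).of_isRealizedIn hH,
        (omits_triangle_iff.2 hone).1.of_isRealizedIn hH,
        (omits_triangle_iff.2 hone).2.of_isRealizedIn hH⟩
    · rintro ⟨hCH, hH, hH', hH''⟩
      exact hreal W H hCH (omits_monoK_two_iff.1 hH') (hm.encard_maxCliques h.cliques ▸ le_top)
        (Or.inr ⟨hm, omits_monoK_three_iff.1 hH, omits_triangle_iff.1 hH''⟩)

/-- If red is a single clique and the blue cliques have two vertices, the graph is `F^1_{ℵ₀,2}`. -/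
theorem IsAdmissible.isFraisseLimit_of_isSingleClique {V : Type*} [Countable V]
    {G : ColoredGraph V} (h : G.IsAdmissible) (h1 : ¬ G.IsIndep .blue)
    (hd : G.IsSingleClique .red) (ht : G.TriFree .blue) (hm : G.ManyCliques .blue)
    (hone : G.ExactlyOne .blue) : IsFraisseLimit (ClassFinf2fin 1) G := by
  obtain ⟨hs, hb⟩ := h.splits _ h1
  have hc := exists_color_eq_of_not_isIndep h1
  have hone' : ∀ {U : Type _} {F : ColoredGraph U}, F.CliqueClasses →
      (F.Omits (monoCoK .red (1 + 1)) ↔ F.IsSingleClique .red) := fun hF => by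
    rw [omits_monoCoK_iff hF, ← encard_maxCliques_le_one_iff hF, Nat.cast_one]
  refine ⟨inferInstance, h.uh, fun W _ H => ⟨fun hH => ?_, ?_⟩⟩
  · exact ⟨h.cliques.of_isRealizedIn hH, ((omits_monoCoK_iff h.cliques).2 (by
        rw [Nat.cast_one, encard_maxCliques_le_one_iff h.cliques]
        exact hd)).of_isRealizedIn hH,
      (omits_monoK_three_iff.2 ht).of_isRealizedIn hH,
      (omits_triangle_iff.2 hone).1.of_isRealizedIn hH,
      (omits_triangle_iff.2 hone).2.of_isRealizedIn hH⟩
  · rintro ⟨hCH, hH, hH', hH''⟩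
    refine isRealizedIn_of_indep_or_clique h.uh h.cliques hCH hs hb hc
      (hm.encard_maxCliques h.cliques ▸ le_top)
      (Or.inr ⟨hm, omits_monoK_three_iff.1 hH', omits_triangle_iff.1 hH''⟩) (Or.inr ⟨hd, ?_⟩)
    exact (hone' hCH).1 hH

/-- The limit of `ClassG r b` is recognized by realizing all graphs with at most as many
cliques as `G`. -/
theorem IsAdmissible.inListOne_of_isRealizedIn {V : Type*} [Countable V]
    {G : ColoredGraph V} (h : G.IsAdmissible) (hc : ∀ c, ∃ u, G.color u = c)
    (hreal : ∀ (W : Type) [Finite W] (H : ColoredGraph W), H.CliqueClasses →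
      (∀ c, (H.maxCliques c).encard ≤ (G.maxCliques c).encard) → H.IsRealizedIn G) :
    G.InListOne := by
  refine Or.inr (Or.inl ⟨_, _, one_le_encard_maxCliques h.cliques (hc .red),
    one_le_encard_maxCliques h.cliques (hc .blue), inferInstance, h.uh,
    fun W _ H => ⟨fun hH => ?_, fun hH => ?_⟩⟩)
  · exact ⟨h.cliques.of_isRealizedIn hH, encard_maxCliques_le h.cliques hH _,
      encard_maxCliques_le h.cliques hH _⟩
  · refine hreal W H hH.1 ?_
    rintro (_ | _)
    · exact hH.2.1
    · exact hH.2.2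

/-- If the cliques of both colors have two vertices, the graph is `F_{2,2}`. -/
theorem IsAdmissible.inListOne_of_triFree {V : Type*} [Countable V] [Infinite V]
    {G : ColoredGraph V} (h : G.IsAdmissible) (h1 : ∀ c, ¬ G.IsIndep c)
    (ht : ∀ c, G.TriFree c) : G.InListOne := by
  have hs := fun c => (h.splits c (h1 c)).1
  have hb := fun c => (h.splits c (h1 c)).2
  have hc := fun c => exists_color_eq_of_not_isIndep (h1 c)
  have hstep : ∀ c, (G.colorClass c).Infinite → (G.colorClass c.other).Infinite :=
    fun c hinf => (hs c).infinite_other h.uh h.cliques (hb c) (hc c)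
      (Or.inr ((ht c).manyCliques h.cliques hinf))
  have hinf : ∀ c, (G.colorClass c).Infinite := by
    intro c
    by_contra hfin
    rw [Set.not_infinite] at hfin
    have hfin' : (G.colorClass c.other).Finite := by
      by_contra h'
      have := hstep _ h'
      rw [other_other] at this
      exact this hfin
    refine Set.infinite_univ (α := V) ((hfin.union hfin').subset fun v _ => ?_)
    by_cases h : G.color v = c
    · exact Or.inl h
    · exact Or.inr (color_ne_iff_eq_other.1 h)
  have hm := fun c => (ht c).manyCliques h.cliques (hinf c)
  have hone : ∀ c, G.ExactlyOne c := fun c x y w hx hy hw hxy =>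
    (hs c).adj_iff_not_adj (ht c) h.cliques hx hy hw hxy
  refine Or.inr (Or.inr ⟨inferInstance, h.uh, fun W _ H => ⟨fun hH => ?_, ?_⟩⟩)
  · exact ⟨h.cliques.of_isRealizedIn hH, fun c =>
      ⟨(omits_monoK_three_iff.2 (ht c)).of_isRealizedIn hH,
        (omits_triangle_iff.2 (hone c)).1.of_isRealizedIn hH,
        (omits_triangle_iff.2 (hone c)).2.of_isRealizedIn hH⟩⟩
  · rintro ⟨hCH, hH⟩
    exact isRealizedIn_of_triFree (c := .red) h.uh h.cliques hCH (hs _) (hs _) (hb _) (hc _) (hm _)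
      (hm _) (ht _) (fun c => omits_monoK_three_iff.1 (hH c).1)
      fun c => omits_triangle_iff.1 (hH c).2

/-- If red cliques are infinite and blue cliques have two vertices, the graph is `F_{ℵ₀,2}` or
`F^k_{ℵ₀,2}`. -/
theorem IsAdmissible.inListTwo_of_triFree_blue {V : Type*} [Countable V]
    {G : ColoredGraph V} (h : G.IsAdmissible) (h1 : ∀ c, ¬ G.IsIndep c)
    (h2 : ∀ c, ¬ G.IsSingleClique c) (hr : ¬ G.TriFree .red) (ht : G.TriFree .blue) :
    G.InListTwo := by
  have hs := fun c => (h.splits c (h1 c)).1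
  have hb := fun c => (h.splits c (h1 c)).2
  have hc := fun c => exists_color_eq_of_not_isIndep (h1 c)
  have hinf : G.SplitsInf .red := (hs _).splitsInf h.uh h.cliques (h2 _) hr
  have hm : G.ManyCliques .blue := ht.manyCliques h.cliques
    ((hs .red).infinite_other h.uh h.cliques (hb _) (hc _) (Or.inl hinf))
  have hone : G.ExactlyOne .blue := fun x y w hx hy hw hxy =>
    (hs _).adj_iff_not_adj ht h.cliques hx hy hw hxy
  have hreal : ∀ (W : Type) [Finite W] (H : ColoredGraph W), H.CliqueClasses →
      (H.maxCliques .red).encard ≤ (G.maxCliques .red).encard →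
      H.TriFree .blue → H.ExactlyOne .blue → H.IsRealizedIn G := fun W _ H hCH hcard htH hH =>
    isRealizedIn_of_infinite_of_triFree (c := .red) h.cliques hCH hcard (hc _) (hs _) ht hm htH hH
      fun C hfin hcol hpw => fullOver_of_pairwise_not_sameClique h.uh h.cliques (hs _) hinf (hc _)
        (hs _) (h2 _) hm hfin hcol hpw
  by_cases htop : (G.maxCliques .red).encard = ⊤
  · refine Or.inr (Or.inr (Or.inr (Or.inr (Or.inl ⟨inferInstance, h.uh,
      fun W _ H => ⟨fun hH => ?_, ?_⟩⟩))))
    · exact ⟨h.cliques.of_isRealizedIn hH, (omits_monoK_three_iff.2 ht).of_isRealizedIn hH,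
        (omits_triangle_iff.2 hone).1.of_isRealizedIn hH,
        (omits_triangle_iff.2 hone).2.of_isRealizedIn hH⟩
    · rintro ⟨hCH, hH, hH'⟩
      exact hreal W H hCH (htop ▸ le_top) (omits_monoK_three_iff.1 hH) (omits_triangle_iff.1 hH')
  · obtain ⟨k, hk⟩ := ENat.ne_top_iff_exists.1 htop
    refine Or.inr (Or.inl ⟨k, ?_, inferInstance, h.uh, fun W _ H => ⟨fun hH => ?_, ?_⟩⟩)
    · have := one_le_encard_maxCliques h.cliques (hc .red)
      rw [← hk] at this
      exact_mod_cast this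
    · exact ⟨h.cliques.of_isRealizedIn hH,
        ((omits_monoCoK_iff h.cliques).2 hk.ge).of_isRealizedIn hH,
        (omits_monoK_three_iff.2 ht).of_isRealizedIn hH,
        (omits_triangle_iff.2 hone).1.of_isRealizedIn hH,
        (omits_triangle_iff.2 hone).2.of_isRealizedIn hH⟩
    · rintro ⟨hCH, hH'', hH, hH'⟩
      exact hreal W H hCH (((omits_monoCoK_iff hCH).1 hH'').trans hk.le)
        (omits_monoK_three_iff.1 hH) (omits_triangle_iff.1 hH')

/-- If all cliques are infinite, the graph is `F_{ℵ₀,ℵ₀}` in the even case, and else `G_{r,b}`. -/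
theorem IsAdmissible.inListOne_or_inListTwo_of_infinite {V : Type*} [Countable V]
    {G : ColoredGraph V} (h : G.IsAdmissible) (h1 : ∀ c, ¬ G.IsIndep c)
    (h2 : ∀ c, ¬ G.IsSingleClique c) (ht : ∀ c, ¬ G.TriFree c) :
    G.InListOne ∨ G.InListTwo := by
  have hs := fun c => (h.splits c (h1 c)).1
  have hb := fun c => (h.splits c (h1 c)).2
  have hc := fun c => exists_color_eq_of_not_isIndep (h1 c)
  have hinf : ∀ c, G.SplitsInf c := fun c => (hs c).splitsInf h.uh h.cliques (h2 c) (ht c)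
  by_cases heven : G.Even .red
  · right
    have hm : G.ManyCliques .blue :=
      heven.other.manyCliques h.uh h.cliques (hc _) (hb _) (hs _) (hinf _)
    refine Or.inr (Or.inr (Or.inr (Or.inr (Or.inr ⟨inferInstance, h.uh,
      fun W _ H => ⟨fun hH => ?_, ?_⟩⟩))))
    · exact ⟨h.cliques.of_isRealizedIn hH, (omits_diamond_iff.2 heven).1.of_isRealizedIn hH,
        (omits_diamond_iff.2 heven).2.of_isRealizedIn hH⟩
    · rintro ⟨hCH, hH⟩
      exact isRealizedIn_of_even (c := .red) h.uh h.cliques hCH (hc _) (hb _) (hs _) (hinf _) hm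
        heven (omits_diamond_iff.1 hH) fun C hfin hcol hpw =>
          fullOver_of_pairwise_not_sameClique (c := .red) h.uh h.cliques (hs _) (hinf _) (hc _)
            (hs _) (h2 _) hm hfin hcol hpw
  · left
    exact h.inListOne_of_isRealizedIn hc fun W _ H hCH hcard =>
      isRealizedIn_of_fullOver (c := .red) h.cliques hCH hcard (hc _) (hb _) (hinf _)
        fun C hfin hcol => fullOver_of_not_even h.uh h.cliques (hs _) (hc _) (hs _) (hinf _) heven
          hfin hcol

theorem swap_swap {V : Type*} (G : ColoredGraph V) : G.swap.swap = G := by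
  simp [swap, other_other]

/-- The classification when the red class is neither independent nor a clique. -/
theorem IsAdmissible.upToSwap_of_red {V : Type*} [Countable V] [Infinite V]
    {G : ColoredGraph V} (h : G.IsAdmissible) (h1 : ¬ G.IsIndep .red)
    (h2 : ¬ G.IsSingleClique .red) : UpToSwap InListOne G ∨ UpToSwap InListTwo G := by
  by_cases hi : G.IsIndep .blue
  · exact Or.inr (Or.inl (h.inListTwo_of_isIndep h1 h2 hi))
  have h1' : ∀ c, ¬ G.IsIndep c := by
    rintro (_ | _)
    · exact h1
    · exact hi
  by_cases hd : G.IsSingleClique .blue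
  · by_cases ht : G.TriFree .red
    · have hsw := h.swap
      have i1 : ¬ G.swap.IsIndep .blue := isIndep_swap_iff.not.2 h1
      have i3 : G.swap.IsSingleClique .red := isSingleClique_swap_iff.2 hd
      rcases hsw.splitsInf_or i1 (isSingleClique_swap_iff.not.2 h2) (Or.inr i3) with
        ⟨-, ht'⟩ | ⟨ht', hm, hone⟩
      · exact absurd (triFree_swap_iff.2 ht) ht'
      · exact Or.inr (Or.inr (Or.inr (Or.inl ⟨1, le_rfl,
          hsw.isFraisseLimit_of_isSingleClique i1 i3 ht' hm hone⟩)))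
    · obtain ⟨hs, hb⟩ := h.splits _ h1
      have hc := fun c => exists_color_eq_of_not_isIndep (h1' c)
      refine Or.inl (Or.inl (h.inListOne_of_isRealizedIn hc fun W _ H hCH hcard => ?_))
      refine isRealizedIn_of_indep_or_clique h.uh h.cliques hCH hs hb (hc _) (hcard _)
        (Or.inl (hs.splitsInf h.uh h.cliques h2 ht)) (Or.inr ⟨hd, ?_⟩)
      exact (encard_maxCliques_le_one_iff hCH).1
        ((hcard .blue).trans ((encard_maxCliques_le_one_iff h.cliques).2 hd))
  have h2' : ∀ c, ¬ G.IsSingleClique c := by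
    rintro (_ | _)
    · exact h2
    · exact hd
  by_cases ht : G.TriFree .red <;> by_cases ht' : G.TriFree .blue
  · exact Or.inl (Or.inl (h.inListOne_of_triFree h1' (by rintro (_ | _) <;> assumption)))
  · exact Or.inr (Or.inr (h.swap.inListTwo_of_triFree_blue
      (fun c => isIndep_swap_iff.not.2 (h1' _)) (fun c => isSingleClique_swap_iff.not.2 (h2' _))
      (triFree_swap_iff.not.2 ht') (triFree_swap_iff.2 ht)))
  · exact Or.inr (Or.inl (h.inListTwo_of_triFree_blue h1' h2' ht ht'))
  · exact (h.inListOne_or_inListTwo_of_infinite h1' h2' (by rintro (_ | _) <;> assumption)).imp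
      Or.inl Or.inl

theorem IsAdmissible.upToSwap {V : Type*} [Countable V] [Infinite V]
    {G : ColoredGraph V} (h : G.IsAdmissible) : UpToSwap InListOne G ∨ UpToSwap InListTwo G := by
  by_cases hall : ∀ c, G.IsIndep c ∨ G.IsSingleClique c
  · exact Or.inl (Or.inl (Or.inl hall))
  push Not at hall
  obtain ⟨c, h1, h2⟩ := hall
  cases c with
  | red => exact h.upToSwap_of_red h1 h2
  | blue =>
    have := h.swap.upToSwap_of_red (isIndep_swap_iff.not.2 h1) (isSingleClique_swap_iff.not.2 h2)
    rw [UpToSwap, UpToSwap, swap_swap] at this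
    exact this.imp Or.symm Or.symm

/-! ### Piecewise ultrahomogeneity -/

theorem isPiecewiseUltrahomogeneous_iff {V : Type*} {G : ColoredGraph V} (hC : G.CliqueClasses) :
    G.IsPiecewiseUltrahomogeneous ↔ ∀ m n, G.color m ≠ G.color n →
      (G.induce (G.cliqueOf m ∪ G.cliqueOf n)).IsUltrahomogeneous := by
  simp only [IsPiecewiseUltrahomogeneous, mem_maxCliques_iff hC]
  constructor
  · intro h m n hmn
    cases hm : G.color m with
    | red => exact h _ ⟨m, hm, rfl⟩ _ ⟨n, color_ne_iff_eq_other.1 (hm ▸ hmn.symm), rfl⟩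
    | blue =>
      rw [Set.union_comm]
      exact h _ ⟨n, color_ne_iff_eq_other.1 (hm ▸ hmn.symm), rfl⟩ _ ⟨m, hm, rfl⟩
  · rintro h _ ⟨m, hm, rfl⟩ _ ⟨n, hn, rfl⟩
    exact h m n (by simp [hm, hn])

theorem mem_right_of_color {V : Type*} {G : ColoredGraph V} {m n x : V}
    (hmn : G.color m ≠ G.color n) (hx : x ∈ G.cliqueOf m ∪ G.cliqueOf n)
    (hxn : G.color x = G.color n) : G.SameClique n x :=
  hx.resolve_left fun h => hmn (SameClique.color_eq h ▸ hxn)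

/-- If a vertex forming a clique by itself splits a clique of the other color, then these two
cliques induce a graph that is not ultrahomogeneous. -/
theorem not_isPiecewiseUltrahomogeneous_of_isIndep {V : Type*} {G : ColoredGraph V}
    (hC : G.CliqueClasses) {m m' b : V} (hmm' : G.SameClique m m') (hb : G.color m ≠ G.color b)
    (hi : G.IsIndep (G.color b)) (hbm : G.graph.Adj b m) (hbm' : ¬ G.graph.Adj b m') :
    ¬ G.IsPiecewiseUltrahomogeneous := by
  intro h
  have huh := (isPiecewiseUltrahomogeneous_iff hC).1 h m b hb
  set P := G.cliqueOf m ∪ G.cliqueOf b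
  have hbP : b ∈ P := Or.inr (SameClique.refl G b)
  obtain ⟨ψ, hψ, hψm⟩ := huh.exists_aut_apply (x := ⟨m, Or.inl (SameClique.refl G m)⟩)
    (y := ⟨m', Or.inl hmm'⟩) hmm'.1
  have hcol : G.color (ψ ⟨b, hbP⟩ : V) = G.color b := hψ.2 ⟨b, hbP⟩
  have hsame : G.SameClique b (ψ ⟨b, hbP⟩ : V) := mem_right_of_color hb (ψ ⟨b, hbP⟩).2 hcol
  have heq : b = (ψ ⟨b, hbP⟩ : V) := by
    by_contra hne
    exact hi _ _ rfl hcol (hsame.adj hne)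
  have := hψ.1 ⟨b, hbP⟩ ⟨m, Or.inl (SameClique.refl G m)⟩
  rw [hψm] at this
  have : G.graph.Adj (ψ ⟨b, hbP⟩ : V) m' ↔ G.graph.Adj b m := this
  rw [← heq] at this
  exact hbm' (this.2 hbm)

/-- Two vertices of a clique which have the same neighbors in the clique of `b` cannot be mapped
to two vertices separated by `b`. -/
theorem not_isPiecewiseUltrahomogeneous_of_twins {V : Type*} {G : ColoredGraph V}
    (hC : G.CliqueClasses) {m m' m'' b : V} (hmm' : G.SameClique m m')
    (hmm'' : G.SameClique m m'') (hne : m ≠ m') (hne' : m ≠ m'') (hb : G.color m ≠ G.color b)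
    (htwin : ∀ x, G.SameClique b x → (G.graph.Adj x m ↔ G.graph.Adj x m'))
    (hbm : ¬ (G.graph.Adj b m ↔ G.graph.Adj b m'')) : ¬ G.IsPiecewiseUltrahomogeneous := by
  intro h
  have huh := (isPiecewiseUltrahomogeneous_iff hC).1 h m b hb
  set P := G.cliqueOf m ∪ G.cliqueOf b
  have hmP : m ∈ P := Or.inl (SameClique.refl G m)
  have hm'P : m' ∈ P := Or.inl hmm'
  have hm''P : m'' ∈ P := Or.inl hmm''
  have hbP : b ∈ P := Or.inr (SameClique.refl G b)
  obtain ⟨ψ, hψ, hψm', hψm⟩ := huh.exists_aut_fix (C := {⟨m, hmP⟩}) (Set.finite_singleton _)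
    (x := ⟨m', hm'P⟩) (y := ⟨m'', hm''P⟩) (by simpa using hne.symm) (by simpa using hne'.symm)
    (hmm'.symm.1.trans hmm''.1) (by
      simp only [Set.mem_singleton_iff, forall_eq]
      exact iff_of_true (hmm'.adj hne) (hmm''.adj hne'))
  have hψm := hψm _ rfl
  set x := ψ.symm ⟨b, hbP⟩
  have hψx : ψ x = ⟨b, hbP⟩ := ψ.apply_symm_apply _
  have hcol : G.color (x : V) = G.color b := hψ.symm.2 ⟨b, hbP⟩
  have h1 : G.graph.Adj b m ↔ G.graph.Adj (x : V) m := by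
    have := hψ.1 x ⟨m, hmP⟩
    rwa [hψx, hψm] at this
  have h2 : G.graph.Adj b m'' ↔ G.graph.Adj (x : V) m' := by
    have := hψ.1 x ⟨m', hm'P⟩
    rwa [hψx, hψm'] at this
  exact hbm (by rw [h1, h2]; exact htwin x (mem_right_of_color hb x.2 hcol))

theorem isUltrahomogeneous_induce {V : Type*} {G : ColoredGraph V} {P : Set V}
    (h : ∀ (S : Set V) (f : V → V), S.Finite → S ⊆ P → IsEmbOn G G S f → Set.MapsTo f S P →
      ∃ ψ : V ≃ V, G.IsAut ψ ∧ (∀ v, ψ v ∈ P ↔ v ∈ P) ∧ ∀ v ∈ S, ψ v = f v) :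
    (G.induce P).IsUltrahomogeneous := by
  classical
  refine isUltrahomogeneous_iff.2 fun S hS f hf => ?_
  have hval : ∀ v : P, (if h : (v : V) ∈ P then (f ⟨v, h⟩ : V) else v) = f v := fun v => by
    simp [v.2]
  obtain ⟨ψ, hψ, hψP, hψS⟩ := h (Subtype.val '' S)
    (fun v => if h : v ∈ P then (f ⟨v, h⟩ : V) else v) (hS.image _)
    (by rintro _ ⟨v, -, rfl⟩
        exact v.2)
    (by
      refine ⟨?_, ?_, ?_⟩
      · rintro _ ⟨v, hv, rfl⟩ _ ⟨w, hw, rfl⟩ hvw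
        simp only [hval] at hvw
        rw [hf.inj hv hw (Subtype.ext hvw)]
      · rintro _ ⟨v, hv, rfl⟩
        simp only [hval]
        exact hf.color v hv
      · rintro _ ⟨v, hv, rfl⟩ _ ⟨w, hw, rfl⟩
        simp only [hval]
        exact hf.adj v hv w hw)
    (by rintro _ ⟨v, hv, rfl⟩
        simp only [hval]
        exact (f v).2)
  refine ⟨ψ.subtypeEquiv fun v => (hψP v).symm, ⟨fun u v => hψ.1 u v, fun u => hψ.2 u⟩,
    fun v hv => Subtype.ext ?_⟩
  exact (hψS v ⟨v, hv, rfl⟩).trans (hval v)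

/-- To extend an isomorphism between finite subsets of two cliques it suffices to extend it when
it is defined on vertices of one clique only, to one vertex of the other clique: an automorphism
of `G` which respects vertices of both cliques respects the cliques. -/
theorem isPiecewiseUltrahomogeneous_of_extend {V : Type*} {G : ColoredGraph V}
    (hG : G.IsUltrahomogeneous) (hC : G.CliqueClasses)
    (hext : ∀ m n, G.color m ≠ G.color n → ∀ (S : Set V) (f : V → V), S.Finite → S.Nonempty →
      S ⊆ G.cliqueOf n → IsEmbOn G G S f → Set.MapsTo f S (G.cliqueOf n) →
      ∃ y, G.SameClique m y ∧ ∀ s ∈ S, G.graph.Adj (f s) y ↔ G.graph.Adj s m) :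
    G.IsPiecewiseUltrahomogeneous := by
  classical
  refine (isPiecewiseUltrahomogeneous_iff hC).2 fun m n hmn => ?_
  set P := G.cliqueOf m ∪ G.cliqueOf n with hP
  have hside : ∀ {a b x}, G.color a ≠ G.color b → x ∈ G.cliqueOf a ∪ G.cliqueOf b →
      G.color x ≠ G.color b → G.SameClique a x := fun _ hx hxn =>
    hx.resolve_right fun h => hxn (SameClique.color_eq h)
  -- an automorphism respecting one vertex of each clique
  have hboth : ∀ (S : Set V) (f : V → V), S.Finite → S ⊆ P → IsEmbOn G G S f → Set.MapsTo f S P →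
      (∃ x ∈ S, x ∈ G.cliqueOf m) → (∃ x ∈ S, x ∈ G.cliqueOf n) →
      ∃ ψ : V ≃ V, G.IsAut ψ ∧ (∀ v, ψ v ∈ P ↔ v ∈ P) ∧ ∀ v ∈ S, ψ v = f v := by
    rintro S f hS hSP hf hfP ⟨x, hxS, hx⟩ ⟨y, hyS, hy⟩
    obtain ⟨ψ, hψ, hψS⟩ := hG.exists_aut hS hf
    have hfx : G.SameClique m (ψ x) := by
      rw [hψS x hxS]
      refine hside hmn (hfP hxS) ?_
      rw [hf.color x hxS, SameClique.color_eq hx]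
      exact hmn
    have hfy : G.SameClique n (ψ y) := by
      rw [hψS y hyS]
      refine mem_right_of_color hmn (hfP hyS) ?_
      rw [hf.color y hyS, SameClique.color_eq hy]
    refine ⟨ψ, hψ, fun v => or_congr ?_ ?_, hψS⟩
    · constructor
      · intro h
        exact SameClique.trans hC hx (hψ.sameClique.1 (SameClique.trans hC hfx.symm h))
      · intro h
        exact SameClique.trans hC hfx (hψ.sameClique.2 (SameClique.trans hC (SameClique.symm hx) h))
    · constructor
      · intro h
        exact SameClique.trans hC hy (hψ.sameClique.1 (SameClique.trans hC hfy.symm h))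
      · intro h
        exact SameClique.trans hC hfy (hψ.sameClique.2 (SameClique.trans hC (SameClique.symm hy) h))
  -- extending a map on one clique to a vertex `a` of the other one
  have hone : ∀ (a b : V), G.color a ≠ G.color b → ∀ (S : Set V) (f : V → V), S.Finite →
      S.Nonempty → S ⊆ G.cliqueOf b → IsEmbOn G G S f → Set.MapsTo f S (G.cliqueOf b) →
      ∃ g : V → V, IsEmbOn G G (insert a S) g ∧ Set.EqOn g f S ∧ G.SameClique a (g a) := by
    intro a b hab S f hS hne hSb hf hfb
    obtain ⟨y, hay, hy⟩ := hext a b hab S f hS hne hSb hf hfb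
    have hSa : ∀ s ∈ S, s ≠ a := fun s hs h => hab (h ▸ SameClique.color_eq (hSb hs))
    refine ⟨Function.update f a y, ?_, fun s hs => Function.update_of_ne (hSa s hs) _ _, by
      simpa using hay⟩
    refine hf.update (fun h => hSa a h rfl) hay.color_eq (fun s hs h => hab ?_) hy
    rw [← hay.color_eq, ← h]
    exact SameClique.color_eq (hfb hs)
  refine isUltrahomogeneous_induce fun S f hS hSP hf hfP => ?_
  rcases S.eq_empty_or_nonempty with rfl | hSne
  · exact ⟨Equiv.refl V, ⟨fun _ _ => Iff.rfl, fun _ => rfl⟩, fun _ => Iff.rfl, by simp⟩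
  have hfinish : ∀ a ∈ P, ∀ g : V → V, IsEmbOn G G (insert a S) g → Set.EqOn g f S → g a ∈ P →
      (∃ x ∈ insert a S, x ∈ G.cliqueOf m) → (∃ x ∈ insert a S, x ∈ G.cliqueOf n) →
      ∃ ψ : V ≃ V, G.IsAut ψ ∧ (∀ v, ψ v ∈ P ↔ v ∈ P) ∧ ∀ v ∈ S, ψ v = f v := by
    intro a ha g hg hgf hga hm hn
    obtain ⟨ψ, hψ, hψP, hψS⟩ := hboth (insert a S) g (hS.insert a)
      (Set.insert_subset ha hSP) hg (by
        rintro s (rfl | hs)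
        · exact hga
        · rw [hgf hs]
          exact hfP hs) hm hn
    exact ⟨ψ, hψ, hψP, fun v hv => (hψS v (Or.inr hv)).trans (hgf hv)⟩
  by_cases hm : ∃ x ∈ S, x ∈ G.cliqueOf m
  · by_cases hn : ∃ x ∈ S, x ∈ G.cliqueOf n
    · exact hboth S f hS hSP hf hfP hm hn
    · have hSm : S ⊆ G.cliqueOf m := fun s hs => (hSP hs).resolve_right fun h => hn ⟨s, hs, h⟩
      obtain ⟨g, hg, hgf, hgn⟩ := hone n m hmn.symm S f hS hSne hSm hf (fun s hs =>
        hside hmn (hfP hs) (by rw [hf.color s hs, SameClique.color_eq (hSm hs)]; exact hmn))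
      obtain ⟨x, hx, hxm⟩ := hm
      exact hfinish n (Or.inr (SameClique.refl G n)) g hg hgf (Or.inr hgn)
        ⟨x, Or.inr hx, hxm⟩ ⟨n, Or.inl rfl, SameClique.refl G n⟩
  · have hSn : S ⊆ G.cliqueOf n := fun s hs => (hSP hs).resolve_left fun h => hm ⟨s, hs, h⟩
    obtain ⟨g, hg, hgf, hgm⟩ := hone m n hmn S f hS hSne hSn hf (fun s hs =>
      mem_right_of_color hmn (hfP hs) (by rw [hf.color s hs, SameClique.color_eq (hSn hs)]))
    obtain ⟨x, hx⟩ := hSne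
    exact hfinish m (Or.inl (SameClique.refl G m)) g hg hgf (Or.inl hgm)
      ⟨m, Or.inl rfl, SameClique.refl G m⟩ ⟨x, Or.inr hx, hSn hx⟩

/-! ### Piecewise ultrahomogeneity of the graphs in the two lists -/

/-- If `H` is realized in an ultrahomogeneous graph, then each embedding of an induced subgraph of
`H` extends to `H`. -/
theorem IsUltrahomogeneous.exists_extension {W V : Type*} {H : ColoredGraph W} {G : ColoredGraph V}
    (hG : G.IsUltrahomogeneous) (h : H.IsRealizedIn G) {S : Set W} (hS : S.Finite) {f : W → V}
    (hf : IsEmbOn H G S f) : ∃ g, IsEmbOn H G Set.univ g ∧ Set.EqOn g f S := by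
  obtain ⟨e, he⟩ := isRealizedIn_iff.1 h
  have hinj : Function.Injective e := fun a b hab => he.inj trivial trivial hab
  rcases S.eq_empty_or_nonempty with rfl | ⟨w₀, hw₀⟩
  · exact ⟨e, he, by simp [Set.EqOn]⟩
  have : Nonempty W := ⟨w₀⟩
  have hinv : ∀ w, Function.invFun e (e w) = w := Function.leftInverse_invFun hinj
  obtain ⟨ψ, hψ, hψS⟩ := hG.exists_aut (hS.image e) (f := f ∘ Function.invFun e) (by
    refine ⟨?_, ?_, ?_⟩
    · rintro _ ⟨v, hv, rfl⟩ _ ⟨w, hw, rfl⟩ hvw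
      simp only [Function.comp_apply, hinv] at hvw
      rw [hf.inj hv hw hvw]
    · rintro _ ⟨v, hv, rfl⟩
      simp only [Function.comp_apply, hinv]
      rw [hf.color v hv, he.color v trivial]
    · rintro _ ⟨v, hv, rfl⟩ _ ⟨w, hw, rfl⟩
      simp only [Function.comp_apply, hinv]
      rw [hf.adj v hv w hw, he.adj v trivial w trivial])
  refine ⟨ψ ∘ e, ⟨fun a _ b _ hab => hinj (ψ.injective hab), fun w _ => ?_, fun w _ w' _ => ?_⟩,
    fun w hw => ?_⟩
  · exact (hψ.2 _).trans (he.color w trivial)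
  · exact (hψ.1 _ _).trans (he.adj w trivial w' trivial)
  · have := hψS (e w) ⟨w, hw, rfl⟩
    simp only [Function.comp_apply, hinv] at this
    exact this

theorem IsFraisseLimit.omits {W : Type} [Finite W] {V : Type*}
    {K : ∀ W : Type, ColoredGraph W → Prop} {G : ColoredGraph V} (h : IsFraisseLimit K G)
    {F : ColoredGraph W} (hF : K W F → F.Omits F) : G.Omits F := fun hr =>
  hF ((h.2.2 W F).1 hr) (isRealizedIn_iff.2 ⟨id, fun _ _ _ _ h => h, fun _ _ => rfl,
    fun _ _ _ _ => Iff.rfl⟩)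

/-- The graph consisting of a clique on `α` of color `c` and a clique on `β` of the other color,
with cross edges given by `E`. -/
def twoCliques {α β : Type} (c : Color) (E : α → β → Prop) : ColoredGraph (α ⊕ β) where
  graph :=
    { Adj := fun x y => match x, y with
        | .inl a, .inl a' => a ≠ a'
        | .inl a, .inr b => E a b
        | .inr b, .inl a => E a b
        | .inr b, .inr b' => b ≠ b'
      symm := ⟨fun x y h => by
        rcases x with a | b <;> rcases y with a' | b'
        · exact Ne.symm h
        · exact h
        · exact h
        · exact Ne.symm h⟩
      loopless := ⟨fun x h => by
        rcases x with a | b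
        · exact h rfl
        · exact h rfl⟩ }
  color := fun x => match x with
    | .inl _ => c
    | .inr _ => c.other

section TwoCliques

variable {α β : Type} {c : Color} {E : α → β → Prop}

theorem twoCliques_isSingleClique (d : Color) : (twoCliques c E).IsSingleClique d := by
  have hc : c ≠ c.other := (other_ne c).symm
  rintro (a | b) (a' | b') hx hy hne
  · exact fun h => hne (congrArg Sum.inl h)
  · exact absurd ((show c = d from hx).trans (show c.other = d from hy).symm) hc
  · exact absurd ((show c = d from hy).trans (show c.other = d from hx).symm) hc
  · exact fun h => hne (congrArg Sum.inr h)

theorem cliqueClasses_of_isSingleClique {W : Type*} {H : ColoredGraph W}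
    (h : ∀ c, H.IsSingleClique c) : H.CliqueClasses :=
  fun c u _ w hu _ hw _ _ huw => h c u w hu hw huw

theorem twoCliques_cliqueClasses : (twoCliques c E).CliqueClasses :=
  cliqueClasses_of_isSingleClique twoCliques_isSingleClique

theorem classG_of_isSingleClique {W : Type} {H : ColoredGraph W} (h : ∀ c, H.IsSingleClique c)
    {r b : ℕ∞} (hr : 1 ≤ r) (hb : 1 ≤ b) : ClassG r b W H := by
  have hC := cliqueClasses_of_isSingleClique h
  exact ⟨hC, ((encard_maxCliques_le_one_iff hC).2 (h _)).trans hr,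
    ((encard_maxCliques_le_one_iff hC).2 (h _)).trans hb⟩

theorem twoCliques_exists_inr {x : α ⊕ β} (hx : (twoCliques c E).color x = c.other) :
    ∃ b, x = .inr b := by
  rcases x with a | b
  · exact absurd (show c = c.other from hx) (other_ne c).symm
  · exact ⟨b, rfl⟩

theorem twoCliques_exists_inl {x : α ⊕ β} (hx : (twoCliques c E).color x = c) :
    ∃ a, x = .inl a := by
  rcases x with a | b
  · exact ⟨a, rfl⟩
  · exact absurd (show c.other = c from hx) (other_ne c)

end TwoCliques

/-- Two adjacent red vertices and a blue vertex adjacent to exactly one of them. -/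
def splitPair : ColoredGraph (Bool ⊕ Unit) := twoCliques .red fun a _ => a = true

/-- Three red vertices and two adjacent blue vertices; two of the red vertices are adjacent to one
blue vertex only, and the third one to the other blue vertex only. -/
def twinPair : ColoredGraph (Option Bool ⊕ Bool) := twoCliques .red fun a b => a.isSome = b

theorem splitPair_isIndep : splitPair.IsIndep .blue := by
  intro x y hx hy
  obtain ⟨a, rfl⟩ := twoCliques_exists_inr (c := .red) hx
  obtain ⟨b, rfl⟩ := twoCliques_exists_inr (c := .red) hy
  exact fun h => h rfl

theorem splitPair_triFree : splitPair.TriFree .red := by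
  intro x y z hx hy hz
  obtain ⟨a, rfl⟩ := twoCliques_exists_inl (c := .red) hx
  obtain ⟨b, rfl⟩ := twoCliques_exists_inl (c := .red) hy
  obtain ⟨d, rfl⟩ := twoCliques_exists_inl (c := .red) hz
  intro h1 h2 h3
  have h1' : a ≠ b := h1
  have h2' : b ≠ d := h2
  have h3' : a ≠ d := h3
  clear * - h1' h2' h3'
  revert a b d
  decide

theorem splitPair_exactlyOne : splitPair.ExactlyOne .red := by
  intro x y w hx hy hw hxy
  obtain ⟨a, rfl⟩ := twoCliques_exists_inl (c := .red) hx
  obtain ⟨b, rfl⟩ := twoCliques_exists_inl (c := .red) hy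
  obtain ⟨d, rfl⟩ := twoCliques_exists_inr (c := .red) (color_ne_iff_eq_other.1 hw)
  have hab : a ≠ b := hxy
  change a = true ↔ ¬ b = true
  clear * - hab
  revert a b
  decide

theorem twinPair_triFree : twinPair.TriFree .blue := by
  intro x y z hx hy hz
  obtain ⟨a, rfl⟩ := twoCliques_exists_inr (c := .red) hx
  obtain ⟨b, rfl⟩ := twoCliques_exists_inr (c := .red) hy
  obtain ⟨d, rfl⟩ := twoCliques_exists_inr (c := .red) hz
  intro h1 h2 h3
  have h1' : a ≠ b := h1
  have h2' : b ≠ d := h2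
  have h3' : a ≠ d := h3
  clear * - h1' h2' h3'
  revert a b d
  decide

theorem twinPair_exactlyOne : twinPair.ExactlyOne .blue := by
  intro x y w hx hy hw hxy
  obtain ⟨a, rfl⟩ := twoCliques_exists_inr (c := .red) hx
  obtain ⟨b, rfl⟩ := twoCliques_exists_inr (c := .red) hy
  obtain ⟨d, rfl⟩ := twoCliques_exists_inl (c := .red) (color_ne_other_iff.1 hw)
  have hab : a ≠ b := hxy
  change d.isSome = a ↔ ¬ d.isSome = b
  clear * - hab
  revert a b d
  decide

theorem twinPair_even : twinPair.Even .red := by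
  intro x y hx hxy u v hu huv
  obtain ⟨a, rfl⟩ := twoCliques_exists_inr (c := .red) (color_ne_iff_eq_other.1 hx)
  obtain ⟨b, rfl⟩ := twoCliques_exists_inr (c := .red)
    (hxy.color_eq.trans (color_ne_iff_eq_other.1 hx))
  obtain ⟨d, rfl⟩ := twoCliques_exists_inl (c := .red) hu
  obtain ⟨e, rfl⟩ := twoCliques_exists_inl (c := .red) (huv.color_eq.trans hu)
  change (d.isSome = a ↔ d.isSome = b) ↔ (e.isSome = a ↔ e.isSome = b)
  clear hx hxy hu huv
  revert a b d e
  decide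

/-- The blue vertex of a `splitPair` is a maximal clique, which splits the clique of the two red
vertices. -/
theorem not_isPiecewiseUltrahomogeneous_of_splitPair {V : Type*} {G : ColoredGraph V}
    (hC : G.CliqueClasses) (hi : G.IsIndep .blue) (h : splitPair.IsRealizedIn G) :
    ¬ G.IsPiecewiseUltrahomogeneous := by
  obtain ⟨f, hf⟩ := isRealizedIn_iff.1 h
  have hred : ∀ a, G.color (f (.inl a)) = .red := fun a => hf.color _ trivial
  have hblue : G.color (f (.inr ())) = .blue := hf.color _ trivial
  refine not_isPiecewiseUltrahomogeneous_of_isIndep hC (m := f (.inl true)) (m' := f (.inl false))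
    (b := f (.inr ())) ?_ (by simp [hred, hblue]) (hblue ▸ hi) ?_ ?_
  · exact ⟨by rw [hred, hred], Or.inr ((hf.adj _ trivial _ trivial).2
      (show true ≠ false by decide))⟩
  · exact (hf.adj _ trivial _ trivial).2 (show true = true by decide)
  · exact fun h => absurd ((hf.adj _ trivial _ trivial).1 h) (show ¬ (false = true) by decide)

/-- If blue cliques are pairs with opposite neighbors, or in the even case, the two red vertices of
a `twinPair` with the same neighbors have the same neighbors in the whole blue clique, unlike the two
other pairs of red vertices. -/
theorem not_isPiecewiseUltrahomogeneous_of_twinPair {V : Type*} {G : ColoredGraph V}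
    (hC : G.CliqueClasses) (h : G.ExactlyOne .blue ∨ G.Even .red)
    (hr : twinPair.IsRealizedIn G) : ¬ G.IsPiecewiseUltrahomogeneous := by
  obtain ⟨f, hf⟩ := isRealizedIn_iff.1 hr
  have hred : ∀ a, G.color (f (.inl a)) = .red := fun a => hf.color _ trivial
  have hblue : ∀ b, G.color (f (.inr b)) = .blue := fun b => hf.color _ trivial
  have hsame : ∀ a a', G.SameClique (f (.inl a)) (f (.inl a')) := by
    intro a a'
    refine ⟨by rw [hred, hred], ?_⟩
    by_cases h : a = a'
    · exact Or.inl (by rw [h])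
    · exact Or.inr ((hf.adj _ trivial _ trivial).2 h)
  have hne : ∀ a a', a ≠ a' → f (.inl a) ≠ f (.inl a') := fun a a' h h' =>
    h (Sum.inl_injective (hf.inj trivial trivial h'))
  have hcross : ∀ a b, G.graph.Adj (f (.inr b)) (f (.inl a)) ↔ a.isSome = b :=
    fun a b => hf.adj _ trivial _ trivial
  refine not_isPiecewiseUltrahomogeneous_of_twins hC (m := f (.inl (some true)))
    (m' := f (.inl (some false))) (m'' := f (.inl none)) (b := f (.inr true)) (hsame _ _)
    (hsame _ _) (hne _ _ (by decide)) (hne _ _ (by decide)) (by simp [hred, hblue]) ?_ ?_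
  · intro x hx
    by_cases hbx : f (.inr true) = x
    · rw [← hbx, hcross, hcross]
      decide
    · have hxc : G.color x = .blue := hx.color_eq.trans (hblue _)
      have key := fun a => hcross a true
      rcases h with h | h
      · have h1 := h _ x (f (.inl (some true))) (hblue true) hxc (by simp [hred]) (hx.adj hbx)
        have h2 := h _ x (f (.inl (some false))) (hblue true) hxc (by simp [hred]) (hx.adj hbx)
        rw [G.graph.adj_comm, G.graph.adj_comm _ x] at h1 h2
        rw [key] at h1 h2
        simp only [Option.isSome_some, true_iff] at h1 h2
        exact iff_of_false h1 h2
      · have := h _ x (by simp [hblue]) hx _ _ (hred (some true)) (hsame _ (some false))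
        simp only [key, Option.isSome_some, true_iff] at this
        exact this
  · rw [hcross, hcross]
    decide

theorem not_forall_isIndep_or_isSingleClique {V : Type*} {G : ColoredGraph V} {c : Color}
    (h : ¬ G.Omits (monoK c 2)) (h' : ¬ G.Omits (monoCoK c 2)) (hC : G.CliqueClasses) :
    ¬ ∀ c, G.IsIndep c ∨ G.IsSingleClique c := by
  intro hall
  rcases hall c with hc | hc
  · exact h (omits_monoK_two_iff.2 hc)
  · refine h' ((omits_monoCoK_iff hC (k := 1)).2 ?_)
    rw [Nat.cast_one, encard_maxCliques_le_one_iff hC]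
    exact hc

theorem monoK_isSingleClique (c d : Color) (n : ℕ) : (monoK c n).IsSingleClique d :=
  fun _ _ _ _ h => h

theorem monoCoK_isIndep (c d : Color) (n : ℕ) : (monoCoK c n).IsIndep d :=
  fun _ _ _ _ h => h

theorem cliqueClasses_monoCoK (c : Color) (n : ℕ) : (monoCoK c n).CliqueClasses :=
  fun _ _ _ _ _ _ _ h => h.elim

theorem monoK_two_triFree (c d : Color) : (monoK c 2).TriFree d := by
  intro x y z _ _ _ hxy hyz hxz
  have h1 : x ≠ y := hxy
  have h2 : y ≠ z := hyz
  have h3 : x ≠ z := hxz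
  omega

theorem exactlyOne_of_monochromatic {W : Type*} {H : ColoredGraph W} {d : Color}
    (h : ∀ w, H.color w = d) (c : Color) : H.ExactlyOne c :=
  fun x _ w hx _ hw _ => absurd ((h w).trans ((h x).symm.trans hx)) hw

theorem even_of_monochromatic {W : Type*} {H : ColoredGraph W} {d : Color}
    (h : ∀ w, H.color w = d) (c : Color) : H.Even c :=
  fun x _ hx _ u _ hu _ => absurd ((h x).trans ((h u).symm.trans hu)) hx

theorem encard_maxCliques_monoCoK_le (c d : Color) (n : ℕ) :
    ((monoCoK c n).maxCliques d).encard ≤ n := by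
  rw [← omits_monoCoK_iff (cliqueClasses_monoCoK c n), Omits, isRealizedIn_iff]
  rintro ⟨f, hf⟩
  have hinj : Function.Injective f := fun a b hab => hf.inj trivial trivial hab
  have := Fintype.card_le_of_injective f hinj
  simp at this

theorem monoK_cliqueClasses (c : Color) (n : ℕ) : (monoK c n).CliqueClasses :=
  cliqueClasses_of_isSingleClique fun d => monoK_isSingleClique c d n

theorem IsFraisseLimit.isRealizedIn {W : Type} [Finite W] {V : Type*}
    {K : ∀ W : Type, ColoredGraph W → Prop} {G : ColoredGraph V} (h : IsFraisseLimit K G)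
    {F : ColoredGraph W} (hF : K W F) : F.IsRealizedIn G :=
  (h.2.2 W F).2 hF

/-- The graphs of the second list have a color class which is neither independent nor a clique,
and they are not piecewise ultrahomogeneous: if blue is independent, then they contain `splitPair`,
and otherwise `twinPair`. -/
theorem InListTwo.properties {V : Type*} {G : ColoredGraph V} (hC : G.CliqueClasses)
    (h : G.InListTwo) : ¬ G.IsPiecewiseUltrahomogeneous ∧
      ¬ ∀ c, G.IsIndep c ∨ G.IsSingleClique c := by
  have hK := monoK_cliqueClasses
  have hcoK := cliqueClasses_monoCoK
  have hcard1 : ∀ {U : Type} {F : ColoredGraph U} {k : ℕ}, (∀ c, F.IsSingleClique c) → 1 ≤ k →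
      F.Omits (monoCoK .red (k + 1)) := fun hF hk => by
    have hCF := cliqueClasses_of_isSingleClique hF
    exact (omits_monoCoK_iff hCF).2 (((encard_maxCliques_le_one_iff hCF).2 (hF _)).trans
      (by exact_mod_cast hk))
  have hcoK3 : ∀ c d, (monoCoK c 2).Omits (monoK d 3) := fun c d =>
    omits_monoK_three_iff.2 (isIndep_triFree (monoCoK_isIndep c d 2))
  have hK3 : ∀ c d, (monoK c 2).Omits (monoK d 3) := fun c d =>
    omits_monoK_three_iff.2 (monoK_two_triFree c d)
  have hcoK2 : ∀ c d, (monoCoK c 2).Omits (monoK d 2) := fun c d =>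
    omits_monoK_two_iff.2 (monoCoK_isIndep c d 2)
  have hK2 : (monoK .red 2).Omits (monoK .blue 2) := omits_monoK_two_iff.2 fun u _ hu =>
    absurd hu (by simp [monoK])
  have hKT : ∀ c d, (monoK c 2).Omits (triangle d) ∧ (monoK c 2).Omits (triangle d).crossCompl :=
    fun c d => omits_triangle_iff.2 (exactlyOne_of_monochromatic (fun _ => rfl) d)
  have hcoKT : ∀ c d,
      (monoCoK c 2).Omits (triangle d) ∧ (monoCoK c 2).Omits (triangle d).crossCompl :=
    fun c d => omits_triangle_iff.2 (exactlyOne_of_monochromatic (fun _ => rfl) d)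
  have hSi := omits_monoK_two_iff.2 splitPair_isIndep
  have hSc : splitPair.CliqueClasses := twoCliques_cliqueClasses
  have hTc : twinPair.CliqueClasses := twoCliques_cliqueClasses
  have hT3 := omits_monoK_three_iff.2 twinPair_triFree
  have hTT := omits_triangle_iff.2 twinPair_exactlyOne
  rcases h with ⟨k, hk, h⟩ | ⟨k, hk, h⟩ | h | h | h | h
  · refine ⟨not_isPiecewiseUltrahomogeneous_of_splitPair hC
      (omits_monoK_two_iff.1 (h.omits fun hF => hF.2.2)) (h.isRealizedIn
        ⟨hSc, hcard1 twoCliques_isSingleClique (by omega), hSi⟩),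
      not_forall_isIndep_or_isSingleClique (c := .red) (not_not.2 (h.isRealizedIn ?_))
        (not_not.2 (h.isRealizedIn ?_)) hC⟩
    · exact ⟨hK _ _, hcard1 (fun d => monoK_isSingleClique _ d 2) (by omega), hK2⟩
    · exact ⟨hcoK _ _, (omits_monoCoK_iff (hcoK _ _)).2
        ((encard_maxCliques_monoCoK_le _ _ _).trans (by exact_mod_cast hk)), hcoK2 _ _⟩
  · refine ⟨not_isPiecewiseUltrahomogeneous_of_twinPair hC
      (Or.inl (omits_triangle_iff.1 ⟨h.omits fun hF => hF.2.2.2.1, h.omits fun hF => hF.2.2.2.2⟩))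
      (h.isRealizedIn ⟨hTc, hcard1 twoCliques_isSingleClique hk, hT3, hTT⟩),
      not_forall_isIndep_or_isSingleClique (c := .blue) (not_not.2 (h.isRealizedIn ?_))
        (not_not.2 (h.isRealizedIn ?_)) hC⟩
    · exact ⟨hK _ _, hcard1 (fun d => monoK_isSingleClique _ d 2) hk, hK3 _ _, hKT _ _⟩
    · refine ⟨hcoK _ _, (omits_monoCoK_iff (hcoK _ _)).2 ?_, hcoK3 _ _, hcoKT _ _⟩
      refine ((encard_maxCliques_le_one_iff (hcoK _ _)).2 fun u _ hu => ?_).trans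
        (by exact_mod_cast hk)
      exact absurd hu (by simp [monoCoK])
  · refine ⟨not_isPiecewiseUltrahomogeneous_of_splitPair hC
      (omits_monoK_two_iff.1 (h.omits fun hF => hF.2.2.1)) (h.isRealizedIn
        ⟨hSc, omits_monoK_three_iff.2 splitPair_triFree, hSi,
          omits_triangle_iff.2 splitPair_exactlyOne⟩),
      not_forall_isIndep_or_isSingleClique (c := .red) (not_not.2 (h.isRealizedIn ?_))
        (not_not.2 (h.isRealizedIn ?_)) hC⟩
    · exact ⟨hK _ _, hK3 _ _, hK2, hKT _ _⟩
    · exact ⟨hcoK _ _, hcoK3 _ _, hcoK2 _ _, hcoKT _ _⟩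
  · exact ⟨not_isPiecewiseUltrahomogeneous_of_splitPair hC
      (omits_monoK_two_iff.1 (h.omits fun hF => hF.2)) (h.isRealizedIn ⟨hSc, hSi⟩),
      not_forall_isIndep_or_isSingleClique (c := .red)
        (not_not.2 (h.isRealizedIn ⟨hK _ _, hK2⟩))
        (not_not.2 (h.isRealizedIn ⟨hcoK _ _, hcoK2 _ _⟩)) hC⟩
  · exact ⟨not_isPiecewiseUltrahomogeneous_of_twinPair hC
      (Or.inl (omits_triangle_iff.1 ⟨h.omits fun hF => hF.2.2.1, h.omits fun hF => hF.2.2.2⟩))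
      (h.isRealizedIn ⟨hTc, hT3, hTT⟩),
      not_forall_isIndep_or_isSingleClique (c := .blue)
        (not_not.2 (h.isRealizedIn ⟨hK _ _, hK3 _ _, hKT _ _⟩))
        (not_not.2 (h.isRealizedIn ⟨hcoK _ _, hcoK3 _ _, hcoKT _ _⟩)) hC⟩
  · have hD : ∀ {F : ColoredGraph (Fin 2)} (c : Color), (∀ w, F.color w = c) →
        F.Omits diamond ∧ F.Omits diamond.crossCompl := fun c hF =>
      omits_diamond_iff.2 (even_of_monochromatic hF .red)
    exact ⟨not_isPiecewiseUltrahomogeneous_of_twinPair hC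
      (Or.inr (omits_diamond_iff.1 ⟨h.omits fun hF => hF.2.1, h.omits fun hF => hF.2.2⟩))
      (h.isRealizedIn ⟨hTc, omits_diamond_iff.2 twinPair_even⟩),
      not_forall_isIndep_or_isSingleClique (c := .red)
        (not_not.2 (h.isRealizedIn ⟨hK _ _, hD .red fun _ => rfl⟩))
        (not_not.2 (h.isRealizedIn ⟨hcoK _ _, hD .red fun _ => rfl⟩)) hC⟩

/-- Over a finite subset of a clique, any pattern is realized in any clique of the other color of
`G_{r,b}`. -/
theorem IsFraisseLimit.isPiecewiseUltrahomogeneous_of_classG {V : Type*} {G : ColoredGraph V}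
    (hC : G.CliqueClasses) {r b : ℕ∞} (hr : 1 ≤ r) (hb : 1 ≤ b)
    (h : IsFraisseLimit (ClassG r b) G) : G.IsPiecewiseUltrahomogeneous := by
  classical
  have hG := h.2.1
  refine isPiecewiseUltrahomogeneous_of_extend hG hC fun m n hmn S f hS _ hSn hf hfn => ?_
  obtain ⟨k, ⟨e⟩⟩ := (hS.image f).to_subtype.exists_equiv_fin
  -- `inl true` stands for `m` and `inl false` for the vertex to be found
  let E : Bool → Fin k → Prop := fun a i =>
    if a then G.graph.Adj m (e.symm i) else ∃ s ∈ S, f s = e.symm i ∧ G.graph.Adj s m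
  have hreal : (twoCliques (G.color m) E).IsRealizedIn G :=
    h.isRealizedIn (classG_of_isSingleClique twoCliques_isSingleClique hr hb)
  have hT : ∀ i, G.SameClique n (e.symm i : V) := fun i => by
    obtain ⟨s, hs, hsi⟩ := (e.symm i).2
    rw [← hsi]
    exact hfn hs
  have hmT : ∀ i, m ≠ (e.symm i : V) := fun i hi => hmn (by rw [hi, (hT i).color_eq])
  have hinj : ∀ i j, (e.symm i : V) = e.symm j → i = j := fun i j hij =>
    e.symm.injective (Subtype.ext hij)
  obtain ⟨g, hg, hgS⟩ := hG.exists_extension hreal (S := {x | x ≠ .inl false}) (Set.toFinite _)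
    (f := Sum.elim (fun _ => m) fun i => (e.symm i : V)) (by
      refine ⟨?_, ?_, ?_⟩
      · rintro ((_ | _) | i) hx ((_ | _) | j) hy hxy
        all_goals first | exact absurd rfl hx | exact absurd rfl hy | skip
        · rfl
        · exact absurd hxy (hmT j)
        · exact absurd hxy.symm (hmT i)
        · exact congrArg Sum.inr (hinj i j hxy)
      · rintro ((_ | _) | i) hx
        · exact absurd rfl hx
        · rfl
        · exact (hT i).color_eq.trans (color_ne_iff_eq_other.1 hmn.symm)
      · rintro ((_ | _) | i) hx ((_ | _) | j) hy
        all_goals first | exact absurd rfl hx | exact absurd rfl hy | skip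
        · exact iff_of_false (G.graph.loopless.irrefl m) fun h => h rfl
        · change _ ↔ E true j
          simp [E]
        · change _ ↔ E true i
          simp [E, G.graph.adj_comm]
        · change G.graph.Adj (e.symm i : V) (e.symm j) ↔ i ≠ j
          constructor
          · rintro h rfl
            exact h.ne rfl
          · exact fun hne => (SameClique.trans hC (hT i).symm (hT j)).adj fun h => hne (hinj i j h))
  have hgm : g (.inl true) = m := hgS (show Sum.inl true ≠ Sum.inl false by simp)
  refine ⟨g (.inl false), ?_, fun s hs => ?_⟩
  · rw [← hgm, hg.sameClique trivial trivial]
    exact ⟨rfl, Or.inr (show true ≠ false by simp)⟩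
  · obtain ⟨i, hi⟩ : ∃ i, (e.symm i : V) = f s := ⟨e ⟨f s, s, hs, rfl⟩, by simp⟩
    have hgi : g (.inr i) = f s :=
      (hgS (show (Sum.inr i : Bool ⊕ Fin k) ≠ Sum.inl false by simp)).trans hi
    rw [← hgi, hg.adj _ trivial _ trivial]
    change E false i ↔ _
    simp only [E, hi]
    constructor
    · rintro ⟨t, ht, hts, hadj⟩
      rwa [← hf.inj ht hs hts]
    · exact fun h => ⟨s, hs, rfl, h⟩

/-- In `F_{2,2}` two vertices of a clique have opposite neighbors in a clique of the other color,
and so the image of one vertex determines the extension. -/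
theorem IsFraisseLimit.isPiecewiseUltrahomogeneous_of_classF22 {V : Type*} {G : ColoredGraph V}
    (hC : G.CliqueClasses) (h : IsFraisseLimit ClassF22 G) : G.IsPiecewiseUltrahomogeneous := by
  have hG := h.2.1
  have hone : ∀ c, G.ExactlyOne c := fun c =>
    omits_triangle_iff.1 ⟨h.omits fun hF => (hF.2 c).2.1, h.omits fun hF => (hF.2 c).2.2⟩
  have hK : ∀ c, (monoK c 2).IsRealizedIn G := fun c => h.isRealizedIn
    ⟨monoK_cliqueClasses c 2, fun d => ⟨omits_monoK_three_iff.2 (monoK_two_triFree c d),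
      omits_triangle_iff.2 (exactlyOne_of_monochromatic (fun _ => rfl) d)⟩⟩
  refine isPiecewiseUltrahomogeneous_of_extend hG hC fun m n hmn S f hS hne hSn hf hfn => ?_
  obtain ⟨p, hmp⟩ : ∃ p, G.graph.Adj m p ∧ G.color p = G.color m := by
    obtain ⟨e, he⟩ := isRealizedIn_iff.1 (hK (G.color m))
    obtain ⟨ψ, hψ, hψm⟩ := hG.exists_aut_apply (x := e 0) (y := m) (he.color 0 trivial)
    refine ⟨ψ (e 1), ?_, (hψ.2 _).trans (he.color 1 trivial)⟩
    rw [← hψm, hψ.1, he.adj 0 trivial 1 trivial]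
    exact (show (0 : Fin 2) ≠ 1 by decide)
  obtain ⟨s₀, hs₀⟩ := hne
  have hcol : ∀ s ∈ S, G.color s = G.color n := fun s hs => SameClique.color_eq (hSn hs)
  have hcolf : ∀ s ∈ S, G.color (f s) = G.color n := fun s hs => SameClique.color_eq (hfn hs)
  obtain ⟨y, hy, hys₀⟩ : ∃ y, G.SameClique m y ∧ (G.graph.Adj (f s₀) y ↔ G.graph.Adj s₀ m) := by
    by_cases hm : G.graph.Adj (f s₀) m ↔ G.graph.Adj s₀ m
    · exact ⟨m, SameClique.refl G m, hm⟩
    · refine ⟨p, ⟨hmp.2.symm, Or.inr hmp.1⟩, ?_⟩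
      have := hone (G.color m) m p (f s₀) rfl hmp.2 (by rw [hcolf s₀ hs₀]; exact hmn.symm) hmp.1
      clear * - this hm
      tauto
  refine ⟨y, hy, fun s hs => ?_⟩
  by_cases hss₀ : s = s₀
  · rw [hss₀, hys₀]
  · have hadj : G.graph.Adj s s₀ :=
      (SameClique.trans hC (SameClique.symm (hSn hs)) (hSn hs₀)).adj hss₀
    have h1 := hone (G.color n) s s₀ m (hcol s hs) (hcol s₀ hs₀) hmn hadj
    have h2 := hone (G.color n) (f s) (f s₀) y (hcolf s hs) (hcolf s₀ hs₀)
      (by rw [hy.color_eq]; exact hmn) ((hf.adj s hs s₀ hs₀).2 hadj)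
    rw [G.graph.adj_comm, h2, G.graph.adj_comm, hys₀, G.graph.adj_comm s, h1, G.graph.adj_comm]

theorem InListOne.properties {V : Type*} {G : ColoredGraph V} (hC : G.CliqueClasses)
    (h : G.InListOne) : (∀ c, G.IsIndep c ∨ G.IsSingleClique c) ∨
      G.IsPiecewiseUltrahomogeneous ∧ ∀ c, ¬ G.IsIndep c := by
  rcases h with h | ⟨r, b, hr, hb, h⟩ | h
  · exact Or.inl h
  · refine Or.inr ⟨h.isPiecewiseUltrahomogeneous_of_classG hC hr hb, fun c hc => ?_⟩
    exact omits_monoK_two_iff.2 hc (h.isRealizedIn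
      (classG_of_isSingleClique (fun d => monoK_isSingleClique c d 2) hr hb))
  · refine Or.inr ⟨h.isPiecewiseUltrahomogeneous_of_classF22 hC, fun c hc => ?_⟩
    exact omits_monoK_two_iff.2 hc (h.isRealizedIn
      ⟨monoK_cliqueClasses c 2, fun d => ⟨omits_monoK_three_iff.2 (monoK_two_triFree c d),
        omits_triangle_iff.2 (exactlyOne_of_monochromatic (fun _ => rfl) d)⟩⟩)

/-- If each color class is independent or a clique, then `G` fails to be piecewise ultrahomogeneous
exactly if a nontrivial clique is split by the vertices of an independent set. Otherwise, maximal
cliques are single vertices in both colors or whole color classes in both colors. -/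
theorem IsAdmissible.isPiecewiseUltrahomogeneous_iff_not_isMixed {V : Type*} {G : ColoredGraph V}
    (h : G.IsAdmissible) (hall : ∀ c, G.IsIndep c ∨ G.IsSingleClique c) :
    G.IsPiecewiseUltrahomogeneous ↔ ¬ G.IsMixed := by
  constructor
  · rintro hpu ⟨c, hc, ⟨u, hu, v, hv, huv⟩, hi, -⟩
    obtain ⟨hs, b, hb⟩ := h.splits c fun hi' => hi' u v hu hv (hc u v hu hv huv)
    obtain ⟨⟨x, hx, hbx⟩, y, hy, hby⟩ := hs b u hb hu
    refine not_isPiecewiseUltrahomogeneous_of_isIndep h.cliques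
      (SameClique.trans h.cliques hx.symm hy) ?_ ?_ hbx hby hpu
    · rw [hx.color_eq, show G.color u = c from hu]
      exact hb.symm
    · rwa [color_ne_iff_eq_other.1 hb]
  · intro hmix
    have hsub : ∀ c, (∀ c, G.IsIndep c) ∨ (∀ c, G.IsSingleClique c) ∨
        ¬ (G.IsSingleClique c ∧ G.IsIndep c.other) := by
      intro c
      by_contra! hcon
      obtain ⟨h1, h2, hc, hi⟩ := hcon
      have hcases : ∀ {P : Color → Prop}, P c → P c.other → ∀ d, P d := fun {P} hp hp' d => by
        by_cases hd : d = c
        · rwa [hd]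
        · rwa [color_ne_iff_eq_other.1 hd]
      refine hmix ⟨c, hc, ?_, hi, ?_⟩
      · by_contra hnt
        rw [Set.not_nontrivial_iff] at hnt
        obtain ⟨d, hd⟩ := h1
        exact hd (hcases (P := G.IsIndep) (fun u v hu hv huv => huv.ne (hnt hu hv)) hi d)
      · by_contra hnt
        rw [Set.not_nontrivial_iff] at hnt
        obtain ⟨d, hd⟩ := h2
        exact hd (hcases (P := G.IsSingleClique) hc
          (fun u v hu hv huv => absurd (hnt hu hv) huv) d)
    have huniform : (∀ c, G.IsIndep c) ∨ ∀ c, G.IsSingleClique c := by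
      rcases hsub .red with h1 | h1 | h1
      · exact Or.inl h1
      · exact Or.inr h1
      rcases hsub .blue with h2 | h2 | h2
      · exact Or.inl h2
      · exact Or.inr h2
      rcases hall .red with hr | hr <;> rcases hall .blue with hb | hb
      · exact Or.inl (by rintro (_ | _) <;> assumption)
      · exact absurd ⟨hb, hr⟩ h2
      · exact absurd ⟨hr, hb⟩ h1
      · exact Or.inr (by rintro (_ | _) <;> assumption)
    refine (isPiecewiseUltrahomogeneous_iff h.cliques).2 fun m n hmn =>
      isUltrahomogeneous_induce fun S f hS hSP hf hfP => ?_
    rcases huniform with hi | hk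
    · -- both cliques are single vertices, so `f` is the identity
      refine ⟨Equiv.refl V, ⟨fun _ _ => Iff.rfl, fun _ => rfl⟩, fun _ => Iff.rfl, fun v hv => ?_⟩
      have hsing : ∀ {a x}, G.SameClique a x → a = x := fun {a x} hax => by
        by_contra hne
        exact hi _ a x rfl hax.color_eq (hax.adj hne)
      have h1 := hf.color v hv
      rcases hSP hv with hvm | hvn <;> rcases hfP hv with hfm | hfn
      · exact (hsing hvm).symm.trans (hsing hfm)
      · exact absurd ((SameClique.color_eq hvm).symm.trans
          (h1.symm.trans (SameClique.color_eq hfn))) hmn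
      · exact absurd ((SameClique.color_eq hfm).symm.trans
          (h1.trans (SameClique.color_eq hvn))) hmn
      · exact (hsing hvn).symm.trans (hsing hfn)
    · -- the two cliques cover the graph
      have huniv : ∀ v, v ∈ G.cliqueOf m ∪ G.cliqueOf n := fun v => by
        by_cases hv : G.color v = G.color n
        · exact Or.inr ⟨hv.symm, or_iff_not_imp_left.2 (hk _ n v hv.symm rfl)⟩
        · have hv' := color_eq_of_ne_of_ne hmn hv
          exact Or.inl ⟨hv', or_iff_not_imp_left.2 (hk _ m v hv' rfl)⟩
      obtain ⟨ψ, hψ, hψS⟩ := h.uh.exists_aut hS hf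
      exact ⟨ψ, hψ, fun v => iff_of_true (huniv _) (huniv _), hψS⟩

theorem isPiecewiseUltrahomogeneous_swap_iff {V : Type*} {G : ColoredGraph V}
    (h : G.IsAdmissible) : G.swap.IsPiecewiseUltrahomogeneous ↔ G.IsPiecewiseUltrahomogeneous := by
  rw [isPiecewiseUltrahomogeneous_iff h.cliques, isPiecewiseUltrahomogeneous_iff h.swap.cliques]
  have hcl : ∀ u, G.swap.cliqueOf u = G.cliqueOf u := fun u => Set.ext fun v => sameClique_swap_iff
  refine forall_congr' fun m => forall_congr' fun n =>
    imp_congr (not_congr swap_color_eq_color_iff) ?_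
  rw [hcl m, hcl n]
  exact isUltrahomogeneous_swap_iff (G := G.induce (G.cliqueOf m ∪ G.cliqueOf n))

theorem forall_swap_iff {V : Type*} {G : ColoredGraph V} :
    (∀ c, G.swap.IsIndep c ∨ G.swap.IsSingleClique c) ↔ ∀ c, G.IsIndep c ∨ G.IsSingleClique c := by
  simp only [isIndep_swap_iff, isSingleClique_swap_iff]
  exact ⟨fun h c => by simpa only [other_other] using h c.other, fun h c => h _⟩

/-- An admissible graph lies in exactly one of the two lists, which also decides whether it is
piecewise ultrahomogeneous. The lists are disjoint because membership in the second one prevents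
piecewise ultrahomogeneity and makes some color class neither independent nor a clique. -/
theorem IsAdmissible.classification {V : Type*} [Countable V] [Infinite V] {G : ColoredGraph V}
    (h : G.IsAdmissible) :
    (UpToSwap InListOne G ∧
        ¬ UpToSwap InListTwo G ∧
        (G.IsPiecewiseUltrahomogeneous ↔ ¬ G.IsMixed)) ∨
      (UpToSwap InListTwo G ∧
        ¬ UpToSwap InListOne G ∧
        ¬ G.IsPiecewiseUltrahomogeneous) := by
  have hpu := isPiecewiseUltrahomogeneous_swap_iff h
  have htwo : UpToSwap InListTwo G → ¬ G.IsPiecewiseUltrahomogeneous ∧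
      ¬ ∀ c, G.IsIndep c ∨ G.IsSingleClique c := by
    rintro (h2 | h2)
    · exact h2.properties h.cliques
    · have := h2.properties h.swap.cliques
      rwa [hpu, forall_swap_iff] at this
  have hone : UpToSwap InListOne G → (∀ c, G.IsIndep c ∨ G.IsSingleClique c) ∨
      G.IsPiecewiseUltrahomogeneous ∧ ∀ c, ¬ G.IsIndep c := by
    rintro (h1 | h1)
    · exact h1.properties h.cliques
    · have := h1.properties h.swap.cliques
      rw [hpu, forall_swap_iff] at this
      refine this.imp_right fun h' => ⟨h'.1, fun c hc => h'.2 c.other ?_⟩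
      rwa [isIndep_swap_iff, other_other]
  have hdisj : UpToSwap InListOne G → ¬ UpToSwap InListTwo G := fun h1 h2 =>
    (hone h1).elim (htwo h2).2 fun h' => (htwo h2).1 h'.1
  rcases h.upToSwap with h1 | h2
  · refine Or.inl ⟨h1, hdisj h1, ?_⟩
    rcases hone h1 with hall | ⟨hpu', hni⟩
    · exact h.isPiecewiseUltrahomogeneous_iff_not_isMixed hall
    · exact iff_of_true hpu' fun ⟨c, _, _, hi, _⟩ => hni _ hi
  · exact Or.inr ⟨h2, fun h1 => hdisj h1 h2, (htwo h2).1⟩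

end ColoredGraph

theorem theoremB {V : Type*} [Countable V] [Infinite V] (G : ColoredGraph V)
    (hG : G.IsUltrahomogeneous)
    (hcliques : ∀ c : Color, G.IsCliqueUnion c)
    (hblowUp : ¬ G.IsBlowUp) :
    (ColoredGraph.UpToSwap ColoredGraph.InListOne G ∧
        ¬ ColoredGraph.UpToSwap ColoredGraph.InListTwo G ∧
        (G.IsPiecewiseUltrahomogeneous ↔ ¬ G.IsMixed)) ∨
      (ColoredGraph.UpToSwap ColoredGraph.InListTwo G ∧
        ¬ ColoredGraph.UpToSwap ColoredGraph.InListOne G ∧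
        ¬ G.IsPiecewiseUltrahomogeneous) :=
  ColoredGraph.IsAdmissible.classification
    ⟨hG, hcliques, fun _ hc => ColoredGraph.splits_of_not_isBlowUp hG hcliques hblowUp hc⟩
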